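/- **Setting.** Let $d\in\{2,3\}$, $k\ge 1$, and let $\Omega\subset\mathbb R^d$ be a bounded open polytopic set. Let $D\in L^\infty(\Omega)^{d\times d}$ be symmetric and uniformly positive definite, and let $\mu\in L^\infty(\Omega)$ with $\mu\ge 0$. Let $\theta\in[-1,1]$ and $\kappa>0$. Let $\mathcal P$ be a finite partition of $\Omega$ into polytopic elements $K$ of diameter $H_K$. Each $K$ is star-shaped with respect to a ball of radius $\rho_K$ with $H_K\le C_{\rm star}\rho_K$, and carries a conforming triangulation $\mathcal T_K$ into simplices $T$ of diameter $h_T$ and inradius $\rho_T$ with $h_T\le C_{\rm sh}\rho_T$. If $T\in\mathcal T_K$ has a facet on $\partial K$ and $K'$ is the element on the other side of that facet, then $h_T\le H_{K'}$. Triangulations of different elements need not match. Assume that $D|_K$ has a trace on $\partial K$ for each $K$ (an essential limit from inside $K$ at almost every point of $\partial K$). Write $\Gamma=\bigcup_K\partial K$, let $\{\cdot\}$ and $[\cdot]$ be the usual averages and (normal) jumps on $\Gamma$, and let $\nabla$ denote the elementwise (or simplexwise) gradient. Let $V_{\mathcal P}$ be the space of functions that are polynomials of degree at most $k$ on each $K$.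 Let $W_{\mathcal T}$ be the space of functions that are, on each $K$, continuous and polynomial of degree at most $k$ on each $T\in\mathcal T_K$. With $\delta_K=\|D\|_{L^\infty(K)}^2\|D^{-1}\|_{L^\infty(K)}$, let $$\sigma|_F=\frac{8C_{\rm star}\,k(k-1+d)}{d}\max_{*\in\{+,-\}}\delta_{K_*}H_{K_*}^{-1}$$ on the part $F$ of $\Gamma$ between $K_+$ and $K_-$ (on $\partial\Omega$, with the single adjacent element only). Set $$a_{DG}(w,v)=\int_\Omega (D\nabla w\cdot\nabla v+\mu wv)\,dx+\int_\Gamma\sigma[w]\cdot[v]\,ds-\int_\Gamma\big(\{D\nabla w\}\cdot[v]+\theta\{D\nabla v\}\cdot[w]\big)\,ds,$$ $$\|v\|_{DG}^2=\int_\Omega (D\nabla v\cdot\nabla v+\mu v^2)\,dx+\int_\Gamma\sigma|[v]|^2\,ds.$$ Let $x_i^T$ be the Lagrange nodes of degree $k$ of $T$ and $\phi_i^T$ the corresponding Lagrange basis functions on $T$. Define $E^+(v)=\sum_i\max\{0,\min\{v(x_i^T),\kappa\}\}\,\phi_i^T$ on each $T$, and $E^-(v)=v-E^+(v)$. Let $\omega_K$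 be the union of $K$ and the elements sharing a facet with $K$. For an elementwise constant $\alpha>0$ let $$s(w,v)=\sum_{K}\alpha|_K\sum_{T\in\mathcal T_K}\sum_i\big(\|D\|_{L^\infty(\omega_K)}h_T^{d-2}+\|\mu\|_{L^\infty(T)}h_T^d\big)\,w(x_i^T)\,v(x_i^T),\qquad \|v\|_s^2=s(v,v).$$ Let $C_{\rm equiv}>0$ be a constant such that $\|v\|_{DG}^2\le C_{\rm equiv}\|\alpha^{-1/2}v\|_s^2$ for all $v\in W_{\mathcal T}$ (this condition does not depend on $\alpha$). **Theorem 11 (Well-posedness).** A constant $C_{\rm equiv}$ as above exists which depends only on $d$, $k$, $C_{\rm star}$, $C_{\rm sh}$ and an upper bound $\chi$ for $\max_K\|D\|_{L^\infty(K)}\|D^{-1}\|_{L^\infty(K)}$. Moreover, for any such constant $C_{\rm equiv}$ and any $\gamma\ge 25\,C_{\rm equiv}$, let $$\alpha|_K=\gamma\max\Big\{1,\frac{H_K}{8C_{\rm star}}\max\frac{|f|}{|T|}\Big\},$$ the inner maximum being over the simplices $T\in\mathcal T_K$ and the facets $f$ of $T$ with $f\subset\partial K$. Then $\|\cdot\|_{DG}$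 is definite on $V_{\mathcal P}$, and the operator $T:V_{\mathcal P}\to V_{\mathcal P}'$ given by $$[Tu,v]=a_{DG}(E^+(u),v)+s(E^-(u),v)$$ is continuous and strongly monotone with respect to $\|\cdot\|_{DG}$. Consequently, for every linear functional $\ell$ on $V_{\mathcal P}$, in particular for $\ell(v)=\int_\Omega fv\,dx$ with $f\in L^2(\Omega)$, there is exactly one $u_H\in V_{\mathcal P}$ with $a_{DG}(E^+(u_H),v)+s(E^-(u_H),v)=\ell(v)$ for all $v\in V_{\mathcal P}$. -/

import Mathlib

open MeasureTheory Filter Topology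
open scoped ENNReal Matrix.Norms.L2Operator RealInnerProductSpace Gradient

noncomputable section

namespace BPDG

/-- Euclidean space `ℝ^d`. -/
abbrev E (d : ℕ) : Type := EuclideanSpace ℝ (Fin d)

/-- A nondegenerate `d`-simplex in `ℝ^d`, given by its `d + 1` vertices; `T.coord j` is the
`j`-th barycentric coordinate. -/
abbrev Simplex (d : ℕ) : Type := AffineBasis (Fin (d + 1)) ℝ (E d)

/-! ### Simplices, polynomials, Lagrange nodes and Lagrange basis -/

/-- The closed simplex. -/
def body {d : ℕ} (T : Simplex d) : Set (E d) := convexHull ℝ (Set.range T)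

/-- The (closed) facet opposite to the vertex `j`. -/
def facet {d : ℕ} (T : Simplex d) (j : Fin (d + 1)) : Set (E d) := convexHull ℝ (T '' {j}ᶜ)

/-- The outward unit normal of `T` on the facet opposite to the vertex `j`: the barycentric
coordinate of `j` vanishes on that facet and is positive inside `T`. -/
def normal {d : ℕ} (T : Simplex d) (j : Fin (d + 1)) : E d :=
  -(‖∇ (fun x => T.coord j x) 0‖⁻¹ • ∇ (fun x => T.coord j x) 0)

/-- The real polynomial functions on `ℝ^d` of total degree at most `k`. -/
def polys (d k : ℕ) : Submodule ℝ (E d → ℝ) :=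
  (MvPolynomial.restrictTotalDegree (Fin d) ℝ k).map
    (LinearMap.pi fun x : E d => (MvPolynomial.aeval (fun j => x j)).toLinearMap)

/-- The indices of the Lagrange nodes of degree `k`: multi-indices `a` on the vertices, `|a| = k`. -/
def nodeIdx (d k : ℕ) : Finset (Fin (d + 1) → ℕ) := Finset.piAntidiag Finset.univ k

/-- The Lagrange node with barycentric coordinates `a / k`. -/
def node {d : ℕ} (T : Simplex d) (k : ℕ) (a : Fin (d + 1) → ℕ) : E d :=
  ∑ j, ((a j : ℝ) / (k : ℝ)) • T j

/-- The Lagrange basis function of degree `k` belonging to the node with index `a`. -/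
def lagrange {d : ℕ} (T : Simplex d) (k : ℕ) (a : Fin (d + 1) → ℕ) : E d → ℝ :=
  fun x => ∏ j, ∏ l ∈ Finset.range (a j), ((k : ℝ) * T.coord j x - l) / ((a j : ℝ) - l)

/-- The `L^∞(S)`-norm; for matrix-valued `f`, with the spectral norm of matrices. -/
def supNorm {d : ℕ} {F : Type*} [NormedAddCommGroup F] (f : E d → F) (S : Set (E d)) : ℝ :=
  (eLpNormEssSup f (volume.restrict S)).toReal

/-! ### Polytopic meshes with simplicial submeshes -/

/-- A polytopic mesh with `N` elements of a bounded open polytopic set `Ω`; the element `i` is the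
union of the simplices `T i t`, `t < n i`, of a conforming local triangulation.  No conformity is
required between different elements. -/
structure PolytopicMesh (d : ℕ) where
  Ω : Set (E d)
  isOpen_Ω : IsOpen Ω
  N : ℕ
  n : Fin N → ℕ
  T : (i : Fin N) → Fin (n i) → Simplex d
  /-- Distinct simplices of one element are different, and meet in the simplex (possibly empty)
  spanned by their common vertices. -/
  conforming : ∀ i t t', t ≠ t' → Set.range (T i t) ≠ Set.range (T i t') ∧
    body (T i t) ∩ body (T i t') ⊆ convexHull ℝ (Set.range (T i t) ∩ Set.range (T i t'))
  interior_disjoint : ∀ i i', i ≠ i' →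
    Disjoint (interior (⋃ t, body (T i t))) (interior (⋃ t, body (T i' t)))
  interior_subset : ∀ i, interior (⋃ t, body (T i t)) ⊆ Ω
  closure_Ω : closure Ω = ⋃ i, ⋃ t, body (T i t)

namespace PolytopicMesh

variable {d : ℕ} (M : PolytopicMesh d)

/-- The polytopic element `i`, as a closed set. -/
def K (i : Fin M.N) : Set (E d) := ⋃ t, body (M.T i t)

/-- The diameter of the element `i`. -/
def H (i : Fin M.N) : ℝ := Metric.diam (M.K i)

/-- The diameter of the simplex `t` of the element `i`. -/
def h (i : Fin M.N) (t : Fin (M.n i)) : ℝ := Metric.diam (body (M.T i t))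

/-- The facet `F = (t, j)` of the submesh of the element `i`. -/
def face (i : Fin M.N) (F : Fin (M.n i) × Fin (d + 1)) : Set (E d) := facet (M.T i F.1) F.2

/-- The outward unit normal on the facet `F`; if `F` lies on the boundary of the element `i`,
this is the outward unit normal of that element. -/
def nrm (i : Fin M.N) (F : Fin (M.n i) × Fin (d + 1)) : E d := normal (M.T i F.1) F.2

open Classical in
/-- The facets of simplices of the element `i` that lie on the boundary of the element. -/
def bdFaces (i : Fin M.N) : Finset (Fin (M.n i) × Fin (d + 1)) :=
  Finset.univ.filter fun F => M.face i F ⊆ frontier (M.K i)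

/-- The elements sharing a facet with the element `i`, including `i` itself. -/
def neighbours (i : Fin M.N) : Set (Fin M.N) :=
  {i' | i' = i ∨ 0 < μHE[d - 1] (M.K i ∩ M.K i' ∩ M.Ω)}

/-- The integral over the skeleton `Γ_P`, of an integrand which is `g` on the part between two
elements and `b` on the part on `∂Ω`.  The skeleton is covered by the boundary facets of the
elements' submeshes; the interior part is counted once from each of its two sides, whence the
factor `1/2` (`g` is symmetric in the two sides for all integrands used here). -/
def skeletonIntegral
    (g : (i : Fin M.N) → Fin (M.n i) × Fin (d + 1) →
      (i' : Fin M.N) → Fin (M.n i') × Fin (d + 1) → E d → ℝ)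
    (b : (i : Fin M.N) → Fin (M.n i) × Fin (d + 1) → E d → ℝ) : ℝ :=
  (1 / 2) * (∑ i, ∑ i' ∈ Finset.univ.erase i, ∑ F ∈ M.bdFaces i, ∑ F' ∈ M.bdFaces i',
      ∫ x in M.face i F ∩ M.face i' F' ∩ M.Ω, g i F i' F' x ∂μHE[d - 1])
    + ∑ i, ∑ F ∈ M.bdFaces i, ∫ x in M.face i F ∩ frontier M.Ω, b i F x ∂μHE[d - 1]

/-! ### Discrete spaces -/

/-- Families of functions, one for each simplex of the submesh.  A polynomial on a simplex or on
an element is represented by its unique polynomial extension to `ℝ^d`, so that its trace and the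
trace of its gradient on the boundary are its values there. -/
abbrev Broken : Type := (i : Fin M.N) → Fin (M.n i) → E d → ℝ

/-- The space `V_P` of elementwise polynomials of degree at most `k`. -/
def VP (k : ℕ) : Submodule ℝ (Fin M.N → E d → ℝ) := Submodule.pi Set.univ fun _ => polys d k

/-- An element of `V_P` as a family over the submesh. -/
def toBroken (v : Fin M.N → E d → ℝ) : M.Broken := fun i _ => v i

/-- The space `W_T`: on every element continuous, on every simplex polynomial of degree at
most `k`. -/
def WT (k : ℕ) : Set M.Broken :=
  {w | (∀ i t, w i t ∈ polys d k) ∧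
    ∀ i t t', ∀ x ∈ body (M.T i t) ∩ body (M.T i t'), w i t x = w i t' x}

/-- The nodally bound-preserving recovery operator `E⁺`. -/
def Eplus (k : ℕ) (κ : ℝ) (v : Fin M.N → E d → ℝ) : M.Broken := fun i t x =>
  ∑ a ∈ nodeIdx d k, max 0 (min (v i (node (M.T i t) k a)) κ) * lagrange (M.T i t) k a x

/-- The complement `E⁻(v) = v - E⁺(v)`. -/
def Eminus (k : ℕ) (κ : ℝ) (v : Fin M.N → E d → ℝ) : M.Broken :=
  M.toBroken v - M.Eplus k κ v

/-- The jump of `v` at a point common to the boundary facets `F` of `i` and `F'` of `i'`. -/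
def jump (v : M.Broken) (i : Fin M.N) (F : Fin (M.n i) × Fin (d + 1))
    (i' : Fin M.N) (F' : Fin (M.n i') × Fin (d + 1)) (x : E d) : E d :=
  v i F.1 x • M.nrm i F + v i' F'.1 x • M.nrm i' F'

/-- The jump of `v` on a boundary facet `F ⊆ ∂Ω` of the element `i`. -/
def jumpBd (v : M.Broken) (i : Fin M.N) (F : Fin (M.n i) × Fin (d + 1)) (x : E d) : E d :=
  v i F.1 x • M.nrm i F

end PolytopicMesh

/-! ### Coefficients of the elliptic problem -/

/-- The coefficients of `-div (D ∇u) + μ u = f` on the mesh `M`: `D ∈ L^∞(Ω)^{d×d}` symmetric and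
uniformly positive definite, `μ ∈ L^∞(Ω)` nonnegative.  For the integrals of `D ∇v` over the
skeleton to make sense, `D` has on the boundary of each element `i` a trace from inside,
`Dtr i`, namely its essential limit at almost every point of that boundary. -/
structure Coeff {d : ℕ} (M : PolytopicMesh d) where
  D : E d → Matrix (Fin d) (Fin d) ℝ
  μ : E d → ℝ
  Dtr : Fin M.N → E d → Matrix (Fin d) (Fin d) ℝ
  D_memLp : ∀ a b, MemLp (fun x => D x a b) ∞ (volume.restrict M.Ω)
  D_symm : ∀ᵐ x ∂volume.restrict M.Ω, (D x).IsSymm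
  D_pos : ∃ D₀ : ℝ, 0 < D₀ ∧ ∀ᵐ x ∂volume.restrict M.Ω, ∀ y : E d,
    D₀ * ‖y‖ ^ 2 ≤ ⟪y, Matrix.toEuclideanCLM (𝕜 := ℝ) (D x) y⟫
  μ_memLp : MemLp μ ∞ (volume.restrict M.Ω)
  μ_nonneg : ∀ᵐ x ∂volume.restrict M.Ω, 0 ≤ μ x
  Dtr_measurable : ∀ i a b, Measurable fun x => Dtr i x a b
  Dtr_trace : ∀ i, ∀ᵐ x ∂(μHE[d - 1] : Measure (E d)).restrict (frontier (M.K i)),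
    Tendsto D (𝓝[M.K i] x ⊓ ae volume) (𝓝 (Dtr i x))

namespace Coeff

variable {d : ℕ} {M : PolytopicMesh d} (c : Coeff M)

/-- `δ_K = ‖D‖²_{∞,K} ‖D⁻¹‖_{∞,K}`. -/
def δ (i : Fin M.N) : ℝ :=
  supNorm c.D (M.K i) ^ 2 * supNorm (fun x => (c.D x)⁻¹) (M.K i)

/-- The factor `8 C_star k (k - 1 + d) / d` of the penalty. -/
def penFactor (d k : ℕ) (Cstar : ℝ) : ℝ := 8 * Cstar * k * ((k : ℝ) - 1 + d) / d

/-- The penalty `σ_P` on the interface between the elements `i` and `i'`. -/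
def σ (k : ℕ) (Cstar : ℝ) (i i' : Fin M.N) : ℝ :=
  penFactor d k Cstar * max (c.δ i * (M.H i)⁻¹) (c.δ i' * (M.H i')⁻¹)

/-- The penalty `σ_P` on the part of the boundary of the element `i` on `∂Ω`. -/
def σBd (k : ℕ) (Cstar : ℝ) (i : Fin M.N) : ℝ :=
  penFactor d k Cstar * (c.δ i * (M.H i)⁻¹)

/-- The trace of `D ∇v` from inside the simplex `t` of the element `i`. -/
def flux (v : M.Broken) (i : Fin M.N) (t : Fin (M.n i)) (x : E d) : E d :=
  Matrix.toEuclideanCLM (𝕜 := ℝ) (c.Dtr i x) (∇ (v i t) x)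

/-- The average of `D ∇v` at a point common to boundary facets of the elements `i` and `i'`. -/
def avgFlux (v : M.Broken) (i : Fin M.N) (F : Fin (M.n i) × Fin (d + 1))
    (i' : Fin M.N) (F' : Fin (M.n i') × Fin (d + 1)) (x : E d) : E d :=
  (1 / 2 : ℝ) • (c.flux v i F.1 x + c.flux v i' F'.1 x)

/-- The volume part `∫_Ω D ∇w · ∇v + μ w v` with broken gradients. -/
def volumeForm (w v : M.Broken) : ℝ :=
  ∑ i, ∑ t, ∫ x in body (M.T i t),
    (⟪Matrix.toEuclideanCLM (𝕜 := ℝ) (c.D x) (∇ (w i t) x), ∇ (v i t) x⟫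
      + c.μ x * w i t x * v i t x)

/-- The penalty part `∫_{Γ_P} σ_P [w] · [v]`. -/
def penaltyForm (k : ℕ) (Cstar : ℝ) (w v : M.Broken) : ℝ :=
  M.skeletonIntegral
    (fun i F i' F' x => c.σ k Cstar i i' * ⟪M.jump w i F i' F' x, M.jump v i F i' F' x⟫)
    (fun i F x => c.σBd k Cstar i * ⟪M.jumpBd w i F x, M.jumpBd v i F x⟫)

/-- The consistency part `∫_{Γ_P} {D ∇w} · [v]`. -/
def consistencyForm (w v : M.Broken) : ℝ :=
  M.skeletonIntegral
    (fun i F i' F' x => ⟪c.avgFlux w i F i' F' x, M.jump v i F i' F' x⟫)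
    (fun i F x => ⟪c.flux w i F.1 x, M.jumpBd v i F x⟫)

/-- The interior penalty form `a_DG`. -/
def aDG (k : ℕ) (Cstar θ : ℝ) (w v : M.Broken) : ℝ :=
  c.volumeForm w v + c.penaltyForm k Cstar w v
    - (c.consistencyForm w v + θ * c.consistencyForm v w)

/-- The DG-norm. -/
def dgNorm (k : ℕ) (Cstar : ℝ) (v : M.Broken) : ℝ :=
  √(c.volumeForm v v + c.penaltyForm k Cstar v v)

/-- The stabilisation weight of the simplex `t` of the element `i`, without the factor `α`:
`‖D‖_{∞,ω_K} h_T^{d-2} + ‖μ‖_{∞,T} h_T^d`. -/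
def weight (i : Fin M.N) (t : Fin (M.n i)) : ℝ :=
  supNorm c.D (⋃ i' ∈ M.neighbours i, M.K i') * M.h i t ^ (d - 2)
    + supNorm c.μ (body (M.T i t)) * M.h i t ^ d

/-- The stabilising bilinear form `s` with elementwise constant factor `α`. -/
def stab (k : ℕ) (α : Fin M.N → ℝ) (w v : M.Broken) : ℝ :=
  ∑ i, α i * ∑ t, ∑ a ∈ nodeIdx d k,
    c.weight i t * w i t (node (M.T i t) k a) * v i t (node (M.T i t) k a)

/-- The semilinear form `a_h(u; v) = a_DG(E⁺(u), v) + s(E⁻(u), v)` of the bound-preserving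
method. -/
def ah (k : ℕ) (Cstar θ κ : ℝ) (α : Fin M.N → ℝ) (u v : Fin M.N → E d → ℝ) : ℝ :=
  c.aDG k Cstar θ (M.Eplus k κ u) (M.toBroken v) + c.stab k α (M.Eminus k κ u) (M.toBroken v)

/-- `C` is a constant `C_equiv`: `‖v‖²_DG ≤ C ‖α^{-1/2} v‖_s²` for all `v ∈ W_T`.  The factor
`α^{-1/2}` cancels the factor `α` of `s`, so that the right-hand side is `s(v, v)` with `α = 1`,
whatever `α` is. -/
def IsEquivConst (k : ℕ) (Cstar C : ℝ) : Prop :=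
  ∀ v ∈ M.WT k, c.dgNorm k Cstar v ^ 2 ≤ C * c.stab k (fun _ => 1) v v

end Coeff

/-- The choice of the factor `α`:
`α|_K = γ max {1, H_K / (8 C_star) max |f| / |T|}`, where the inner maximum is over the simplices
`T` of `K` with a facet `f` on the boundary of `K`. -/
def alphaChoice {d : ℕ} (M : PolytopicMesh d) (Cstar γ : ℝ) (i : Fin M.N) : ℝ :=
  γ * max 1 (M.H i / (8 * Cstar) *
    ⨆ F : {F // F ∈ M.bdFaces i},
      (μHE[d - 1] (M.face i F.1)).toReal / (volume (body (M.T i F.1.1))).toReal)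

/-- The standing mesh assumptions with constants `Cstar` and `Csh`, and a bound `χ` for the
elementwise contrast of the diffusion tensor. -/
structure Admissible {d : ℕ} (M : PolytopicMesh d) (c : Coeff M) (Cstar Csh χ : ℝ) : Prop where
  /-- Every element is star-shaped with respect to a ball of radius `ρ` with `H_K ≤ Cstar ρ`. -/
  star : ∀ i, ∃ (z : E d) (ρ : ℝ), 0 < ρ ∧ Metric.closedBall z ρ ⊆ M.K i ∧
    (∀ y ∈ Metric.closedBall z ρ, StarConvex ℝ y (M.K i)) ∧ M.H i ≤ Cstar * ρ
  /-- Every simplex contains a ball of radius `ρ` with `h_T ≤ Csh ρ`. -/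
  shape : ∀ i t, ∃ (z : E d) (ρ : ℝ), 0 < ρ ∧ Metric.closedBall z ρ ⊆ body (M.T i t) ∧
    M.h i t ≤ Csh * ρ
  /-- A simplex with a facet on the boundary of its element is not coarser than the element on
  the other side of that facet. -/
  neighbour : ∀ i i', i ≠ i' → ∀ F ∈ M.bdFaces i,
    0 < μHE[d - 1] (M.face i F ∩ M.K i' ∩ M.Ω) → M.h i F.1 ≤ M.H i'
  contrast : ∀ i, supNorm c.D (M.K i) * supNorm (fun x => (c.D x)⁻¹) (M.K i) ≤ χ

/-! ### Nonlinear operators into the dual space -/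

/-- Continuity of `A : V → V'`, for the norm `ν` of `V` and the dual norm of `V'`. -/
def IsContinuousOp {V : Type*} [AddCommGroup V] [Module ℝ V] (ν : V → ℝ)
    (A : V → Module.Dual ℝ V) : Prop :=
  ∀ u, ∀ ε > 0, ∃ η > 0, ∀ w, ν (w - u) < η → ∀ z, |A w z - A u z| ≤ ε * ν z

/-- Strong monotonicity of `A : V → V'`, for the norm `ν` of `V`. -/
def IsStronglyMonotone {V : Type*} [AddCommGroup V] [Module ℝ V] (ν : V → ℝ)
    (A : V → Module.Dual ℝ V) : Prop :=
  ∃ m > 0, ∀ u w, m * ν (u - w) ^ 2 ≤ A u (u - w) - A w (u - w)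

end BPDG

end

/-! The theorem rests on strong monotonicity. For two arguments put `e = u - w` and `e⁻ = E⁻(u) -
E⁻(w)`. The difference of the operators tested with `e` is `a_DG(e - e⁻, e) + s(e⁻, e)`. Since
truncation to `[0, κ]` is monotone and 1-Lipschitz at every node, `s(e⁻, e) ≥ s(e⁻, e⁻)`
(`stab_Eminus_le`). It remains to absorb `a_DG(e⁻, e)` and the consistency terms of `a_DG(e, e)`
into `‖e‖²_DG` and `s(e⁻, e⁻)`, which is `ipForm_add_stabForm_ge`.

The consistency terms are controlled by Young's inequality with the weight `σ`, so that only the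
boundary fluxes weighted by `σ⁻¹` need a bound. For `e`, a polynomial on all of `K`, the flux is at
most `d/8` times the volume energy (`fluxNorm_toBroken_le`): the penalty is tuned to a trace
inequality on the star-shaped element. For `e⁻`, a polynomial only on each simplex, the trace
inequality on the simplex costs `|f|/|T|`; this loss is what the second entry of the maximum in `α`
compensates (`fluxNorm_le`). The condition `γ ≥ 25 C_equiv` makes the energy of `e⁻` a small
fraction of `s(e⁻, e⁻)`.

Both trace inequalities come from the sharp inequality `sq_eval_one_le` on the unit interval, with
weight `t^(d-1)`, integrated over the rays of a cone over a facet (`lintegral_sq_le_cone`). On an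
element the apex is the centre of the ball of star-shapedness, the cones over the boundary facets
are disjoint, and all facet planes have distance at least `ρ` from the apex.

The constant `C_equiv` comes from scaling: the Lagrange basis is a fixed function of barycentric
coordinates, whose gradients are at most the inverse inradius, and the condition `h_T ≤ H_{K'}`
bounds the penalty on a facet of `T` by data of the patch divided by `h_T` (`exists_isEquivConst`).

A function in `V_P` of zero DG-norm is constant on each element, has no jumps and vanishes on the
boundary. A generic segment leaving the union of the elements that carry one given value shows that
this value is zero (`eq_zero_of_no_jumps`). So the DG-norm is a Hilbert norm on a finite-dimensional
space, where the operator is Lipschitz because its nonlinearity acts on finitely many nodal values;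
Zarantonello's theorem gives unique solvability. -/

namespace BPDG

/-! ### The sharp weighted endpoint inequality on the unit interval. -/

section OneDim

open Polynomial

theorem integral_derivative_mul (p q : ℝ[X]) :
    ∫ t in (0 : ℝ)..1, (p * derivative q).eval t =
      (p * q).eval 1 - (p * q).eval 0 - ∫ t in (0 : ℝ)..1, (derivative p * q).eval t := by
  have h1 : ∫ t in (0 : ℝ)..1, (derivative (p * q)).eval t = (p * q).eval 1 - (p * q).eval 0 :=
    intervalIntegral.integral_eq_sub_of_hasDerivAt (fun x _ => (p * q).hasDerivAt x)
      ((derivative (p * q)).continuous.intervalIntegrable _ _)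
  rw [← h1, ← intervalIntegral.integral_sub ((derivative (p * q)).continuous.intervalIntegrable _ _)
    ((derivative p * q).continuous.intervalIntegrable _ _)]
  congr 1
  ext t
  simp only [derivative_mul, eval_add, eval_mul]
  ring

/-- The polynomial whose derivatives yield, à la Rodrigues, the endpoint evaluation kernel. -/
noncomputable def rodrigues (n m : ℕ) : ℝ[X] := X ^ (n + m + 1) * (X - C 1) ^ n

theorem rodrigues_iterate_eval_zero (n m j : ℕ) (hj : j ≤ n + m) :
    (derivative^[j] (rodrigues n m)).eval 0 = 0 := by
  have h : X ^ (n + m + 1) ∣ rodrigues n m := Dvd.intro _ rfl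
  have h2 := pow_sub_dvd_iterate_derivative_of_pow_dvd j h
  have h3 : (X : ℝ[X]) ∣ derivative^[j] (rodrigues n m) :=
    (dvd_pow_self _ (by omega)).trans h2
  obtain ⟨r, hr⟩ := h3
  simp [hr]

/-- Expanding about 1 replaces `X - 1` by `X`, and derivatives at 1 become Taylor coefficients. In
particular they vanish for `j < n`. -/
theorem rodrigues_iterate_eval_one (n m j : ℕ) :
    (derivative^[j] (rodrigues n m)).eval 1 =
      (j.factorial : ℝ) * ((X + C 1) ^ (n + m + 1) * X ^ n : ℝ[X]).coeff j := by
  have h := congrArg (fun f => (f (rodrigues n m)).eval 1) (factorial_smul_hasseDeriv (R := ℝ) j)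
  simp only [LinearMap.smul_apply, eval_smul] at h
  rw [← h, ← taylor_coeff]
  simp [rodrigues, taylor_apply]

/-- Integration by parts moves the derivatives onto `q` until it is exhausted. The boundary terms
vanish because the Rodrigues polynomial has a zero of order `n + m + 1` at 0 and of order `n` at 1.
-/
theorem integral_mul_rodrigues_eq_zero (n m j : ℕ) (hj : j ≤ n) (q : ℝ[X]) (hq : q.degree < j) :
    ∫ t in (0 : ℝ)..1, (q * derivative^[j] (rodrigues n m)).eval t = 0 := by
  induction j generalizing q with
  | zero => 
    have : q = 0 := by simpa using hq
    simp [this]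
  | succ j ih =>
    rw [Function.iterate_succ_apply', integral_derivative_mul, ih (by omega)]
    · rw [eval_mul, eval_mul, rodrigues_iterate_eval_zero n m j (by omega),
        rodrigues_iterate_eval_one]
      rw [coeff_mul_X_pow', if_neg (by omega)]
      simp
    · by_cases h : q = 0
      · simp [h]
      · have h1 : (derivative q).degree < q.degree := degree_derivative_lt h
        have h2 : q.degree ≤ (j : ℕ) := by
          rw [Nat.cast_add, Nat.cast_one] at hq
          exact Order.lt_succ_iff.mp hq
        exact h1.trans_le h2

/-- Up to the factor `n!`, `r` represents evaluation at 1 in the inner product with weight `t^m` on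
polynomials of degree at most `n`. It is the `(n+1)`-st derivative of the Rodrigues polynomial
divided by `X^m`: integrating by parts once leaves only the boundary term at 1, the remaining
integral being zero by orthogonality. -/
theorem exists_endpoint_kernel (n m : ℕ) : ∃ r : ℝ[X], r.natDegree ≤ n ∧
    r.eval 1 = (n + 1).factorial * (n + m + 1) ∧
    ∀ q : ℝ[X], q.natDegree ≤ n →
      ∫ t in (0 : ℝ)..1, (q * r * X ^ m).eval t = n.factorial * q.eval 1 := by
  have h : X ^ (n + m + 1) ∣ rodrigues n m := Dvd.intro _ rfl
  have h2 := pow_sub_dvd_iterate_derivative_of_pow_dvd (n + 1) h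
  rw [show n + m + 1 - (n + 1) = m by omega] at h2
  obtain ⟨r, hr⟩ := h2
  have hdeg : (derivative^[n + 1] (rodrigues n m)).natDegree ≤ n + m := by
    refine (natDegree_iterate_derivative _ _).trans ?_
    have : (rodrigues n m).natDegree ≤ (n + m + 1) + n := by
      refine natDegree_mul_le.trans (add_le_add (by simp) ?_)
      exact natDegree_pow_le.trans (by rw [natDegree_X_sub_C]; simp)
    omega
  refine ⟨r, ?_, ?_, ?_⟩
  · by_cases h0 : r = 0
    · simp [h0]
    rw [hr, natDegree_mul (by simp) h0, natDegree_X_pow] at hdeg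
    omega
  · have := rodrigues_iterate_eval_one n m (n + 1)
    rw [hr, eval_mul, eval_pow, eval_X, one_pow, one_mul] at this
    -- The coefficient of index `n + 1` becomes the linear coefficient of `(X + 1)^(n+m+1)`, which
    -- is `n + m + 1`.
    rw [this, show n + 1 = 1 + n by omega, coeff_mul_X_pow]
    simp only [map_one]
    rw [coeff_X_add_one_pow]
    simp
  · intro q hq
    have e : q * r * X ^ m = q * derivative (derivative^[n] (rodrigues n m)) := by
      rw [← Function.iterate_succ_apply' (f := derivative), hr]; ring
    rw [e, integral_derivative_mul, eval_mul, eval_mul, rodrigues_iterate_eval_zero n m n (by omega),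
      rodrigues_iterate_eval_one]
    have h3 : ∫ t in (0 : ℝ)..1, (derivative q * derivative^[n] (rodrigues n m)).eval t = 0 := by
      by_cases h0 : q = 0
      · simp [h0]
      apply integral_mul_rodrigues_eq_zero n m n le_rfl
      exact (degree_derivative_lt h0).trans_le (natDegree_le_iff_degree_le.1 hq)
    rw [h3]
    have h4 := coeff_mul_X_pow ((X + C 1 : ℝ[X]) ^ (n + m + 1)) n 0
    rw [zero_add] at h4
    rw [h4, map_one, coeff_X_add_one_pow]
    simp
    ring

/-- The sharp weighted endpoint inequality for polynomials on the unit interval. -/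
theorem sq_eval_one_le (n m : ℕ) (q : ℝ[X]) (hq : q.natDegree ≤ n) :
    q.eval 1 ^ 2 ≤ ((n : ℝ) + 1) * (n + m + 1) * ∫ t in (0 : ℝ)..1, t ^ m * q.eval t ^ 2 := by
  obtain ⟨r, hr, hr1, hrep⟩ := exists_endpoint_kernel n m
  -- This is `q(1) / r(1)`, the minimiser of the weighted square integral of `q - c r`; that the
  -- minimum is nonnegative is the claim.
  set c : ℝ := q.eval 1 / ((n + 1).factorial * (n + m + 1)) with hc
  have hpos : 0 ≤ ∫ t in (0 : ℝ)..1, t ^ m * (q - C c * r).eval t ^ 2 :=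
    intervalIntegral.integral_nonneg (by norm_num) fun t ht =>
      mul_nonneg (pow_nonneg ht.1 _) (sq_nonneg _)
  have hi : ∀ p : ℝ[X], IntervalIntegrable (fun t => p.eval t) volume 0 1 := fun p =>
    p.continuous.intervalIntegrable _ _
  have e : ∫ t in (0 : ℝ)..1, t ^ m * (q - C c * r).eval t ^ 2 =
      (∫ t in (0 : ℝ)..1, t ^ m * q.eval t ^ 2) - 2 * c * (n.factorial * q.eval 1)
        + c ^ 2 * (n.factorial * r.eval 1) := by
    rw [← hrep q hq, ← hrep r hr, ← intervalIntegral.integral_const_mul,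
      ← intervalIntegral.integral_const_mul, ← intervalIntegral.integral_sub,
      ← intervalIntegral.integral_add]
    · congr 1
      ext t
      simp only [eval_sub, eval_mul, eval_C, eval_pow, eval_X]
      ring
    · exact (Continuous.sub (by fun_prop) (by fun_prop)).intervalIntegrable _ _
    · exact (hi _).const_mul _
    · exact Continuous.intervalIntegrable (by fun_prop) _ _
    · exact (hi _).const_mul _
  rw [e, hr1] at hpos
  have hf : ((n + 1).factorial : ℝ) = (n + 1) * n.factorial := by
    rw [Nat.factorial_succ]; push_cast; ring
  have hn : (0 : ℝ) < n.factorial := by positivity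
  set Q := ∫ t in (0 : ℝ)..1, t ^ m * q.eval t ^ 2
  have hA : (0 : ℝ) < (n + 1) * (n + m + 1) := by positivity
  have e2 : Q - 2 * c * (n.factorial * q.eval 1) +
      c ^ 2 * (n.factorial * ((n + 1).factorial * (n + m + 1))) =
      Q - q.eval 1 ^ 2 / ((n + 1) * (n + m + 1)) := by
    rw [hc, hf]
    field_simp
    ring
  rw [e2, sub_nonneg, div_le_iff₀ hA] at hpos
  linarith

end OneDim


/-! ### Polynomials of bounded total degree, their gradients and restrictions to rays. -/

section Polys

variable {d k l : ℕ} {p q : E d → ℝ}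

theorem mem_polys : p ∈ polys d k ↔ ∃ P : MvPolynomial (Fin d) ℝ, P.totalDegree ≤ k ∧
    p = fun x : E d => MvPolynomial.aeval (fun j => x j) P := by
  simp only [polys, Submodule.mem_map, MvPolynomial.mem_restrictTotalDegree]
  constructor
  · rintro ⟨P, hP, rfl⟩; exact ⟨P, hP, rfl⟩
  · rintro ⟨P, hP, rfl⟩; exact ⟨P, hP, rfl⟩

theorem polys_mono (h : k ≤ l) : polys d k ≤ polys d l := by
  intro p hp
  rw [mem_polys] at *
  obtain ⟨P, hP, rfl⟩ := hp
  exact ⟨P, hP.trans h, rfl⟩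

theorem mul_mem_polys (hp : p ∈ polys d k) (hq : q ∈ polys d l) : p * q ∈ polys d (k + l) := by
  rw [mem_polys] at *
  obtain ⟨P, hP, rfl⟩ := hp
  obtain ⟨Q, hQ, rfl⟩ := hq
  refine ⟨P * Q, (MvPolynomial.totalDegree_mul _ _).trans (add_le_add hP hQ), ?_⟩
  ext x
  simp

theorem prod_mem_polys {ι : Type*} (s : Finset ι) (f : ι → E d → ℝ) (n : ι → ℕ)
    (hf : ∀ i ∈ s, f i ∈ polys d (n i)) : (∏ i ∈ s, f i) ∈ polys d (∑ i ∈ s, n i) := by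
  classical
  induction s using Finset.induction_on with
  | empty => 
    rw [mem_polys]
    exact ⟨1, by simp, by ext x; simp⟩
  | insert a s ha ih =>
    rw [Finset.prod_insert ha, Finset.sum_insert ha]
    exact mul_mem_polys (hf _ (by simp)) (ih fun i hi => hf _ (by simp [hi]))

theorem const_mem_polys (c : ℝ) : (fun _ : E d => c) ∈ polys d k := by
  rw [mem_polys]
  exact ⟨MvPolynomial.C c, by simp, by ext x; simp⟩

theorem proj_mem_polys (i : Fin d) : (fun x : E d => x i) ∈ polys d 1 := by
  rw [mem_polys]
  exact ⟨MvPolynomial.X i, by simp, by ext x; simp⟩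

theorem linear_mem_polys (f : E d →ₗ[ℝ] ℝ) : (fun x : E d => f x) ∈ polys d 1 := by
  have : (fun x : E d => f x) = ∑ i, f (EuclideanSpace.single i 1) • (fun x : E d => x i) := by
    ext x
    conv_lhs => rw [← (EuclideanSpace.basisFun (Fin d) ℝ).sum_repr x]
    simp [mul_comm]
  rw [this]
  exact Submodule.sum_mem _ fun i _ => Submodule.smul_mem _ _ (proj_mem_polys i)

theorem affine_mem_polys (f : E d →ᵃ[ℝ] ℝ) : (fun x : E d => f x) ∈ polys d 1 := by
  have : (fun x : E d => f x) = (fun x : E d => f.linear x) + fun _ => f 0 := by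
    ext x
    exact congrFun f.decomp x
  rw [this]
  exact Submodule.add_mem _ (linear_mem_polys _) (const_mem_polys _)

theorem contDiff_of_mem_polys (hp : p ∈ polys d k) : ContDiff ℝ (⊤ : ℕ∞) p := by
  obtain ⟨P, -, rfl⟩ := mem_polys.1 hp
  clear hp
  induction P using MvPolynomial.induction_on with
  | C a => simpa using contDiff_const
  | add p q hp hq =>
    simp only [map_add]
    exact hp.add hq
  | mul_X p i hp =>
    simp only [map_mul, MvPolynomial.aeval_X]
    exact hp.mul (EuclideanSpace.proj (𝕜 := ℝ) i).contDiff

theorem continuous_of_mem_polys (hp : p ∈ polys d k) : Continuous p :=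
  (contDiff_of_mem_polys hp).continuous

theorem differentiable_of_mem_polys (hp : p ∈ polys d k) : Differentiable ℝ p :=
  (contDiff_of_mem_polys hp).differentiable (by simp)

theorem hasFDerivAt_aeval (P : MvPolynomial (Fin d) ℝ) (x : E d) :
    HasFDerivAt (fun x : E d => MvPolynomial.aeval (fun j => x j) P)
      (∑ i, MvPolynomial.aeval (fun j => x j) (MvPolynomial.pderiv i P) •
        (EuclideanSpace.proj i : E d →L[ℝ] ℝ)) x := by
  induction P using MvPolynomial.induction_on with
  | C a => simpa using hasFDerivAt_const a x
  | add p q hp hq =>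
    simp only [map_add, add_smul, Finset.sum_add_distrib]
    exact hp.add hq
  | mul_X p i hp =>
    simp only [map_mul, MvPolynomial.aeval_X]
    have := hp.mul (EuclideanSpace.proj (𝕜 := ℝ) i : E d →L[ℝ] ℝ).hasFDerivAt (x := x)
    refine this.congr_fderiv ?_
    simp only [Derivation.leibniz, MvPolynomial.pderiv_X, map_add, smul_eq_mul, map_mul, add_smul,
      Finset.sum_add_distrib, Finset.smul_sum]
    congr 1
    · rw [Finset.sum_eq_single i]
      · simp
      · intro b _ hb
        simp [hb.symm]
      · simp
    · refine Finset.sum_congr rfl fun j _ => ?_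
      simp [smul_smul]

theorem totalDegree_pderiv_le (P : MvPolynomial (Fin d) ℝ) (i : Fin d) (hP : P.totalDegree ≤ k) :
    (MvPolynomial.pderiv i P).totalDegree ≤ k - 1 := by
  rw [← MvPolynomial.mem_restrictTotalDegree]
  rw [P.as_sum, map_sum]
  refine Submodule.sum_mem _ fun s hs => ?_
  rw [MvPolynomial.pderiv_monomial, MvPolynomial.mem_restrictTotalDegree]
  by_cases h : s i = 0
  · simp [h]
  refine (MvPolynomial.totalDegree_monomial_le _ _).trans ?_
  have h1 := MvPolynomial.le_totalDegree hs
  have h2 : (s - Finsupp.single i 1) + Finsupp.single i 1 = s :=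
    tsub_add_cancel_of_le (by simpa [Nat.one_le_iff_ne_zero] using h)
  have h3 := congrArg (fun f : Fin d →₀ ℕ => f.sum fun _ e => e) h2
  rw [Finsupp.sum_add_index' (by simp) (by simp)] at h3
  simp only [Finsupp.sum_single_index] at h3
  change (s - Finsupp.single i 1).sum (fun _ e => e) ≤ _
  omega

theorem gradient_apply {x : E d} (i : Fin d) :
    (∇ p x) i = fderiv ℝ p x (EuclideanSpace.single i 1) := by
  rw [← inner_gradient_left, EuclideanSpace.inner_single_right]
  simp

theorem gradient_apply_mem_polys (hp : p ∈ polys d k) (i : Fin d) :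
    (fun x => (∇ p x) i) ∈ polys d (k - 1) := by
  obtain ⟨P, hP, rfl⟩ := mem_polys.1 hp
  rw [mem_polys]
  refine ⟨MvPolynomial.pderiv i P, totalDegree_pderiv_le P i hP, ?_⟩
  ext x
  rw [gradient_apply, (hasFDerivAt_aeval P x).fderiv]
  simp

theorem gradient_add_of_mem (hp : p ∈ polys d k) (hq : q ∈ polys d l) (x : E d) :
    ∇ (p + q) x = ∇ p x + ∇ q x := by
  simp only [gradient]
  rw [fderiv_add (differentiable_of_mem_polys hp x) (differentiable_of_mem_polys hq x), map_add]

theorem gradient_smul_of_mem (c : ℝ) (hp : p ∈ polys d k) (x : E d) :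
    ∇ (c • p) x = c • ∇ p x := by
  simp only [gradient]
  rw [fderiv_const_smul (differentiable_of_mem_polys hp x)]
  simp

theorem continuous_gradient_of_mem (hp : p ∈ polys d k) : Continuous fun x => ∇ p x := by
  refine (LinearIsometryEquiv.continuous _).comp ?_
  exact (contDiff_of_mem_polys hp).continuous_fderiv (by simp)

/-- This reduces statements in `ℝ^d` to polynomials in one variable, both for the trace inequality
and for unique continuation. -/
theorem exists_ray_polynomial (hp : p ∈ polys d k) (z w : E d) :
    ∃ r : Polynomial ℝ, r.natDegree ≤ k ∧ ∀ t, r.eval t = p (z + t • w) := by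
  obtain ⟨P, hP, rfl⟩ := mem_polys.1 hp
  refine ⟨MvPolynomial.aeval (fun j => Polynomial.C (z j) + Polynomial.X * Polynomial.C (w j)) P,
    ?_, ?_⟩
  · have := MvPolynomial.aeval_natDegree_le (m := k) (n := 1) P hP
      (fun j => Polynomial.C (z j) + Polynomial.X * Polynomial.C (w j)) (fun j => by
        compute_degree)
    simpa using this
  · intro t
    rw [← Polynomial.coe_aeval_eq_eval, ← AlgHom.comp_apply, MvPolynomial.comp_aeval]
    have e : ∀ i, w i * t = t * w i := fun i => mul_comm _ _
    simp [e]

/-- On the line from a point of `U` to any other point, the polynomial has infinitely many zeros. -/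
theorem eq_zero_of_mem_polys_of_eqOn_open (hp : p ∈ polys d k) {U : Set (E d)} (hU : IsOpen U)
    (hne : U.Nonempty) (h : ∀ x ∈ U, p x = 0) : p = 0 := by
  obtain ⟨z, hz⟩ := hne
  ext x
  obtain ⟨r, -, hr⟩ := exists_ray_polynomial hp z (x - z)
  have hc : Continuous fun t : ℝ => z + t • (x - z) := by fun_prop
  have hn : {t : ℝ | z + t • (x - z) ∈ U} ∈ 𝓝 (0 : ℝ) :=
    hc.continuousAt.preimage_mem_nhds (hU.mem_nhds (by simpa using hz))
  have hr0 : r = 0 := by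
    refine Polynomial.eq_zero_of_infinite_isRoot r (Set.Infinite.mono ?_ (infinite_of_mem_nhds _ hn))
    intro t ht
    simp only [Set.mem_ofPred_eq, Polynomial.IsRoot] at *
    rw [hr, h _ ht]
  have := hr 1
  rw [hr0] at this
  simpa using this.symm

end Polys


/-! ### Lagrange nodes, Lagrange basis and unisolvence. -/

section Lagrange

variable {d k : ℕ} (T : Simplex d)

theorem sum_of_mem_nodeIdx {a : Fin (d + 1) → ℕ} (ha : a ∈ nodeIdx d k) : ∑ j, a j = k := by
  simpa [nodeIdx] using ha

theorem sum_nodeIdx_div (hk : 1 ≤ k) {a : Fin (d + 1) → ℕ} (ha : a ∈ nodeIdx d k) :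
    ∑ j, ((a j : ℝ) / (k : ℝ)) = 1 := by
  rw [← Finset.sum_div, ← Nat.cast_sum, sum_of_mem_nodeIdx ha]
  have : (k : ℝ) ≠ 0 := by positivity
  exact div_self this

theorem node_eq_affineCombination (hk : 1 ≤ k) {a : Fin (d + 1) → ℕ} (ha : a ∈ nodeIdx d k) :
    node T k a = Finset.univ.affineCombination ℝ T (fun j => (a j : ℝ) / k) := by
  rw [Finset.affineCombination_eq_linear_combination _ _ _ (sum_nodeIdx_div hk ha)]
  rfl

theorem coord_node (hk : 1 ≤ k) {a : Fin (d + 1) → ℕ} (ha : a ∈ nodeIdx d k) (j : Fin (d + 1)) :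
    T.coord j (node T k a) = (a j : ℝ) / k := by
  rw [node_eq_affineCombination T hk ha,
    T.coord_apply_combination_of_mem (Finset.mem_univ j) (sum_nodeIdx_div hk ha)]

theorem lagrange_node (hk : 1 ≤ k) {a b : Fin (d + 1) → ℕ} (ha : a ∈ nodeIdx d k)
    (hb : b ∈ nodeIdx d k) : lagrange T k a (node T k b) = if a = b then 1 else 0 := by
  have hk0 : (k : ℝ) ≠ 0 := by positivity
  have e : ∀ j, (k : ℝ) * T.coord j (node T k b) = b j := fun j => by
    rw [coord_node T hk hb]; field_simp
  unfold lagrange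
  simp_rw [e]
  split_ifs with h
  · subst h
    refine Finset.prod_eq_one fun j _ => Finset.prod_eq_one fun l hl => ?_
    refine div_self (sub_ne_zero.2 ?_)
    have := Finset.mem_range.1 hl
    exact_mod_cast this.ne'
  -- Different multi-indices of equal sum have such a `j`; the factor with `l = b j` in the product
  -- then vanishes.
  · have : ∃ j, b j < a j := by
      by_contra! hcon
      apply h
      have hs : ∑ j, a j = ∑ j, b j := by rw [sum_of_mem_nodeIdx ha, sum_of_mem_nodeIdx hb]
      ext j
      exact (Finset.sum_eq_sum_iff_of_le fun i _ => hcon i).1 hs j (Finset.mem_univ j)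
    obtain ⟨j, hj⟩ := this
    refine Finset.prod_eq_zero (Finset.mem_univ j) (Finset.prod_eq_zero (Finset.mem_range.2 hj) ?_)
    simp

theorem lagrange_mem_polys {a : Fin (d + 1) → ℕ} (ha : a ∈ nodeIdx d k) :
    lagrange T k a ∈ polys d k := by
  have e : lagrange T k a = ∏ j, ∏ l ∈ Finset.range (a j),
      fun x : E d => ((k : ℝ) * T.coord j x - l) / ((a j : ℝ) - l) := by
    ext x
    simp [lagrange, Finset.prod_apply]
  rw [e]
  refine polys_mono (k := ∑ j : Fin (d + 1), ∑ l ∈ Finset.range (a j), 1) ?_ ?_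
  · simp [sum_of_mem_nodeIdx ha]
  refine prod_mem_polys _ _ _ fun j _ => prod_mem_polys _ _ _ fun l _ => ?_
  have e2 : (fun x : E d => ((k : ℝ) * T.coord j x - l) / ((a j : ℝ) - l)) =
      ((a j : ℝ) - l)⁻¹ • ((k : ℝ) • (fun x : E d => T.coord j x) - fun _ => (l : ℝ)) := by
    ext x
    simp [div_eq_inv_mul]
  rw [e2]
  exact Submodule.smul_mem _ _ (Submodule.sub_mem _ (Submodule.smul_mem _ _ (affine_mem_polys _))
    (const_mem_polys _))

/-- A linear combination of monomials of degree at most `k`, with coefficients indexed like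
Lagrange nodes. -/
noncomputable def monomialSum (d k : ℕ) : (nodeIdx d k → ℝ) →ₗ[ℝ] (E d → ℝ) :=
  ∑ a : nodeIdx d k, (LinearMap.proj a).smulRight fun x : E d => ∏ i : Fin d, x i ^ a.1 i.succ

/-- The slack `k - |s|` of an exponent `s` serves as its zeroth index, so that monomials of degree
at most `k` are labelled by node indices. This bounds the dimension by the number of nodes without
computing either. -/
theorem polys_le_range_monomialSum : polys d k ≤ LinearMap.range (monomialSum d k) := by
  classical
  intro p hp
  obtain ⟨P, hP, rfl⟩ := mem_polys.1 hp
  have e : (fun x : E d => MvPolynomial.aeval (fun j => x j) P) =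
      ∑ s ∈ P.support, P.coeff s • fun x : E d => ∏ i, x i ^ s i := by
    ext x
    conv_lhs => rw [P.as_sum, map_sum]
    simp only [Finset.sum_apply, Pi.smul_apply, smul_eq_mul]
    refine Finset.sum_congr rfl fun s _ => ?_
    rw [MvPolynomial.aeval_monomial, Finsupp.prod_fintype _ _ (by simp)]
    rfl
  rw [e]
  refine Submodule.sum_mem _ fun s hs => Submodule.smul_mem _ _ ?_
  have hsk : ∑ i, s i ≤ k := by
    have h := (MvPolynomial.le_totalDegree hs).trans hP
    rwa [Finsupp.sum_fintype _ _ (by simp)] at h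
  have hmem : (Fin.cons (k - ∑ i, s i) s : Fin (d + 1) → ℕ) ∈ nodeIdx d k := by
    simp only [nodeIdx, Finset.mem_piAntidiag, Fin.sum_univ_succ, Fin.cons_zero, Fin.cons_succ]
    exact ⟨by omega, by simp⟩
  refine ⟨Pi.single ⟨_, hmem⟩ 1, ?_⟩
  ext x
  simp only [monomialSum, LinearMap.sum_apply, LinearMap.smulRight_apply, LinearMap.proj_apply,
    Finset.sum_apply, Pi.smul_apply, smul_eq_mul]
  rw [Finset.sum_eq_single ⟨_, hmem⟩]
  · simp
  · intro b _ hb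
    simp [hb]
  · simp

instance finiteDimensional_polys (d k : ℕ) : FiniteDimensional ℝ (polys d k) :=
  Submodule.finiteDimensional_of_le polys_le_range_monomialSum

theorem finrank_polys_le : Module.finrank ℝ (polys d k) ≤ (nodeIdx d k).card := by
  refine (Submodule.finrank_mono polys_le_range_monomialSum).trans ?_
  refine (LinearMap.finrank_range_le _).trans ?_
  simp

/-- Evaluation in the Lagrange nodes. -/
noncomputable def nodalValues (T : Simplex d) (k : ℕ) : polys d k →ₗ[ℝ] (nodeIdx d k → ℝ) where
  toFun p a := p.1 (node T k a)
  map_add' _ _ := rfl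
  map_smul' _ _ := rfl

theorem nodalValues_surjective (hk : 1 ≤ k) : Function.Surjective (nodalValues T k) := by
  classical
  intro c
  refine ⟨∑ a : nodeIdx d k, c a • ⟨lagrange T k a, lagrange_mem_polys T a.2⟩, ?_⟩
  ext b
  simp only [map_sum, map_smul, Finset.sum_apply, Pi.smul_apply, smul_eq_mul]
  rw [Finset.sum_eq_single b]
  · simp [nodalValues, lagrange_node T hk b.2 b.2]
  · intro a _ hab
    have : a.1 ≠ b.1 := fun h => hab (Subtype.ext h)
    simp [nodalValues, lagrange_node T hk a.2 b.2, this]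
  · simp

/-- Unisolvence: evaluation at the nodes is onto because of the Lagrange basis, and the dimension of
the polynomials does not exceed the number of nodes. -/
theorem nodalValues_injective (hk : 1 ≤ k) : Function.Injective (nodalValues T k) := by
  have h1 : (nodeIdx d k).card ≤ Module.finrank ℝ (polys d k) := by
    have := LinearMap.finrank_range_le (nodalValues T k)
    rw [LinearMap.range_eq_top.2 (nodalValues_surjective T hk)] at this
    simpa using this
  refine (LinearMap.injective_iff_surjective_of_finrank_eq_finrank ?_).2
    (nodalValues_surjective T hk)
  simpa using le_antisymm finrank_polys_le h1

theorem lagrange_sum_mem_polys (c : (Fin (d + 1) → ℕ) → ℝ) :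
    (fun x => ∑ a ∈ nodeIdx d k, c a * lagrange T k a x) ∈ polys d k := by
  have : (fun x => ∑ a ∈ nodeIdx d k, c a * lagrange T k a x) =
      ∑ a ∈ nodeIdx d k, c a • lagrange T k a := by
    ext x; simp
  rw [this]
  exact Submodule.sum_mem _ fun a ha => Submodule.smul_mem _ _ (lagrange_mem_polys T ha)

theorem lagrange_sum_node (hk : 1 ≤ k) (c : (Fin (d + 1) → ℕ) → ℝ) {b : Fin (d + 1) → ℕ}
    (hb : b ∈ nodeIdx d k) : ∑ a ∈ nodeIdx d k, c a * lagrange T k a (node T k b) = c b := by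
  rw [Finset.sum_eq_single b]
  · simp [lagrange_node T hk hb hb]
  · intro a ha hab
    simp [lagrange_node T hk ha hb, hab]
  · exact fun h => absurd hb h

theorem lagrange_interpolation (hk : 1 ≤ k) {p : E d → ℝ} (hp : p ∈ polys d k) (x : E d) :
    p x = ∑ a ∈ nodeIdx d k, p (node T k a) * lagrange T k a x := by
  have := @nodalValues_injective d k T hk ⟨p, hp⟩ ⟨_, lagrange_sum_mem_polys T fun a => p (node T k a)⟩
    (by
      ext b
      exact (lagrange_sum_node T hk (fun a => p (node T k a)) b.2).symm)
  exact congrFun (congrArg Subtype.val this) x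

end Lagrange


/-! ### Integration over cones and the trace inequality on a cone. -/

section Cone

variable {d : ℕ} {n z : E d} {A : Set (E d)}

/-- The open cone with apex `z` over a subset `A` of the hyperplane `⟪n, x - z⟫ = 1`. -/
def cone (n z : E d) (A : Set (E d)) : Set (E d) :=
  {y | ⟪n, y - z⟫ ∈ Set.Ioo (0 : ℝ) 1 ∧ z + (⟪n, y - z⟫)⁻¹ • (y - z) ∈ A}

/-- The parametrisation of a cone with apex `z`. -/
def coneMap (z : E d) (p : ℝ × E d) : E d := z + p.1 • (p.2 - z)

theorem continuous_coneMap (z : E d) : Continuous (coneMap z) := by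
  unfold coneMap; fun_prop

theorem mem_cone_iff (hA : A ⊆ {x | ⟪n, x - z⟫ = 1}) {y : E d} :
    y ∈ cone n z A ↔ ∃ t ∈ Set.Ioo (0 : ℝ) 1, ∃ x ∈ A, z + t • (x - z) = y := by
  constructor
  · rintro ⟨h1, h2⟩
    refine ⟨_, h1, _, h2, ?_⟩
    rw [add_sub_cancel_left, smul_smul, mul_inv_cancel₀ h1.1.ne', one_smul, add_sub_cancel]
  · rintro ⟨t, ht, x, hx, rfl⟩
    have h1 : ⟪n, x - z⟫ = 1 := hA hx
    have h2 : ⟪n, z + t • (x - z) - z⟫ = t := by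
      rw [add_sub_cancel_left, inner_smul_right, h1, mul_one]
    refine ⟨by rwa [h2], ?_⟩
    rw [h2, add_sub_cancel_left, smul_smul, inv_mul_cancel₀ ht.1.ne', one_smul, add_sub_cancel]
    exact hx

theorem measurableSet_cone (hA : MeasurableSet A) : MeasurableSet (cone n z A) := by
  have h1 : Measurable fun y : E d => ⟪n, y - z⟫ := by fun_prop
  have h2 : Measurable fun y : E d => z + (⟪n, y - z⟫)⁻¹ • (y - z) :=
    measurable_const.add (h1.inv.smul (measurable_id.sub_const z))
  exact (h1 measurableSet_Ioo).inter (h2 hA)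

/-- Cavalieri's principle along `n`. The slice at height `t` is the image of part of `A` under the
homothety with ratio `t`, whence `t^(d-1)`; since the base has height 1 in the scale of `n`, its
true distance from the apex is `‖n‖⁻¹`. -/
theorem volume_cone_inter (hn : n ≠ 0) (hA : MeasurableSet A) (hAn : A ⊆ {x | ⟪n, x - z⟫ = 1})
    {s : Set (E d)} (hs : MeasurableSet s) :
    volume (cone n z A ∩ s) = ‖n‖ₑ⁻¹ * ∫⁻ t in Set.Ioo (0 : ℝ) 1,
      ENNReal.ofReal (t ^ (d - 1)) * μHE[d - 1] (A ∩ (fun x => coneMap z (t, x)) ⁻¹' s) := by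
  have hn' : ‖n‖ ≠ 0 := norm_ne_zero_iff.2 hn
  -- With this vector the plane through `z + t • v` orthogonal to it is exactly `⟪n, y - z⟫ = t`.
  set v : E d := (‖n‖ ^ 2)⁻¹ • n with hv
  have hv0 : v ≠ 0 := smul_ne_zero (by positivity) hn
  have hvn : ‖v‖ₑ = ‖n‖ₑ⁻¹ := by
    rw [hv, enorm_smul, enorm_inv (by positivity), enorm_pow, enorm_norm]
    have h0 : ‖n‖ₑ ≠ 0 := by simpa using hn
    rw [pow_two, ENNReal.mul_inv (Or.inl h0) (Or.inl (by simp)), mul_assoc,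
      ENNReal.inv_mul_cancel h0 (by simp), mul_one]
  have key := EuclideanGeometry.euclideanHausdorffMeasure_eq_lintegral (V := E d) z hv0
    ((measurableSet_cone hA (n := n) (z := z)).inter hs)
  rw [finrank_euclideanSpace_fin, EuclideanSpace.euclideanHausdorffMeasure_eq_volume, hvn] at key
  rw [key, ← lintegral_indicator measurableSet_Ioo]
  congr 1
  refine lintegral_congr fun t => ?_
  have hmem : ∀ y : E d, y ∈ AffineSubspace.mk' (t • v +ᵥ z) (Submodule.span ℝ {v})ᗮ ↔
      ⟪n, y - z⟫ = t := by
    intro y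
    rw [AffineSubspace.mem_mk', Submodule.mem_orthogonal_singleton_iff_inner_right, vsub_eq_sub,
      vadd_eq_add, hv, inner_smul_left]
    have h2 : ⟪n, y - (t • (‖n‖ ^ 2)⁻¹ • n + z)⟫ = ⟪n, y - z⟫ - t := by
      rw [show y - (t • (‖n‖ ^ 2)⁻¹ • n + z) = (y - z) - t • (‖n‖ ^ 2)⁻¹ • n by abel,
        inner_sub_right, inner_smul_right, inner_smul_right, real_inner_self_eq_norm_sq]
      field_simp
    rw [h2]
    simp [hn, sub_eq_zero]
  by_cases ht : t ∈ Set.Ioo (0 : ℝ) 1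
  · rw [Set.indicator_of_mem ht]
    have himg : cone n z A ∩ s ∩ AffineSubspace.mk' (t • v +ᵥ z) (Submodule.span ℝ {v})ᗮ =
        AffineMap.homothety z t '' (A ∩ (fun x => coneMap z (t, x)) ⁻¹' s) := by
      ext y
      constructor
      · rintro ⟨⟨hc, hys⟩, hy⟩
        have hy' := (hmem y).1 hy
        have e : z + t • ((z + t⁻¹ • (y - z)) - z) = y := by
          rw [add_sub_cancel_left, smul_smul, mul_inv_cancel₀ ht.1.ne', one_smul, add_sub_cancel]
        refine ⟨z + t⁻¹ • (y - z), ⟨?_, ?_⟩, ?_⟩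
        · have := hc.2
          rwa [hy'] at this
        · change z + t • ((z + t⁻¹ • (y - z)) - z) ∈ s
          rwa [e]
        · rw [AffineMap.homothety_apply, vadd_eq_add, vsub_eq_sub, add_comm]
          exact e
      · rintro ⟨x, ⟨hx, hxs⟩, rfl⟩
        have e : AffineMap.homothety z t x = z + t • (x - z) := by
          rw [AffineMap.homothety_apply, vadd_eq_add, vsub_eq_sub, add_comm]
        rw [e]
        refine ⟨⟨(mem_cone_iff hAn).2 ⟨t, ht, x, hx, rfl⟩, hxs⟩, (hmem _).2 ?_⟩
        have h1 : ⟪n, x - z⟫ = 1 := hAn hx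
        rw [add_sub_cancel_left, inner_smul_right, h1, mul_one]
    rw [himg, euclideanHausdorffMeasure_homothety_image _ _ ht.1.ne']
    rw [ENNReal.smul_def, smul_eq_mul, ENNReal.ofReal_pow ht.1.le]
    congr 2
    rw [Real.nnnorm_of_nonneg ht.1.le, Real.toNNReal_of_nonneg ht.1.le]
  · rw [Set.indicator_of_notMem ht]
    have : cone n z A ∩ s ∩ AffineSubspace.mk' (t • v +ᵥ z) (Submodule.span ℝ {v})ᗮ = ∅ := by
      ext y
      simp only [Set.mem_inter_iff, Set.mem_empty_iff_false, iff_false, not_and]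
      intro hc hy
      have := hc.1.1
      rw [(hmem y).1 hy] at this
      exact ht this
    rw [this, measure_empty]

theorem lintegral_pow_Ioo (m : ℕ) :
    ∫⁻ t in Set.Ioo (0 : ℝ) 1, ENNReal.ofReal (t ^ m) = ((m : ℝ≥0∞) + 1)⁻¹ := by
  rw [restrict_Ioo_eq_restrict_Ioc, ← ofReal_integral_eq_lintegral_ofReal]
  · rw [← intervalIntegral.integral_of_le (by norm_num), integral_pow]
    simp only [one_pow, ne_eq, Nat.add_eq_zero_iff, one_ne_zero, and_false, not_false_eq_true,
      zero_pow, sub_zero, one_div]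
    rw [ENNReal.ofReal_inv_of_pos (by positivity)]
    congr 1
    rw [ENNReal.ofReal_add (by positivity) (by norm_num)]
    simp
  · exact ((continuous_pow m).integrableOn_Icc).mono_set Set.Ioc_subset_Icc_self
  · filter_upwards [ae_restrict_mem measurableSet_Ioc] with t ht
    exact pow_nonneg ht.1.le _

theorem volume_cone (hd : 1 ≤ d) (hn : n ≠ 0) (hA : MeasurableSet A)
    (hAn : A ⊆ {x | ⟪n, x - z⟫ = 1}) :
    volume (cone n z A) = ‖n‖ₑ⁻¹ * ((d : ℝ≥0∞)⁻¹ * μHE[d - 1] A) := by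
  have h := volume_cone_inter hn hA hAn MeasurableSet.univ
  simp only [Set.inter_univ, Set.preimage_univ] at h
  rw [h, lintegral_mul_const _ (by fun_prop), lintegral_pow_Ioo]
  congr 3
  obtain ⟨m, rfl⟩ : ∃ m, d = m + 1 := ⟨d - 1, by omega⟩
  simp

theorem hausdorff_eq_volume_cone (hd : 1 ≤ d) (hn : n ≠ 0) (hA : MeasurableSet A)
    (hAn : A ⊆ {x | ⟪n, x - z⟫ = 1}) :
    μHE[d - 1] A = (d : ℝ≥0∞) * ‖n‖ₑ * volume (cone n z A) := by
  have h0 : ‖n‖ₑ ≠ 0 := by simpa using hn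
  have hd0 : (d : ℝ≥0∞) ≠ 0 := by simp; omega
  rw [volume_cone hd hn hA hAn, mul_assoc, ← mul_assoc ‖n‖ₑ, ENNReal.mul_inv_cancel h0 (by simp),
    one_mul, ← mul_assoc, ENNReal.mul_inv_cancel hd0 (by simp), one_mul]

theorem lintegral_cone (hn : n ≠ 0) (hA : MeasurableSet A)
    (hAn : A ⊆ {x | ⟪n, x - z⟫ = 1}) (hfin : μHE[d - 1] A ≠ ∞) {g : E d → ℝ≥0∞}
    (hg : Measurable g) :
    ∫⁻ y in cone n z A, g y = ‖n‖ₑ⁻¹ * ∫⁻ x in A, (∫⁻ t in Set.Ioo (0 : ℝ) 1,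
      ENNReal.ofReal (t ^ (d - 1)) * g (coneMap z (t, x))) ∂μHE[d - 1] := by
  have : IsFiniteMeasure ((μHE[d - 1] : Measure (E d)).restrict A) :=
    ⟨by rw [Measure.restrict_apply_univ]; exact hfin.lt_top⟩
  have hpw : Measurable fun t : ℝ => ENNReal.ofReal (t ^ (d - 1)) := by fun_prop
  -- Lebesgue measure on the cone is the push-forward of a product measure under the cone
  -- parametrisation. Finiteness of the surface measure of `A` allows Tonelli's theorem.
  have hmeas : (volume.restrict (cone n z A)) = ‖n‖ₑ⁻¹ •
      ((((volume.restrict (Set.Ioo (0 : ℝ) 1)).withDensity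
        (fun t => ENNReal.ofReal (t ^ (d - 1)))).prod
        ((μHE[d - 1] : Measure (E d)).restrict A)).map (coneMap z)) := by
    ext s hs
    rw [Measure.restrict_apply hs, Set.inter_comm, volume_cone_inter hn hA hAn hs,
      Measure.smul_apply, smul_eq_mul, Measure.map_apply (continuous_coneMap z).measurable hs,
      Measure.prod_apply ((continuous_coneMap z).measurable hs),
      lintegral_withDensity_eq_lintegral_mul₀ hpw.aemeasurable]
    · congr 1
      refine lintegral_congr fun t => ?_
      rw [Pi.mul_apply, Measure.restrict_apply, Set.inter_comm]
      · rfl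
      · exact measurable_prodMk_left ((continuous_coneMap z).measurable hs)
    · exact (measurable_measure_prodMk_left
        ((continuous_coneMap z).measurable hs)).aemeasurable
  have hgc : Measurable fun p : ℝ × E d => g (coneMap z p) :=
    hg.comp (continuous_coneMap z).measurable
  rw [hmeas, lintegral_smul_measure, smul_eq_mul, lintegral_map hg (continuous_coneMap z).measurable,
    lintegral_prod_symm' _ hgc]
  congr 1
  refine lintegral_congr fun x => ?_
  rw [lintegral_withDensity_eq_lintegral_mul₀ hpw.aemeasurable]
  · rfl
  · exact (hgc.comp measurable_prodMk_right).aemeasurable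

/-- On each ray from the apex the polynomial has degree at most `k` in `t`, and the endpoint
inequality with `n = k`, `m = d - 1` applies. Integrating over the base gives the claim. -/
theorem lintegral_sq_le_cone {k : ℕ} (hd : 1 ≤ d) (hn : n ≠ 0) (hA : MeasurableSet A)
    (hAn : A ⊆ {x | ⟪n, x - z⟫ = 1}) (hfin : μHE[d - 1] A ≠ ∞) {p : E d → ℝ} (hp : p ∈ polys d k) :
    ∫⁻ x in A, ENNReal.ofReal (p x ^ 2) ∂μHE[d - 1] ≤
      ENNReal.ofReal (((k : ℝ) + 1) * (k + d) * ‖n‖) *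
        ∫⁻ y in cone n z A, ENNReal.ofReal (p y ^ 2) := by
  have hpc := continuous_of_mem_polys hp
  have hn0 : ‖n‖ₑ ≠ 0 := by simpa using hn
  rw [lintegral_cone hn hA hAn hfin (by fun_prop)]
  rw [ENNReal.ofReal_mul (by positivity), ← mul_assoc, mul_assoc (ENNReal.ofReal _),
    ofReal_norm, ENNReal.mul_inv_cancel hn0 (by simp), mul_one, ← lintegral_const_mul']
  · refine lintegral_mono fun x => ?_
    obtain ⟨r, hr, hrp⟩ := exists_ray_polynomial hp z (x - z)
    have h1 := sq_eval_one_le k (d - 1) r hr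
    rw [hrp, one_smul, add_sub_cancel] at h1
    have hdd : ((k : ℝ) + (d - 1 : ℕ) + 1) = k + d := by
      obtain ⟨m, rfl⟩ : ∃ m, d = m + 1 := ⟨d - 1, by omega⟩
      simp; ring
    rw [hdd] at h1
    refine (ENNReal.ofReal_le_ofReal h1).trans ?_
    rw [ENNReal.ofReal_mul (by positivity)]
    refine mul_le_mul_right (le_of_eq ?_) _
    rw [intervalIntegral.integral_of_le (by norm_num), ofReal_integral_eq_lintegral_ofReal,
      restrict_Ioo_eq_restrict_Ioc]
    · refine setLIntegral_congr_fun measurableSet_Ioc fun t ht => ?_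
      simp only [coneMap]
      rw [ENNReal.ofReal_mul (pow_nonneg ht.1.le _), hrp]
    · exact (Continuous.integrableOn_Icc (by fun_prop)).mono_set Set.Ioc_subset_Icc_self
    · filter_upwards [ae_restrict_mem measurableSet_Ioc] with t ht
      exact mul_nonneg (pow_nonneg ht.1.le _) (sq_nonneg _)
  · exact ENNReal.ofReal_ne_top

end Cone


/-! ### Barycentric geometry of a simplex, and of simplices that touch along facets. -/

section SimplexGeometry

variable {d : ℕ} (T : Simplex d)

/-- The gradient of a barycentric coordinate. -/
noncomputable def grad (j : Fin (d + 1)) : E d := ∇ (fun x => T.coord j x) 0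

/-- The relative interior of a facet. -/
def relFacet (j : Fin (d + 1)) : Set (E d) :=
  {x | T.coord j x = 0 ∧ ∀ i, i ≠ j → 0 < T.coord i x}

theorem continuous_coord (j : Fin (d + 1)) : Continuous fun x => T.coord j x :=
  continuous_of_mem_polys (affine_mem_polys (T.coord j))

theorem coord_sub (j : Fin (d + 1)) (x y : E d) :
    T.coord j x - T.coord j y = ⟪grad T j, x - y⟫ := by
  have h1 : ∀ w, T.coord j w = T.coord j 0 + (T.coord j).linear w := fun w => by
    exact (congrFun (T.coord j).decomp w).trans (add_comm _ _)
  have h2 : HasFDerivAt (fun x => T.coord j x) (LinearMap.toContinuousLinearMap (T.coord j).linear)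
      0 := by
    have := (LinearMap.toContinuousLinearMap (T.coord j).linear).hasFDerivAt (x := (0 : E d))
    refine (this.const_add (T.coord j 0)).congr_of_eventuallyEq (Eventually.of_forall fun w => ?_)
    exact h1 w
  rw [grad, inner_gradient_left, h2.fderiv, h1 x, h1 y, LinearMap.coe_toContinuousLinearMap', map_sub]
  ring

theorem sum_coord (x : E d) : ∑ i, T.coord i x = 1 := T.sum_coord_apply_eq_one x

theorem sum_coord_smul (x : E d) : ∑ i, T.coord i x • T i = x :=
  T.linear_combination_coord_eq_self x

theorem affine_eq_sum_coord (f : E d →ᵃ[ℝ] ℝ) (x : E d) : f x = ∑ i, T.coord i x * f (T i) := by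
  conv_lhs => rw [← T.affineCombination_coord_eq_self x]
  rw [Finset.map_affineCombination _ _ _ (sum_coord T x),
    Finset.affineCombination_eq_linear_combination _ _ _ (sum_coord T x)]
  rfl

theorem mem_body {x : E d} : x ∈ body T ↔ ∀ j, 0 ≤ T.coord j x := by
  rw [body, T.convexHull_eq_nonneg_coord]; rfl

theorem mem_interior_body {x : E d} : x ∈ interior (body T) ↔ ∀ j, 0 < T.coord j x := by
  rw [body, T.interior_convexHull]; rfl

theorem mem_convexHull_image {s : Set (Fin (d + 1))} {x : E d} :
    x ∈ convexHull ℝ (T '' s) ↔ ∀ i, 0 ≤ T.coord i x ∧ (i ∉ s → T.coord i x = 0) := by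
  classical
  constructor
  · intro hx
    have hconv : Convex ℝ {x : E d | ∀ i, 0 ≤ T.coord i x ∧ (i ∉ s → T.coord i x = 0)} := by
      intro y hy z hz a b ha hb hab i
      have e : T.coord i (a • y + b • z) = a * T.coord i y + b * T.coord i z := by
        have := Convex.combo_affine_apply hab (f := T.coord i) (x := y) (y := z)
        simpa using this
      rw [e]
      refine ⟨add_nonneg (mul_nonneg ha (hy i).1) (mul_nonneg hb (hz i).1), fun hi => ?_⟩
      rw [(hy i).2 hi, (hz i).2 hi]; simp
    refine convexHull_min ?_ hconv hx
    rintro _ ⟨l, hl, rfl⟩ i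
    rw [T.coord_apply]
    split_ifs with h
    · subst h; exact ⟨by norm_num, fun h => absurd hl h⟩
    · simp
  · intro h
    rw [← sum_coord_smul T x]
    have e : ∑ i, T.coord i x • T i = ∑ i ∈ Finset.univ.filter (· ∈ s), T.coord i x • T i := by
      rw [Finset.sum_filter]
      refine Finset.sum_congr rfl fun i _ => ?_
      split_ifs with hi
      · rfl
      · rw [(h i).2 hi, zero_smul]
    rw [e]
    refine (convex_convexHull ℝ _).sum_mem (fun i _ => (h i).1) ?_ fun i hi => ?_
    · rw [← sum_coord T x, Finset.sum_filter]
      refine Finset.sum_congr rfl fun i _ => ?_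
      split_ifs with hi
      · rfl
      · rw [(h i).2 hi]
    · exact subset_convexHull ℝ _ ⟨i, by simpa using hi, rfl⟩

theorem mem_facet {j : Fin (d + 1)} {x : E d} :
    x ∈ facet T j ↔ T.coord j x = 0 ∧ ∀ i, 0 ≤ T.coord i x := by
  rw [facet, mem_convexHull_image]
  constructor
  · intro h
    exact ⟨(h j).2 (by simp), fun i => (h i).1⟩
  · rintro ⟨h1, h2⟩ i
    refine ⟨h2 i, fun hi => ?_⟩
    have : i = j := by simpa using hi
    rw [this, h1]

theorem isCompact_body : IsCompact (body T) := (Set.finite_range T).isCompact_convexHull ℝ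

theorem isCompact_facet (j : Fin (d + 1)) : IsCompact (facet T j) :=
  ((Set.toFinite _).image T).isCompact_convexHull ℝ

theorem facet_subset_body (j : Fin (d + 1)) : facet T j ⊆ body T :=
  convexHull_mono (Set.image_subset_range _ _)

theorem relFacet_subset_facet (j : Fin (d + 1)) : relFacet T j ⊆ facet T j := by
  intro x hx
  refine (mem_facet T).2 ⟨hx.1, fun i => ?_⟩
  by_cases h : i = j
  · rw [h, hx.1]
  · exact (hx.2 i h).le

theorem measurableSet_relFacet (j : Fin (d + 1)) : MeasurableSet (relFacet T j) := by
  have : relFacet T j = (fun x => T.coord j x) ⁻¹' {0} ∩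
      ⋂ i, ⋂ (_ : i ≠ j), (fun x => T.coord i x) ⁻¹' Set.Ioi 0 := by
    ext x; simp [relFacet]
  rw [this]
  refine ((continuous_coord T j).measurable (measurableSet_singleton _)).inter ?_
  exact MeasurableSet.iInter fun i => MeasurableSet.iInter fun _ =>
    (continuous_coord T i).measurable measurableSet_Ioi

theorem measurableSet_facet (j : Fin (d + 1)) : MeasurableSet (facet T j) :=
  (isCompact_facet T j).isClosed.measurableSet

theorem interior_body_nonempty : (interior (body T)).Nonempty :=
  ⟨_, T.centroid_mem_interior_convexHull⟩

theorem volume_body_pos : 0 < volume (body T) :=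
  (isOpen_interior.measure_pos _ (interior_body_nonempty T)).trans_le
    (measure_mono interior_subset)

theorem volume_body_ne_top : volume (body T) ≠ ∞ := (isCompact_body T).measure_ne_top

theorem exists_ne_index (hd : 1 ≤ d) (j : Fin (d + 1)) : ∃ i, i ≠ j := by
  have : Nontrivial (Fin (d + 1)) := Fin.nontrivial_iff_two_le.2 (by omega)
  exact exists_ne j

theorem grad_ne_zero (hd : 1 ≤ d) (j : Fin (d + 1)) : grad T j ≠ 0 := by
  obtain ⟨i, hi⟩ := exists_ne_index hd j
  intro h
  have := coord_sub T j (T j) (T i)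
  rw [h, inner_zero_left, T.coord_apply_eq, T.coord_apply_ne hi.symm] at this
  norm_num at this

theorem norm_grad_pos (hd : 1 ≤ d) (j : Fin (d + 1)) : 0 < ‖grad T j‖ :=
  norm_pos_iff.2 (grad_ne_zero T hd j)

theorem normal_eq (j : Fin (d + 1)) : normal T j = -(‖grad T j‖⁻¹ • grad T j) := rfl

theorem norm_normal (hd : 1 ≤ d) (j : Fin (d + 1)) : ‖normal T j‖ = 1 := by
  rw [normal_eq, norm_neg, norm_smul, norm_inv, norm_norm,
    inv_mul_cancel₀ (norm_grad_pos T hd j).ne']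

theorem relFacet_nonempty (hd : 1 ≤ d) (j : Fin (d + 1)) : (relFacet T j).Nonempty := by
  classical
  have hd0 : (d : ℝ) ≠ 0 := by positivity
  let w : Fin (d + 1) → ℝ := fun i => if i = j then 0 else (d : ℝ)⁻¹
  have hw : ∑ i, w i = 1 := by
    have h1 := Finset.add_sum_erase Finset.univ w (Finset.mem_univ j)
    rw [← h1]
    simp only [w, if_true, zero_add]
    rw [Finset.sum_congr rfl (g := fun _ => (d : ℝ)⁻¹)
      (fun i hi => by simp [Finset.ne_of_mem_erase hi])]
    rw [Finset.sum_const, Finset.card_erase_of_mem (Finset.mem_univ _)]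
    simp [hd0]
  refine ⟨Finset.univ.affineCombination ℝ T w, ?_, fun i hi => ?_⟩
  · rw [T.coord_apply_combination_of_mem (Finset.mem_univ _) hw]; simp [w]
  · rw [T.coord_apply_combination_of_mem (Finset.mem_univ _) hw]; simp only [w, hi, if_false]
    positivity

theorem facet_subset_closure_relFacet (hd : 1 ≤ d) (j : Fin (d + 1)) :
    facet T j ⊆ closure (relFacet T j) := by
  intro x hx
  obtain ⟨b, hb⟩ := relFacet_nonempty T hd j
  have hx' := (mem_facet T).1 hx
  have hc : Continuous fun t : ℝ => AffineMap.lineMap x b t := by fun_prop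
  have hlim : Tendsto (fun t : ℝ => AffineMap.lineMap x b t) (𝓝[>] 0) (𝓝 x) := by
    have := hc.tendsto 0
    rw [AffineMap.lineMap_apply_zero] at this
    exact this.mono_left nhdsWithin_le_nhds
  refine mem_closure_of_tendsto hlim ?_
  filter_upwards [Ioo_mem_nhdsGT (zero_lt_one' ℝ)] with t ht
  have e : ∀ i, T.coord i (AffineMap.lineMap x b t) =
      (1 - t) * T.coord i x + t * T.coord i b := fun i => by
    rw [AffineMap.apply_lineMap, AffineMap.lineMap_apply_ring]
  refine ⟨?_, fun i hi => ?_⟩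
  · rw [e, hx'.1, hb.1]; simp
  · rw [e]
    have h1 := mul_nonneg (sub_nonneg.2 ht.2.le) (hx'.2 i)
    have h2 := mul_pos ht.1 (hb.2 i hi)
    linarith

/-! ### Facets seen from an apex -/

/-- Seen from `z`, the scaled gradient is the covector normalised as required for cones with apex
`z` over the facet. -/
theorem facet_subset_hyperplane (j : Fin (d + 1)) {z : E d} (hz : T.coord j z ≠ 0) :
    facet T j ⊆ {x | ⟪-((T.coord j z)⁻¹ • grad T j), x - z⟫ = 1} := by
  intro x hx
  have h := coord_sub T j x z
  rw [((mem_facet T).1 hx).1] at h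
  rw [Set.mem_ofPred_eq, inner_neg_left, inner_smul_left, ← h]
  simp [hz]

theorem norm_apex (j : Fin (d + 1)) {z : E d} :
    ‖-((T.coord j z)⁻¹ • grad T j)‖ = ‖grad T j‖ / |T.coord j z| := by
  rw [norm_neg, norm_smul, norm_inv, Real.norm_eq_abs, div_eq_inv_mul]

theorem facet_subset_vertex (j : Fin (d + 1)) :
    facet T j ⊆ {x | ⟪-grad T j, x - T j⟫ = 1} := by
  have := facet_subset_hyperplane T j (z := T j) (by simp)
  simpa using this

theorem cone_facet_subset_body (j : Fin (d + 1)) :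
    cone (-grad T j) (T j) (facet T j) ⊆ body T := by
  intro y hy
  obtain ⟨t, ht, x, hx, rfl⟩ := (mem_cone_iff (facet_subset_vertex T j)).1 hy
  have h1 : T j ∈ body T := subset_convexHull ℝ _ ⟨j, rfl⟩
  have h2 := facet_subset_body T j hx
  exact (convex_convexHull ℝ _).add_smul_sub_mem h1 h2 ⟨ht.1.le, ht.2.le⟩

theorem interior_body_subset_cone (hd : 1 ≤ d) (j : Fin (d + 1)) :
    interior (body T) ⊆ cone (-grad T j) (T j) (relFacet T j) := by
  intro y hy
  rw [mem_interior_body] at hy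
  have h1 : ⟪-grad T j, y - T j⟫ = 1 - T.coord j y := by
    rw [inner_neg_left, ← coord_sub, T.coord_apply_eq]; ring
  have h2 : T.coord j y < 1 := by
    obtain ⟨i, hi⟩ := exists_ne_index hd j
    have := sum_coord T y
    rw [← Finset.add_sum_erase _ _ (Finset.mem_univ j)] at this
    have h3 : 0 < ∑ i ∈ Finset.univ.erase j, T.coord i y :=
      Finset.sum_pos (fun i _ => hy i) ⟨i, by simp [hi]⟩
    linarith
  have h3 : 0 < 1 - T.coord j y := by linarith
  refine ⟨by rw [h1]; exact ⟨h3, by linarith [hy j]⟩, ?_⟩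
  rw [h1]
  have e : ∀ i, T.coord i (T j + (1 - T.coord j y)⁻¹ • (y - T j)) =
      T.coord i (T j) + (1 - T.coord j y)⁻¹ * (T.coord i y - T.coord i (T j)) := fun i => by
    have := coord_sub T i (T j + (1 - T.coord j y)⁻¹ • (y - T j)) (T j)
    rw [add_sub_cancel_left, inner_smul_right, ← coord_sub] at this
    linarith
  refine ⟨?_, fun i hi => ?_⟩
  · rw [e, T.coord_apply_eq]; field_simp; ring
  · rw [e, T.coord_apply_ne hi]
    have := mul_pos (inv_pos.2 h3) (hy i)
    simpa using this

/-- The cone from the opposite vertex contains the interior of the simplex, and the boundary of a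
convex set is null. -/
theorem volume_cone_facet (hd : 1 ≤ d) (j : Fin (d + 1)) :
    volume (cone (-grad T j) (T j) (facet T j)) = volume (body T) := by
  refine le_antisymm (measure_mono (cone_facet_subset_body T j)) ?_
  have h : volume (body T) = volume (interior (body T)) :=
    measure_congr ((convex_convexHull ℝ _).addHaar_frontier volume |> fun h =>
      (interior_ae_eq_of_null_frontier h).symm)
  rw [h]
  refine measure_mono ((interior_body_subset_cone T hd j).trans ?_)
  exact fun y hy => ⟨hy.1, relFacet_subset_facet T j hy.2⟩

/-- This is "volume equals base times height over `d`", the height being `‖grad T j‖⁻¹`. -/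
theorem hausdorff_facet (hd : 1 ≤ d) (j : Fin (d + 1)) :
    μHE[d - 1] (facet T j) = (d : ℝ≥0∞) * ‖grad T j‖ₑ * volume (body T) := by
  rw [hausdorff_eq_volume_cone hd (neg_ne_zero.2 (grad_ne_zero T hd j)) (measurableSet_facet T j)
    (facet_subset_vertex T j), volume_cone_facet T hd, enorm_neg]

theorem hausdorff_facet_ne_top (hd : 1 ≤ d) (j : Fin (d + 1)) : μHE[d - 1] (facet T j) ≠ ∞ := by
  rw [hausdorff_facet T hd]
  exact ENNReal.mul_ne_top (ENNReal.mul_ne_top (by simp) (by simp)) (volume_body_ne_top T)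

theorem volume_coord_eq_zero (i : Fin (d + 1)) :
    volume {x : E d | T.coord i x = 0} = 0 := by
  let S : AffineSubspace ℝ (E d) := (AffineSubspace.mk' (0 : ℝ) ⊥).comap (T.coord i)
  have hS : (S : Set (E d)) = {x : E d | T.coord i x = 0} := by
    ext x
    simp [S, AffineSubspace.mem_mk']
  rw [← hS]
  refine Measure.addHaar_affineSubspace _ _ fun h => ?_
  have : T i ∈ (S : Set (E d)) := by rw [h]; trivial
  rw [hS] at this
  simp at this

/-- The relative boundary lies in planes `λ_i = 0` with `i ≠ j`. These contain the vertex `j`, so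
the cone from that vertex over such a part lies in a plane and has volume zero. -/
theorem hausdorff_facet_diff_relFacet (hd : 1 ≤ d) (j : Fin (d + 1)) :
    μHE[d - 1] (facet T j \ relFacet T j) = 0 := by
  have hsub : facet T j \ relFacet T j ⊆ ⋃ i, ⋃ (_ : i ≠ j), facet T j ∩ {x | T.coord i x = 0} := by
    rintro x ⟨hx, hx'⟩
    have h1 := (mem_facet T).1 hx
    simp only [relFacet, Set.mem_ofPred_eq, not_and, not_forall] at hx'
    obtain ⟨i, hi, hi'⟩ := hx' h1.1
    simp only [Set.mem_iUnion]
    exact ⟨i, hi, hx, le_antisymm (not_lt.1 hi') (h1.2 i)⟩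
  refine measure_mono_null hsub ((measure_iUnion_null_iff).2 fun i =>
    (measure_iUnion_null_iff).2 fun hi => ?_)
  have hm : MeasurableSet (facet T j ∩ {x | T.coord i x = 0}) :=
    (measurableSet_facet T j).inter ((continuous_coord T i).measurable (measurableSet_singleton 0))
  have hs : facet T j ∩ {x | T.coord i x = 0} ⊆ {x | ⟪-grad T j, x - T j⟫ = 1} :=
    Set.inter_subset_left.trans (facet_subset_vertex T j)
  rw [hausdorff_eq_volume_cone hd (neg_ne_zero.2 (grad_ne_zero T hd j)) hm hs]
  refine mul_eq_zero.2 (Or.inr (measure_mono_null ?_ (volume_coord_eq_zero T i)))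
  intro y hy
  obtain ⟨t, ht, x, hx, rfl⟩ := (mem_cone_iff hs).1 hy
  have := coord_sub T i (T j + t • (x - T j)) (T j)
  rw [add_sub_cancel_left, inner_smul_right, ← coord_sub, hx.2, T.coord_apply_ne hi] at this
  simpa using this

theorem relFacet_ae_eq_facet (hd : 1 ≤ d) (j : Fin (d + 1)) :
    relFacet T j =ᵐ[μHE[d - 1]] facet T j :=
  (relFacet_subset_facet T j).eventuallyLE.antisymm
    (ae_le_set.2 (hausdorff_facet_diff_relFacet T hd j))

/-- Surface measure is proportional to the volume of the cone from the opposite vertex, and that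
cone is a neighbourhood of the midpoint between the vertex and `x`. -/
theorem hausdorff_facet_inter_pos (hd : 1 ≤ d) (j : Fin (d + 1)) {U : Set (E d)} (hU : IsOpen U)
    {x : E d} (hx : x ∈ relFacet T j) (hxU : x ∈ U) : 0 < μHE[d - 1] (facet T j ∩ U) := by
  have hs : facet T j ∩ U ⊆ {x | ⟪-grad T j, x - T j⟫ = 1} :=
    Set.inter_subset_left.trans (facet_subset_vertex T j)
  rw [hausdorff_eq_volume_cone hd (neg_ne_zero.2 (grad_ne_zero T hd j))
    ((measurableSet_facet T j).inter hU.measurableSet) hs]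
  have h0 : ‖-grad T j‖ₑ ≠ 0 := by simpa using grad_ne_zero T hd j
  refine ENNReal.mul_pos (mul_ne_zero (by simp; omega) h0) (ne_of_gt ?_)
  set y : E d := T j + (1 / 2 : ℝ) • (x - T j) with hy
  have hxj : ⟪-grad T j, x - T j⟫ = 1 := facet_subset_vertex T j (relFacet_subset_facet T j hx)
  have hyj : ⟪-grad T j, y - T j⟫ = 1 / 2 := by
    rw [hy, add_sub_cancel_left, inner_smul_right, hxj, mul_one]
  have hyi : y ∈ interior (body T) := by
    rw [mem_interior_body]
    intro i
    have := coord_sub T i y (T j)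
    rw [hy, add_sub_cancel_left, inner_smul_right, ← coord_sub] at this
    rw [hy]
    by_cases hi : i = j
    · subst hi
      rw [hx.1, T.coord_apply_eq] at this
      linarith
    · rw [T.coord_apply_ne hi] at this
      linarith [hx.2 i hi]
  refine Measure.measure_pos_of_mem_nhds volume (x := y) ?_
  have hcont : ContinuousAt (fun w : E d => T j + (⟪-grad T j, w - T j⟫)⁻¹ • (w - T j)) y := by
    have h1 : ContinuousAt (fun w : E d => ⟪-grad T j, w - T j⟫) y := by fun_prop
    have h2 : ContinuousAt (fun w : E d => w - T j) y := by fun_prop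
    exact continuousAt_const.add ((h1.inv₀ (by rw [hyj]; norm_num)).smul h2)
  have hyx : T j + (⟪-grad T j, y - T j⟫)⁻¹ • (y - T j) = x := by
    rw [hyj, hy, add_sub_cancel_left, smul_smul]
    norm_num
  have hev := hcont.preimage_mem_nhds (by rw [hyx]; exact hU.mem_nhds hxU)
  filter_upwards [hev, isOpen_interior.mem_nhds hyi] with w hw1 hw2
  have := interior_body_subset_cone T hd j hw2
  exact ⟨this.1, relFacet_subset_facet T j this.2, hw1⟩

theorem lintegral_sq_facet_le {k : ℕ} (hd : 1 ≤ d) (j : Fin (d + 1)) {p : E d → ℝ}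
    (hp : p ∈ polys d k) :
    ∫⁻ x in facet T j, ENNReal.ofReal (p x ^ 2) ∂μHE[d - 1] ≤
      ENNReal.ofReal (((k : ℝ) + 1) * (k + d) * ‖grad T j‖) *
        ∫⁻ y in body T, ENNReal.ofReal (p y ^ 2) := by
  have := lintegral_sq_le_cone hd (neg_ne_zero.2 (grad_ne_zero T hd j)) (measurableSet_facet T j)
    (facet_subset_vertex T j) (hausdorff_facet_ne_top T hd j) hp
  rw [norm_neg] at this
  exact this.trans (mul_le_mul_right (lintegral_mono_set (cone_facet_subset_body T j)) _)

/-! ### Adjacent simplices -/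

theorem eventually_mem_body {j : Fin (d + 1)} {x : E d} (hx : x ∈ relFacet T j) :
    ∀ᶠ y in 𝓝 x, ∀ i, i ≠ j → 0 < T.coord i y := by
  rw [eventually_all]
  intro i
  by_cases hi : i = j
  · simp [hi]
  · have := (continuous_coord T i).continuousAt.preimage_mem_nhds
      (isOpen_Ioi.mem_nhds (hx.2 i hi))
    filter_upwards [this] with y hy _
    exact hy

variable {T} {T' T'' : Simplex d}

/-- A direction along which both coordinates increase would lead from `x` into both interiors. Such
a direction exists unless the two gradients are opposite. -/
theorem exists_grad_eq_neg (hd : 1 ≤ d) (hdisj : Disjoint (interior (body T)) (interior (body T')))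
    {j j' : Fin (d + 1)} {x : E d} (hx : x ∈ relFacet T j) (hx' : x ∈ relFacet T' j') :
    ∃ c : ℝ, 0 < c ∧ grad T' j' = -(c • grad T j) := by
  have hnot : ∀ w : E d, 0 < ⟪grad T j, w⟫ → ¬ 0 < ⟪grad T' j', w⟫ := by
    intro w h1 h2
    have hlim : Tendsto (fun t : ℝ => x + t • w) (𝓝[>] 0) (𝓝 x) := by
      have hc : Continuous fun t : ℝ => x + t • w := by fun_prop
      have := hc.tendsto 0
      simp only [zero_smul, add_zero] at this
      exact this.mono_left nhdsWithin_le_nhds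
    have hev := (hlim.eventually (eventually_mem_body T hx)).and
      ((hlim.eventually (eventually_mem_body T' hx')).and self_mem_nhdsWithin)
    obtain ⟨t, ht1, ht2, ht3⟩ := hev.exists
    have ht3 : 0 < t := ht3
    refine Set.disjoint_left.1 hdisj ((mem_interior_body T (x := x + t • w)).2 fun i => ?_)
      ((mem_interior_body T' (x := x + t • w)).2 fun i => ?_)
    · by_cases hi : i = j
      · have := coord_sub T j (x + t • w) x
        rw [add_sub_cancel_left, inner_smul_right, hx.1, sub_zero] at this
        rw [hi, this]; positivity
      · exact ht1 i hi
    · by_cases hi : i = j'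
      · have := coord_sub T' j' (x + t • w) x
        rw [add_sub_cancel_left, inner_smul_right, hx'.1, sub_zero] at this
        rw [hi, this]; positivity
      · exact ht2 i hi
  have hg := norm_grad_pos T hd j
  have hg' := norm_grad_pos T' hd j'
  set g := grad T j
  set g' := grad T' j'
  have hcs := (abs_le.1 (abs_real_inner_le_norm g g')).1
  have heq : ⟪g, g'⟫ = -(‖g‖ * ‖g'‖) := by
    by_contra hne
    have hlt : -(‖g‖ * ‖g'‖) < ⟪g, g'⟫ := lt_of_le_of_ne hcs (Ne.symm hne)
    -- The bisector of the two gradients has positive product with each unless equality holds in the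
    -- Cauchy–Schwarz inequality.
    refine hnot (‖g'‖ • g + ‖g‖ • g') ?_ ?_
    · rw [inner_add_right, inner_smul_right, inner_smul_right, real_inner_self_eq_norm_sq]
      nlinarith
    · rw [inner_add_right, inner_smul_right, inner_smul_right, real_inner_self_eq_norm_sq,
        real_inner_comm]
      nlinarith
  have h2 : ⟪g, -g'⟫ = ‖g‖ * ‖-g'‖ := by rw [inner_neg_right, heq, norm_neg, neg_neg]
  rw [inner_eq_norm_mul_iff_real, norm_neg] at h2
  refine ⟨‖g'‖ / ‖g‖, by positivity, ?_⟩
  rw [div_eq_inv_mul, mul_smul, h2, smul_smul, inv_mul_cancel₀ hg.ne', one_smul, neg_neg]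

theorem exists_coord_eq_neg (hd : 1 ≤ d) (hdisj : Disjoint (interior (body T)) (interior (body T')))
    {j j' : Fin (d + 1)} {x : E d} (hx : x ∈ relFacet T j) (hx' : x ∈ relFacet T' j') :
    ∃ c : ℝ, 0 < c ∧ ∀ y, T'.coord j' y = -(c * T.coord j y) := by
  obtain ⟨c, hc, h⟩ := exists_grad_eq_neg hd hdisj hx hx'
  refine ⟨c, hc, fun y => ?_⟩
  have h1 := coord_sub T j y x
  have h2 := coord_sub T' j' y x
  rw [hx.1, sub_zero] at h1
  rw [hx'.1, sub_zero, h, inner_neg_left, inner_smul_left, ← h1] at h2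
  simpa using h2

theorem normal_eq_neg (hd : 1 ≤ d) (hdisj : Disjoint (interior (body T)) (interior (body T')))
    {j j' : Fin (d + 1)} {x : E d} (hx : x ∈ relFacet T j) (hx' : x ∈ relFacet T' j') :
    normal T' j' = -normal T j := by
  obtain ⟨c, hc, h⟩ := exists_grad_eq_neg hd hdisj hx hx'
  have hg := norm_grad_pos T hd j
  rw [normal_eq, normal_eq, h, norm_neg, norm_smul, Real.norm_of_nonneg hc.le, smul_neg, smul_smul]
  congr 3
  field_simp

/-- Near `x` all other coordinates stay positive, and the two coordinates belonging to the facets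
have opposite signs; their sign decides in which simplex a point lies. -/
theorem eventually_mem_union (hd : 1 ≤ d) (hdisj : Disjoint (interior (body T)) (interior (body T')))
    {j j' : Fin (d + 1)} {x : E d} (hx : x ∈ relFacet T j) (hx' : x ∈ relFacet T' j') :
    ∀ᶠ y in 𝓝 x, y ∈ body T ∪ body T' := by
  obtain ⟨c, hc, h⟩ := exists_coord_eq_neg hd hdisj hx hx'
  filter_upwards [eventually_mem_body T hx, eventually_mem_body T' hx'] with y h1 h2
  rcases le_total 0 (T.coord j y) with h3 | h3
  · refine Or.inl ((mem_body T).2 fun i => ?_)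
    by_cases hi : i = j
    · rwa [hi]
    · exact (h1 i hi).le
  · refine Or.inr ((mem_body T').2 fun i => ?_)
    by_cases hi : i = j'
    · rw [hi, h]
      nlinarith
    · exact (h2 i hi).le

/-- A plane has two sides: being opposite to the first simplex, the other two would lie on the same
side, yet they must be opposite to each other. -/
theorem not_three_adjacent (hd : 1 ≤ d) (h1 : Disjoint (interior (body T)) (interior (body T')))
    (h2 : Disjoint (interior (body T)) (interior (body T'')))
    (h3 : Disjoint (interior (body T')) (interior (body T'')))
    {j j' j'' : Fin (d + 1)} {x : E d} (hx : x ∈ relFacet T j) (hx' : x ∈ relFacet T' j')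
    (hx'' : x ∈ relFacet T'' j'') : False := by
  obtain ⟨c1, hc1, e1⟩ := exists_coord_eq_neg hd h1 hx hx'
  obtain ⟨c2, hc2, e2⟩ := exists_coord_eq_neg hd h2 hx hx''
  obtain ⟨c3, hc3, e3⟩ := exists_coord_eq_neg hd h3 hx' hx''
  have h := e3 (T j)
  rw [e1, e2, T.coord_apply_eq] at h
  nlinarith [mul_pos hc3 hc1]

theorem notMem_interior_of_mem_relFacet
    (hdisj : Disjoint (interior (body T)) (interior (body T'))) {x : E d} (hx : x ∈ body T') :
    x ∉ interior (body T) := by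
  intro h
  have h1 : x ∈ closure (interior (body T')) := by
    have := (convex_convexHull ℝ (Set.range T')).closure_interior_eq_closure_of_nonempty_interior
      (interior_body_nonempty T')
    rw [body, this]
    exact subset_closure hx
  obtain ⟨y, hy1, hy2⟩ := mem_closure_iff.1 h1 _ isOpen_interior h
  exact Set.disjoint_left.1 hdisj hy1 hy2

end SimplexGeometry


/-! ### Conforming pairs of simplices. -/

section Conforming

variable {d : ℕ} {T T' : Simplex d}

theorem simplex_injective (T : Simplex d) : Function.Injective T := T.ind.injective

theorem exists_vertex_notMem (hne : Set.range T ≠ Set.range T') : ∃ j, T j ∉ Set.range T' := by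
  classical
  by_contra! h
  apply hne
  have hsub : Set.range T ⊆ Set.range T' := by
    rintro _ ⟨j, rfl⟩; exact h j
  refine Set.eq_of_subset_of_ncard_le hsub ?_ (Set.finite_range T')
  rw [← Set.image_univ, ← Set.image_univ, Set.ncard_image_of_injective _ (simplex_injective T),
    Set.ncard_image_of_injective _ (simplex_injective T')]

theorem convexHull_inter_subset_facet {l : Fin (d + 1)} (hl : T l ∉ Set.range T') :
    convexHull ℝ (Set.range T ∩ Set.range T') ⊆ facet T l := by
  refine convexHull_mono ?_
  rintro _ ⟨⟨i, rfl⟩, hi⟩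
  refine ⟨i, ?_, rfl⟩
  rintro rfl
  exact hl hi

theorem disjoint_interior_of_conforming (hne : Set.range T ≠ Set.range T')
    (hsub : body T ∩ body T' ⊆ convexHull ℝ (Set.range T ∩ Set.range T')) :
    Disjoint (interior (body T)) (interior (body T')) := by
  obtain ⟨j, hj⟩ := exists_vertex_notMem hne
  rw [Set.disjoint_left]
  intro x hx hx'
  have h1 := convexHull_inter_subset_facet hj
    (hsub ⟨interior_subset hx, interior_subset hx'⟩)
  exact ((mem_interior_body T).1 hx j).ne' ((mem_facet T).1 h1).1

/-- A point in the relative interior of a facet has positive coordinates at all its `d` vertices, so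
by conformity these are all vertices of `T'`. Exactly one index of `T'` remains, and it is the
opposite one. -/
theorem exists_relFacet_subset
    (hsub : body T ∩ body T' ⊆ convexHull ℝ (Set.range T ∩ Set.range T')) {j : Fin (d + 1)}
    {y : E d} (hy : y ∈ relFacet T j) (hy' : y ∈ body T') :
    ∃ j', relFacet T j ⊆ relFacet T' j' := by
  classical
  have h1 : ∀ l, l ≠ j → ∃ m, T' m = T l := by
    intro l hl
    by_contra hcon
    have h2 := convexHull_inter_subset_facet (T := T) (T' := T') (l := l) hcon
      (hsub ⟨facet_subset_body T j (relFacet_subset_facet T j hy), hy'⟩)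
    exact (hy.2 l hl).ne' ((mem_facet T).1 h2).1
  have h1' : ∀ l, ∃ m, l ≠ j → T' m = T l := fun l => by
    by_cases hl : l = j
    · exact ⟨l, fun h => absurd hl h⟩
    · obtain ⟨m, hm⟩ := h1 l hl; exact ⟨m, fun _ => hm⟩
  choose e he using h1'
  set S : Finset (Fin (d + 1)) := (Finset.univ.erase j).image e with hS
  have hcard : S.card = d := by
    rw [hS, Finset.card_image_of_injOn, Finset.card_erase_of_mem (Finset.mem_univ _)]
    · simp
    · intro a ha b hb hab
      have ha' : a ≠ j := by simpa using ha
      have hb' : b ≠ j := by simpa using hb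
      apply simplex_injective T
      rw [← he a ha', ← he b hb', hab]
  have hcomp : Sᶜ.card = 1 := by rw [Finset.card_compl, hcard]; simp
  obtain ⟨j', hj'⟩ := Finset.card_eq_one.1 hcomp
  refine ⟨j', fun x hx => ⟨?_, fun m hm => ?_⟩⟩
  · rw [affine_eq_sum_coord T]
    refine Finset.sum_eq_zero fun l _ => ?_
    by_cases hl : l = j
    · rw [hl, hx.1, zero_mul]
    · have : j' ≠ e l := by
        rintro rfl
        have h2 : e l ∈ Sᶜ := by rw [hj']; simp
        exact Finset.mem_compl.1 h2 (Finset.mem_image_of_mem e (by simp [hl]))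
      rw [← he l hl, T'.coord_apply_ne this, mul_zero]
  · have hmS : m ∈ S := by
      by_contra hcon
      have : m ∈ Sᶜ := Finset.mem_compl.2 hcon
      rw [hj'] at this
      exact hm (by simpa using this)
    obtain ⟨l, hl, rfl⟩ := Finset.mem_image.1 hmS
    have hl' : l ≠ j := by simpa using hl
    rw [affine_eq_sum_coord T]
    refine Finset.sum_pos' (fun i _ => ?_) ⟨l, Finset.mem_univ _, ?_⟩
    · by_cases hi : i = j
      · rw [hi, hx.1, zero_mul]
      · refine mul_nonneg (hx.2 i hi).le ?_
        rw [← he i hi, T'.coord_apply]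
        split_ifs <;> norm_num
    · rw [← he l hl', T'.coord_apply_eq, mul_one]
      exact hx.2 l hl'

end Conforming

/-! ### Boundary facets of the elements and the trace inequality on star-shaped elements. -/

namespace PolytopicMesh

variable {d : ℕ} (M : PolytopicMesh d)

theorem body_subset_K (i : Fin M.N) (t : Fin (M.n i)) : body (M.T i t) ⊆ M.K i :=
  Set.subset_iUnion (fun t => body (M.T i t)) t

theorem isCompact_K (i : Fin M.N) : IsCompact (M.K i) :=
  isCompact_iUnion fun t => isCompact_body (M.T i t)

theorem face_subset_body (i : Fin M.N) (F : Fin (M.n i) × Fin (d + 1)) :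
    M.face i F ⊆ body (M.T i F.1) := facet_subset_body _ _

theorem mem_bdFaces {i : Fin M.N} {F : Fin (M.n i) × Fin (d + 1)} :
    F ∈ M.bdFaces i ↔ M.face i F ⊆ frontier (M.K i) := by
  simp [bdFaces]

theorem disjoint_same (i : Fin M.N) {t t' : Fin (M.n i)} (h : t ≠ t') :
    Disjoint (interior (body (M.T i t))) (interior (body (M.T i t'))) :=
  disjoint_interior_of_conforming (M.conforming i t t' h).1 (M.conforming i t t' h).2

theorem disjoint_of_ne {i i' : Fin M.N} (h : i ≠ i') (t : Fin (M.n i)) (t' : Fin (M.n i')) :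
    Disjoint (interior (body (M.T i t))) (interior (body (M.T i' t'))) :=
  (M.interior_disjoint i i' h).mono (interior_mono (M.body_subset_K i t))
    (interior_mono (M.body_subset_K i' t'))

/-- The relative interior of the facet `F`. -/
def relFace (i : Fin M.N) (F : Fin (M.n i) × Fin (d + 1)) : Set (E d) := relFacet (M.T i F.1) F.2

theorem relFace_subset_face (i : Fin M.N) (F : Fin (M.n i) × Fin (d + 1)) :
    M.relFace i F ⊆ M.face i F := relFacet_subset_facet _ _

theorem relFace_subset_body (i : Fin M.N) (F : Fin (M.n i) × Fin (d + 1)) :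
    M.relFace i F ⊆ body (M.T i F.1) := (M.relFace_subset_face i F).trans (M.face_subset_body i F)

theorem relFace_ae_eq_face (hd : 1 ≤ d) (i : Fin M.N) (F : Fin (M.n i) × Fin (d + 1)) :
    M.relFace i F =ᵐ[μHE[d - 1]] M.face i F := relFacet_ae_eq_facet (M.T i F.1) hd F.2

variable {M}

/-- A second simplex of the element meeting the relative interior at any point `y` shares the whole
facet. The two simplices then cover a neighbourhood of `x`, which cannot be a boundary point. -/
theorem eq_of_mem_body_of_mem_relFace (hd : 1 ≤ d) {i : Fin M.N} {F : Fin (M.n i) × Fin (d + 1)}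
    {x y : E d} (hx : x ∈ frontier (M.K i)) (hxF : x ∈ M.relFace i F) (hy : y ∈ M.relFace i F)
    {t : Fin (M.n i)} (ht : y ∈ body (M.T i t)) : t = F.1 := by
  by_contra hne
  obtain ⟨j', hj'⟩ := exists_relFacet_subset (M.conforming i F.1 t (Ne.symm hne)).2 hy ht
  have hev := eventually_mem_union hd (M.disjoint_same i (Ne.symm hne)) hxF (hj' hxF)
  refine hx.2 (mem_interior_iff_mem_nhds.2 ?_)
  filter_upwards [hev] with w hw
  rcases hw with hw | hw
  · exact M.body_subset_K _ _ hw
  · exact M.body_subset_K _ _ hw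

theorem eventually_body_of_mem_K (hd : 1 ≤ d) {i : Fin M.N} {F : Fin (M.n i) × Fin (d + 1)}
    {x y : E d} (hx : x ∈ frontier (M.K i)) (hxF : x ∈ M.relFace i F) (hy : y ∈ M.relFace i F) :
    ∀ᶠ w in 𝓝 y, w ∈ M.K i → w ∈ body (M.T i F.1) := by
  have h1 : ∀ᶠ w in 𝓝 y, ∀ t, t ≠ F.1 → w ∉ body (M.T i t) := by
    rw [eventually_all]
    intro t
    by_cases ht : t = F.1
    · simp [ht]
    · have : y ∈ (body (M.T i t))ᶜ := fun h => ht (eq_of_mem_body_of_mem_relFace hd hx hxF hy h)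
      filter_upwards [(isCompact_body (M.T i t)).isClosed.isOpen_compl.mem_nhds this] with w hw _
      exact hw
  filter_upwards [h1] with w hw hwK
  obtain ⟨t, ht⟩ := Set.mem_iUnion.1 hwK
  by_contra hcon
  refine hw t ?_ ht
  rintro rfl
  exact hcon ht

/-- One boundary point in the relative interior forces the whole facet onto the boundary: near each
point of the relative interior the element coincides with a single simplex, and the facet is the
closure of its relative interior. -/
theorem mem_bdFaces_of_mem_relFace (hd : 1 ≤ d) {i : Fin M.N} {F : Fin (M.n i) × Fin (d + 1)}
    {x : E d} (hx : x ∈ frontier (M.K i)) (hxF : x ∈ M.relFace i F) : F ∈ M.bdFaces i := by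
  rw [mem_bdFaces]
  have h1 : M.relFace i F ⊆ frontier (M.K i) := by
    intro y hy
    refine ⟨subset_closure (M.body_subset_K i F.1 (M.relFace_subset_body i F hy)), fun hint => ?_⟩
    have h2 : y ∈ interior (body (M.T i F.1)) := by
      rw [mem_interior_iff_mem_nhds]
      filter_upwards [eventually_body_of_mem_K hd hx hxF hy, mem_interior_iff_mem_nhds.1 hint]
        with w h1 h2
      exact h1 h2
    exact ((mem_interior_body _).1 h2 F.2).ne' hy.1
  exact (facet_subset_closure_relFacet _ hd _).trans
    (closure_minimal h1 isClosed_frontier)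

theorem bdFaces_eq_of_mem (hd : 1 ≤ d) {i : Fin M.N} {F F' : Fin (M.n i) × Fin (d + 1)}
    (hF : F ∈ M.bdFaces i) {x : E d} (hx : x ∈ M.relFace i F) (hx' : x ∈ M.relFace i F') :
    F' = F := by
  have hfr := M.mem_bdFaces.1 hF (M.relFace_subset_face i F hx)
  have h1 := eq_of_mem_body_of_mem_relFace hd hfr hx hx (M.relFace_subset_body i F' hx')
  obtain ⟨t, j⟩ := F
  obtain ⟨t', j'⟩ := F'
  simp only at h1
  subst h1
  have : j' = j := by
    by_contra h
    exact (hx.2 j' h).ne' hx'.1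
  rw [this]

theorem bdFaces_neighbour_unique (hd : 1 ≤ d) {i i' i'' : Fin M.N}
    {F : Fin (M.n i) × Fin (d + 1)} {F' : Fin (M.n i') × Fin (d + 1)}
    {F'' : Fin (M.n i'') × Fin (d + 1)} (hi' : i' ≠ i) (hi'' : i'' ≠ i)
    {x : E d} (hx : x ∈ M.relFace i F) (hx' : x ∈ M.relFace i' F') (hx'' : x ∈ M.relFace i'' F'') :
    i' = i'' := by
  by_contra hne
  exact not_three_adjacent hd (M.disjoint_of_ne hi'.symm _ _) (M.disjoint_of_ne hi''.symm _ _)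
    (M.disjoint_of_ne hne _ _) hx hx' hx''

/-! ### Star-shaped elements -/

theorem mem_interior_K_of_star {i : Fin M.N} {z : E d} {ρ : ℝ} (hρ : 0 < ρ)
    (hstar : ∀ y ∈ Metric.closedBall z ρ, StarConvex ℝ y (M.K i)) {x : E d} (hx : x ∈ M.K i)
    {s : ℝ} (hs0 : 0 ≤ s) (hs : s < 1) : z + s • (x - z) ∈ interior (M.K i) := by
  rw [mem_interior_iff_mem_nhds, Metric.mem_nhds_iff]
  refine ⟨(1 - s) * ρ, mul_pos (by linarith) hρ, fun w hw => ?_⟩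
  have h1s : 0 < 1 - s := by linarith
  -- The point from which `w` is seen in the direction of `x` with the same parameter `s`; it stays
  -- in the ball, so star-shapedness about it puts `w` into the element.
  set y := z + (1 - s)⁻¹ • (w - (z + s • (x - z))) with hy
  have hyb : y ∈ Metric.closedBall z ρ := by
    rw [Metric.mem_ball, dist_eq_norm] at hw
    rw [Metric.mem_closedBall, dist_eq_norm, hy, add_sub_cancel_left, norm_smul, norm_inv,
      Real.norm_of_nonneg h1s.le, inv_mul_le_iff₀ h1s]
    exact hw.le
  have h2 := hstar y hyb hx h1s.le hs0 (by ring)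
  have h3 : (1 - s) • y + s • x = w := by
    rw [hy, smul_add, smul_smul, mul_inv_cancel₀ h1s.ne', one_smul, sub_smul, one_smul, smul_sub]
    abel
  rwa [h3] at h2

/-- The whole ball lies on the inner side of the facet plane: a segment from a facet point to a ball
point on the outer side would stay in the element by star-shapedness, hence near the facet in the
adjacent simplex. Evaluating the coordinate at the lowest point of the ball gives the distance
bound. -/
theorem radius_mul_norm_grad_le (hd : 1 ≤ d) {i : Fin M.N} {z : E d} {ρ : ℝ} (hρ : 0 < ρ)
    (hstar : ∀ y ∈ Metric.closedBall z ρ, StarConvex ℝ y (M.K i))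
    {F : Fin (M.n i) × Fin (d + 1)} (hF : F ∈ M.bdFaces i) :
    ρ * ‖grad (M.T i F.1) F.2‖ ≤ (M.T i F.1).coord F.2 z := by
  set T := M.T i F.1
  obtain ⟨x, hx⟩ := relFacet_nonempty T hd F.2
  have hx' : x ∈ M.relFace i F := hx
  have hfr := M.mem_bdFaces.1 hF (M.relFace_subset_face i F hx)
  have hxK := M.body_subset_K i F.1 (M.relFace_subset_body i F hx)
  have hball : ∀ y ∈ Metric.closedBall z ρ, 0 ≤ T.coord F.2 y := by
    intro y hy
    by_contra! hneg
    have hc : Continuous fun t : ℝ => AffineMap.lineMap x y t := by fun_prop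
    have hlim : Tendsto (fun t : ℝ => AffineMap.lineMap x y t) (𝓝[>] 0) (𝓝 x) := by
      have := hc.tendsto 0
      rw [AffineMap.lineMap_apply_zero] at this
      exact this.mono_left nhdsWithin_le_nhds
    have hev := (hlim.eventually (eventually_body_of_mem_K hd hfr hx' hx')).and
      (Ioo_mem_nhdsGT (zero_lt_one' ℝ))
    obtain ⟨t, h1, ht⟩ := hev.exists
    have hK : AffineMap.lineMap x y t ∈ M.K i := by
      have := hstar y hy hxK ht.1.le (sub_nonneg.2 ht.2.le) (by ring)
      rw [AffineMap.lineMap_apply_module]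
      rwa [add_comm]
    have h2 := (mem_body _).1 (h1 hK) F.2
    have h3 : T.coord F.2 (AffineMap.lineMap x y t) = t * T.coord F.2 y := by
      rw [AffineMap.apply_lineMap, AffineMap.lineMap_apply_ring, hx.1]; simp
    change 0 ≤ T.coord F.2 _ at h2
    rw [h3] at h2
    nlinarith [mul_neg_of_pos_of_neg ht.1 hneg]
  have hg := norm_grad_pos T hd F.2
  have h4 := hball (z - (ρ * ‖grad T F.2‖⁻¹) • grad T F.2) (by
    rw [Metric.mem_closedBall, dist_eq_norm, sub_sub_cancel_left, norm_neg, norm_smul,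
      Real.norm_of_nonneg (by positivity), mul_assoc, inv_mul_cancel₀ hg.ne', mul_one])
  have h5 := coord_sub T F.2 (z - (ρ * ‖grad T F.2‖⁻¹) • grad T F.2) z
  rw [sub_sub_cancel_left, inner_neg_right, inner_smul_right, real_inner_self_eq_norm_sq] at h5
  have h6 : ρ * ‖grad T F.2‖⁻¹ * ‖grad T F.2‖ ^ 2 = ρ * ‖grad T F.2‖ := by
    field_simp
  rw [h6] at h5
  linarith

/-- The trace inequality on a star-shaped element. -/
theorem sum_lintegral_sq_face_le (hd : 1 ≤ d) {i : Fin M.N} {z : E d} {ρ : ℝ} (hρ : 0 < ρ)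
    (hstar : ∀ y ∈ Metric.closedBall z ρ, StarConvex ℝ y (M.K i)) {k : ℕ} {p : E d → ℝ}
    (hp : p ∈ polys d k) :
    ∑ F ∈ M.bdFaces i, ∫⁻ x in M.face i F, ENNReal.ofReal (p x ^ 2) ∂μHE[d - 1] ≤
      ENNReal.ofReal (((k : ℝ) + 1) * (k + d) * ρ⁻¹) *
        ∫⁻ y in M.K i, ENNReal.ofReal (p y ^ 2) := by
  set ν : Fin (M.n i) × Fin (d + 1) → E d := fun F =>
    -(((M.T i F.1).coord F.2 z)⁻¹ • grad (M.T i F.1) F.2) with hν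
  have hz : ∀ F ∈ M.bdFaces i, 0 < (M.T i F.1).coord F.2 z := fun F hF =>
    (mul_pos hρ (norm_grad_pos _ hd _)).trans_le (radius_mul_norm_grad_le hd hρ hstar hF)
  have hsub : ∀ F ∈ M.bdFaces i, M.relFace i F ⊆ {x | ⟪ν F, x - z⟫ = 1} := fun F hF =>
    (M.relFace_subset_face i F).trans (facet_subset_hyperplane _ _ (hz F hF).ne')
  have hKz : ∀ x ∈ M.K i, ∀ t ∈ Set.Ioo (0 : ℝ) 1, z + t • (x - z) ∈ interior (M.K i) :=
    fun x hx t ht => mem_interior_K_of_star hρ hstar hx ht.1.le ht.2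
  have hfr : ∀ F ∈ M.bdFaces i, ∀ x ∈ M.relFace i F, x ∈ frontier (M.K i) := fun F hF x hx =>
    M.mem_bdFaces.1 hF (M.relFace_subset_face i F hx)
  have hxK : ∀ F, ∀ x ∈ M.relFace i F, x ∈ M.K i := fun F x hx =>
    M.body_subset_K i F.1 (M.relFace_subset_body i F hx)
  -- Along a ray from `z`, no point of the element lies beyond a boundary point, since the points
  -- before it are interior. Used in both directions, this shows that a ray meets the boundary once,
  -- so the cones over different boundary facets are disjoint.
  have hray : ∀ x₁ ∈ M.K i, ∀ x₂ ∈ frontier (M.K i), ∀ t₁ ∈ Set.Ioo (0 : ℝ) 1,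
      ∀ t₂ ∈ Set.Ioo (0 : ℝ) 1, z + t₁ • (x₁ - z) = z + t₂ • (x₂ - z) → t₂ ≤ t₁ := by
    intro x₁ h₁ x₂ h₂ t₁ ht₁ t₂ ht₂ h
    by_contra! hlt
    have e : x₂ = z + (t₁ / t₂) • (x₁ - z) := by
      have h' : t₁ • (x₁ - z) = t₂ • (x₂ - z) := add_left_cancel h
      rw [div_eq_inv_mul, mul_smul, h', smul_smul, inv_mul_cancel₀ ht₂.1.ne', one_smul,
        add_sub_cancel]
    refine h₂.2 ?_
    rw [e]
    exact mem_interior_K_of_star hρ hstar h₁ (div_nonneg ht₁.1.le ht₂.1.le)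
      ((div_lt_one ht₂.1).2 hlt)
  have hdisj : Set.PairwiseDisjoint (M.bdFaces i : Set (Fin (M.n i) × Fin (d + 1)))
      (fun F => cone (ν F) z (M.relFace i F)) := by
    intro F hF F' hF' hne
    rw [Function.onFun, Set.disjoint_left]
    intro y hy hy'
    obtain ⟨t, ht, x, hx, hxy⟩ := (mem_cone_iff (hsub F hF)).1 hy
    obtain ⟨t', ht', x', hx', hxy'⟩ := (mem_cone_iff (hsub F' hF')).1 hy'
    have heq : z + t • (x - z) = z + t' • (x' - z) := hxy.trans hxy'.symm
    have h1 := hray x (hxK F x hx) x' (hfr F' hF' x' hx') t ht t' ht' heq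
    have h2 := hray x' (hxK F' x' hx') x (hfr F hF x hx) t' ht' t ht heq.symm
    have h3 : t = t' := le_antisymm h2 h1
    subst h3
    have h4 : x = x' := by
      have := smul_right_injective (E d) ht.1.ne' (add_left_cancel heq)
      exact sub_left_injective this
    subst h4
    exact hne (bdFaces_eq_of_mem hd hF hx hx').symm
  have hmeas : ∀ F ∈ M.bdFaces i, MeasurableSet (cone (ν F) z (M.relFace i F)) := fun F _ =>
    measurableSet_cone (measurableSet_relFacet _ _)
  have hcK : (⋃ F ∈ M.bdFaces i, cone (ν F) z (M.relFace i F)) ⊆ M.K i := by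
    refine Set.iUnion₂_subset fun F hF y hy => ?_
    obtain ⟨t, ht, x, hx, rfl⟩ := (mem_cone_iff (hsub F hF)).1 hy
    exact _root_.interior_subset (hKz x (hxK F x hx) t ht)
  have hterm : ∀ F ∈ M.bdFaces i, ∫⁻ x in M.face i F, ENNReal.ofReal (p x ^ 2) ∂μHE[d - 1] ≤
      ENNReal.ofReal (((k : ℝ) + 1) * (k + d) * ρ⁻¹) *
        ∫⁻ y in cone (ν F) z (M.relFace i F), ENNReal.ofReal (p y ^ 2) := by
    intro F hF
    have hg := norm_grad_pos (M.T i F.1) hd F.2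
    have hn0 : ν F ≠ 0 := by
      rw [hν]
      exact neg_ne_zero.2 (smul_ne_zero (inv_ne_zero (hz F hF).ne') (grad_ne_zero _ hd _))
    have hfin : μHE[d - 1] (M.relFace i F) ≠ ∞ :=
      ((measure_mono (M.relFace_subset_face i F)).trans_lt
        (hausdorff_facet_ne_top (M.T i F.1) hd F.2).lt_top).ne
    -- The distance of every boundary facet plane from the apex is at least `ρ`, which makes the
    -- constant the same for all facets.
    have hnorm : ‖ν F‖ ≤ ρ⁻¹ := by
      have := radius_mul_norm_grad_le hd hρ hstar hF
      rw [hν]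
      simp only
      rw [norm_apex, abs_of_pos (hz F hF), div_le_iff₀ (hz F hF), ← div_eq_inv_mul,
        le_div_iff₀ hρ]
      linarith
    rw [← setLIntegral_congr (M.relFace_ae_eq_face hd i F)]
    refine (lintegral_sq_le_cone hd hn0 (measurableSet_relFacet _ _) (hsub F hF) hfin hp).trans ?_
    refine mul_le_mul_left (ENNReal.ofReal_le_ofReal ?_) _
    exact mul_le_mul_of_nonneg_left hnorm (by positivity)
  refine (Finset.sum_le_sum hterm).trans ?_
  rw [← Finset.mul_sum, ← lintegral_biUnion_finset hdisj hmeas]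
  exact mul_le_mul_right (lintegral_mono_set hcK) _

end PolytopicMesh


/-! ### Symmetric coercive matrices, essential suprema and essentially bounded functions. -/

section MatrixFacts

variable {d : ℕ} {A : Matrix (Fin d) (Fin d) ℝ}

theorem norm_toEuclideanCLM_apply_le (A : Matrix (Fin d) (Fin d) ℝ) (y : E d) :
    ‖Matrix.toEuclideanCLM (𝕜 := ℝ) A y‖ ≤ ‖A‖ * ‖y‖ := by
  rw [← Matrix.l2_opNorm_toEuclideanCLM]
  exact ContinuousLinearMap.le_opNorm _ _

theorem inner_toEuclideanCLM_comm (hA : A.IsSymm) (x y : E d) :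
    ⟪Matrix.toEuclideanCLM (𝕜 := ℝ) A x, y⟫ = ⟪x, Matrix.toEuclideanCLM (𝕜 := ℝ) A y⟫ := by
  rw [real_inner_comm, Matrix.inner_toEuclideanCLM, Matrix.inner_toEuclideanCLM,
    Matrix.dotProduct_mulVec, ← Matrix.mulVec_transpose, hA.eq, dotProduct_comm]

theorem det_ne_zero_of_coercive {D₀ : ℝ} (h0 : 0 < D₀)
    (h : ∀ y : E d, D₀ * ‖y‖ ^ 2 ≤ ⟪y, Matrix.toEuclideanCLM (𝕜 := ℝ) A y⟫) : A.det ≠ 0 := by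
  intro hdet
  obtain ⟨v, hv, hv0⟩ := Matrix.exists_mulVec_eq_zero_iff.2 hdet
  have h1 := h (WithLp.toLp 2 v)
  rw [Matrix.toEuclideanCLM_toLp, hv0, WithLp.toLp_zero, inner_zero_right] at h1
  have h2 : 0 < ‖(WithLp.toLp 2 v : E d)‖ := norm_pos_iff.2 (by simpa using hv)
  have : 0 < D₀ * ‖(WithLp.toLp 2 v : E d)‖ ^ 2 := by positivity
  linarith

theorem toEuclideanCLM_mul_inv (hA : A.det ≠ 0) (y : E d) :
    Matrix.toEuclideanCLM (𝕜 := ℝ) A (Matrix.toEuclideanCLM (𝕜 := ℝ) A⁻¹ y) = y := by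
  have h : A * A⁻¹ = 1 := Matrix.mul_nonsing_inv A (isUnit_iff_ne_zero.2 hA)
  have := congrArg (fun B => Matrix.toEuclideanCLM (𝕜 := ℝ) B y) h
  simpa [map_mul] using this

theorem norm_inv_le_of_coercive {D₀ : ℝ} (h0 : 0 < D₀)
    (h : ∀ y : E d, D₀ * ‖y‖ ^ 2 ≤ ⟪y, Matrix.toEuclideanCLM (𝕜 := ℝ) A y⟫) : ‖A⁻¹‖ ≤ D₀⁻¹ := by
  rw [← Matrix.l2_opNorm_toEuclideanCLM]
  refine ContinuousLinearMap.opNorm_le_bound _ (by positivity) fun y => ?_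
  set w := Matrix.toEuclideanCLM (𝕜 := ℝ) A⁻¹ y with hw
  have h1 := h w
  rw [hw, toEuclideanCLM_mul_inv (det_ne_zero_of_coercive h0 h), ← hw] at h1
  have h2 := real_inner_le_norm w y
  rw [inv_mul_eq_div, le_div_iff₀ h0]
  by_contra! hcon
  have hwpos : 0 < ‖w‖ := by
    by_contra hw0
    have : ‖w‖ = 0 := le_antisymm (not_lt.1 hw0) (norm_nonneg _)
    rw [this, zero_mul] at hcon
    linarith [norm_nonneg y]
  nlinarith

theorem sq_inner_le_of_coercive (hs : A.IsSymm)
    (h : ∀ y : E d, 0 ≤ ⟪y, Matrix.toEuclideanCLM (𝕜 := ℝ) A y⟫) (x y : E d) :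
    ⟪x, Matrix.toEuclideanCLM (𝕜 := ℝ) A y⟫ ^ 2 ≤
      ⟪x, Matrix.toEuclideanCLM (𝕜 := ℝ) A x⟫ * ⟪y, Matrix.toEuclideanCLM (𝕜 := ℝ) A y⟫ := by
  have key : ∀ t : ℝ, 0 ≤ ⟪y, Matrix.toEuclideanCLM (𝕜 := ℝ) A y⟫ * (t * t) +
      2 * ⟪x, Matrix.toEuclideanCLM (𝕜 := ℝ) A y⟫ * t +
      ⟪x, Matrix.toEuclideanCLM (𝕜 := ℝ) A x⟫ := by
    intro t
    have h1 := h (x + t • y)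
    rw [map_add, map_smul, inner_add_left, inner_add_right, inner_add_right, inner_smul_left,
      inner_smul_left, inner_smul_right, inner_smul_right] at h1
    have h2 : ⟪y, Matrix.toEuclideanCLM (𝕜 := ℝ) A x⟫ =
        ⟪x, Matrix.toEuclideanCLM (𝕜 := ℝ) A y⟫ := by
      rw [← inner_toEuclideanCLM_comm hs, real_inner_comm]
    rw [h2] at h1
    simp only [conj_trivial] at h1
    linarith
  have := discrim_le_zero key
  rw [discrim] at this
  nlinarith

/-- Write `y = A w` and apply the Cauchy–Schwarz inequality of `A`: `‖y‖⁴ ≤ ⟪y, A y⟫ ⟪w, y⟫`, where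
the last factor is at most `‖A⁻¹‖ ‖y‖²`. -/
theorem norm_sq_le_of_coercive {D₀ : ℝ} (h0 : 0 < D₀) (hs : A.IsSymm)
    (h : ∀ y : E d, D₀ * ‖y‖ ^ 2 ≤ ⟪y, Matrix.toEuclideanCLM (𝕜 := ℝ) A y⟫) (y : E d) :
    ‖y‖ ^ 2 ≤ ‖A⁻¹‖ * ⟪Matrix.toEuclideanCLM (𝕜 := ℝ) A y, y⟫ := by
  have hpos : ∀ y : E d, 0 ≤ ⟪y, Matrix.toEuclideanCLM (𝕜 := ℝ) A y⟫ := fun y =>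
    (by positivity : 0 ≤ D₀ * ‖y‖ ^ 2).trans (h y)
  set w := Matrix.toEuclideanCLM (𝕜 := ℝ) A⁻¹ y with hw
  have hAw : Matrix.toEuclideanCLM (𝕜 := ℝ) A w = y :=
    toEuclideanCLM_mul_inv (det_ne_zero_of_coercive h0 h) y
  have h1 := sq_inner_le_of_coercive hs hpos y w
  rw [hAw, real_inner_self_eq_norm_sq] at h1
  have h2 : ⟪w, y⟫ ≤ ‖A⁻¹‖ * ‖y‖ ^ 2 := by
    refine (real_inner_le_norm _ _).trans ?_
    have := mul_le_mul_of_nonneg_right (norm_toEuclideanCLM_apply_le A⁻¹ y) (norm_nonneg y)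
    rw [← hw] at this
    linarith [this]
  rw [real_inner_comm]
  have hp := hpos y
  by_cases hy : ‖y‖ = 0
  · rw [hy]
    simpa using mul_nonneg (norm_nonneg A⁻¹) hp
  · have hy' : 0 < ‖y‖ ^ 2 := by positivity
    have h3 := mul_le_mul_of_nonneg_left h2 hp
    have h4 : ‖y‖ ^ 2 * ‖y‖ ^ 2 ≤
        (‖A⁻¹‖ * ⟪y, Matrix.toEuclideanCLM (𝕜 := ℝ) A y⟫) * ‖y‖ ^ 2 := by nlinarith
    exact le_of_mul_le_mul_right h4 hy'

theorem norm_le_sum_entries (A : Matrix (Fin d) (Fin d) ℝ) :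
    ‖A‖ ≤ ∑ a, ∑ b, |A a b| * ‖(Matrix.single a b (1 : ℝ) : Matrix (Fin d) (Fin d) ℝ)‖ := by
  conv_lhs => rw [Matrix.matrix_eq_sum_single A]
  refine (norm_sum_le _ _).trans (Finset.sum_le_sum fun a _ => (norm_sum_le _ _).trans
    (Finset.sum_le_sum fun b _ => ?_))
  have : Matrix.single a b (A a b) = A a b • Matrix.single a b (1 : ℝ) := by
    rw [Matrix.smul_single, smul_eq_mul, mul_one]
  rw [this, norm_smul, Real.norm_eq_abs]

end MatrixFacts

section SupNorm

variable {d : ℕ} {F : Type*} [NormedAddCommGroup F] {f : E d → F} {S S' : Set (E d)}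

theorem supNorm_nonneg : 0 ≤ supNorm f S := ENNReal.toReal_nonneg

/-- The bound `B` only ensures finiteness: an infinite essential supremum would be turned into 0 by
`toReal`. -/
theorem ae_norm_le_supNorm {B : ℝ} (hB : ∀ᵐ x ∂volume.restrict S, ‖f x‖ ≤ B) :
    ∀ᵐ x ∂volume.restrict S, ‖f x‖ ≤ supNorm f S := by
  have h1 := (eLpNormEssSup_lt_top_of_ae_bound hB).ne
  filter_upwards [ae_le_eLpNormEssSup (f := f) (μ := volume.restrict S)] with x hx
  rw [supNorm, ← toReal_enorm]
  exact ENNReal.toReal_mono h1 hx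

theorem supNorm_mono {B : ℝ} (hB : ∀ᵐ x ∂volume.restrict S', ‖f x‖ ≤ B) (h : S ⊆ S') :
    supNorm f S ≤ supNorm f S' :=
  ENNReal.toReal_mono (eLpNormEssSup_lt_top_of_ae_bound hB).ne
    (eLpNormEssSup_mono_measure f (Measure.restrict_mono_set volume h).absolutelyContinuous)

theorem le_supNorm {B b : ℝ} (hB : ∀ᵐ x ∂volume.restrict S, ‖f x‖ ≤ B) (hS : volume S ≠ 0)
    (hb : ∀ᵐ x ∂volume.restrict S, b ≤ ‖f x‖) : b ≤ supNorm f S := by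
  have : (ae (volume.restrict S)).NeBot := by
    rw [ae_neBot]; simpa [Measure.restrict_eq_zero] using hS
  obtain ⟨x, h1, h2⟩ := ((ae_norm_le_supNorm hB).and hb).exists
  exact h2.trans h1

end SupNorm

section BddMeas

variable {d : ℕ} {ν : Measure (E d)} {F : Type*} [NormedAddCommGroup F]

/-- Essentially bounded strongly measurable functions. -/
def BddMeas (ν : Measure (E d)) (g : E d → F) : Prop :=
  AEStronglyMeasurable g ν ∧ ∃ B : ℝ, ∀ᵐ x ∂ν, ‖g x‖ ≤ B

theorem BddMeas.add {g h : E d → F} (hg : BddMeas ν g) (hh : BddMeas ν h) :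
    BddMeas ν (fun x => g x + h x) := by
  obtain ⟨B, hB⟩ := hg.2
  obtain ⟨C, hC⟩ := hh.2
  refine ⟨hg.1.add hh.1, B + C, ?_⟩
  filter_upwards [hB, hC] with x h1 h2
  exact (norm_add_le _ _).trans (add_le_add h1 h2)

theorem BddMeas.smul [NormedSpace ℝ F] {g : E d → ℝ} {h : E d → F} (hg : BddMeas ν g)
    (hh : BddMeas ν h) : BddMeas ν (fun x => g x • h x) := by
  obtain ⟨B, hB⟩ := hg.2
  obtain ⟨C, hC⟩ := hh.2
  refine ⟨hg.1.smul hh.1, |B| * C, ?_⟩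
  filter_upwards [hB, hC] with x h1 h2
  rw [norm_smul]
  exact mul_le_mul (h1.trans (le_abs_self B)) h2 (norm_nonneg _) (abs_nonneg _)

theorem BddMeas.mul {g h : E d → ℝ} (hg : BddMeas ν g)
    (hh : BddMeas ν h) : BddMeas ν (fun x => g x * h x) := hg.smul hh

theorem BddMeas.const (a : F) : BddMeas ν (fun _ => a) :=
  ⟨aestronglyMeasurable_const, ‖a‖, Eventually.of_forall fun _ => le_rfl⟩

theorem BddMeas.inner {g h : E d → E d} (hg : BddMeas ν g)
    (hh : BddMeas ν h) : BddMeas ν (fun x => ⟪g x, h x⟫) := by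
  obtain ⟨B, hB⟩ := hg.2
  obtain ⟨C, hC⟩ := hh.2
  refine ⟨hg.1.inner hh.1, |B| * C, ?_⟩
  filter_upwards [hB, hC] with x h1 h2
  exact (norm_inner_le_norm _ _).trans
    (mul_le_mul (h1.trans (le_abs_self B)) h2 (norm_nonneg _) (abs_nonneg _))

theorem BddMeas.integrable {g : E d → ℝ} (hg : BddMeas ν g) (hν : ν Set.univ ≠ ∞) :
    Integrable g ν := by
  have : IsFiniteMeasure ν := ⟨hν.lt_top⟩
  obtain ⟨B, hB⟩ := hg.2
  exact Integrable.of_bound hg.1 B hB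

theorem BddMeas.mono {ν' : Measure (E d)} {g : E d → F} (hg : BddMeas ν g) (h : ν' ≤ ν) :
    BddMeas ν' g := by
  obtain ⟨B, hB⟩ := hg.2
  exact ⟨hg.1.mono_measure h, B, ae_mono h hB⟩

theorem BddMeas.of_continuous {S : Set (E d)} {μ : Measure (E d)} (hS : IsCompact S) {g : E d → F}
    [SecondCountableTopology F] (hg : Continuous g) : BddMeas (μ.restrict S) g := by
  obtain ⟨B, hB⟩ := hS.exists_bound_of_continuousOn hg.continuousOn
  exact ⟨hg.aestronglyMeasurable, B, ae_restrict_of_forall_mem hS.isClosed.measurableSet hB⟩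

theorem BddMeas.clm {A : E d → Matrix (Fin d) (Fin d) ℝ} {g : E d → E d} {B : ℝ}
    (hA : ∀ a b, AEStronglyMeasurable (fun x => A x a b) ν) (hB : ∀ᵐ x ∂ν, ‖A x‖ ≤ B)
    (hg : BddMeas ν g) : BddMeas ν (fun x => Matrix.toEuclideanCLM (𝕜 := ℝ) (A x) (g x)) := by
  obtain ⟨C, hC⟩ := hg.2
  refine ⟨?_, |B| * C, ?_⟩
  · have e : (fun x => Matrix.toEuclideanCLM (𝕜 := ℝ) (A x) (g x)) =
        fun x => ∑ a, (∑ b, A x a b * g x b) • EuclideanSpace.single a (1 : ℝ) := by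
      ext x i
      rw [Matrix.ofLp_toEuclideanCLM, Matrix.mulVec, dotProduct]
      simp [Pi.single_apply]
    rw [e]
    refine Finset.aestronglyMeasurable_fun_sum _ fun a _ => AEStronglyMeasurable.smul_const ?_ _
    refine Finset.aestronglyMeasurable_fun_sum _ fun b _ => (hA a b).mul ?_
    exact (EuclideanSpace.proj (𝕜 := ℝ) b).continuous.comp_aestronglyMeasurable hg.1
  · filter_upwards [hB, hC] with x h1 h2
    exact (norm_toEuclideanCLM_apply_le _ _).trans
      (mul_le_mul (h1.trans (le_abs_self B)) h2 (norm_nonneg _) (abs_nonneg _))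

end BddMeas

/-! ### Bounds for the coefficients and the trace of `D` on each element. -/

namespace PolytopicMesh

variable {d : ℕ} (M : PolytopicMesh d)

/-- The closed element may leave `Ω`, but only through boundaries of simplices, which are null. -/
theorem restrict_K_le (i : Fin M.N) : volume.restrict (M.K i) ≤ volume.restrict M.Ω := by
  have h : volume (M.K i \ M.Ω) = 0 := by
    have hsub : M.K i \ M.Ω ⊆ ⋃ t, frontier (body (M.T i t)) := by
      rintro x ⟨hx, hxΩ⟩
      obtain ⟨t, ht⟩ := Set.mem_iUnion.1 hx
      refine Set.mem_iUnion.2 ⟨t, subset_closure ht, fun hint => hxΩ ?_⟩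
      exact M.interior_subset i (interior_mono (M.body_subset_K i t) hint)
    exact measure_mono_null hsub (measure_iUnion_null fun t =>
      (convex_convexHull ℝ _).addHaar_frontier volume)
  exact Measure.restrict_mono_ae (ae_le_set.2 h)

theorem restrict_K_absolutelyContinuous (i : Fin M.N) :
    volume.restrict (M.K i) ≪ volume.restrict M.Ω :=
  (M.restrict_K_le i).absolutelyContinuous

theorem restrict_body_le (i : Fin M.N) (t : Fin (M.n i)) :
    volume.restrict (body (M.T i t)) ≤ volume.restrict (M.K i) :=
  Measure.restrict_mono_set volume (M.body_subset_K i t)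

theorem volume_K_ne_top (i : Fin M.N) : volume (M.K i) ≠ ∞ := (M.isCompact_K i).measure_ne_top

end PolytopicMesh

namespace Coeff

variable {d : ℕ} {M : PolytopicMesh d} (c : Coeff M)

theorem exists_bound_D : ∃ B : ℝ, ∀ i, ∀ᵐ x ∂volume.restrict (M.K i), ‖c.D x‖ ≤ B := by
  have h1 : ∀ a b, ∃ B : ℝ, ∀ᵐ x ∂volume.restrict M.Ω, |c.D x a b| ≤ B := fun a b => by
    have h := (c.D_memLp a b).2
    rw [eLpNorm_exponent_top] at h
    refine ⟨(eLpNormEssSup (fun x => c.D x a b) (volume.restrict M.Ω)).toReal, ?_⟩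
    filter_upwards [ae_le_eLpNormEssSup (f := fun x => c.D x a b) (μ := volume.restrict M.Ω)]
      with x hx
    rw [← Real.norm_eq_abs, ← toReal_enorm]
    exact ENNReal.toReal_mono h.ne hx
  choose B hB using h1
  refine ⟨∑ a, ∑ b, B a b * ‖(Matrix.single a b (1 : ℝ) : Matrix (Fin d) (Fin d) ℝ)‖, fun i => ?_⟩
  refine (M.restrict_K_absolutelyContinuous i).ae_le ?_
  filter_upwards [ae_all_iff.2 fun a => ae_all_iff.2 fun b => hB a b] with x hx
  refine (norm_le_sum_entries _).trans (Finset.sum_le_sum fun a _ => Finset.sum_le_sum fun b _ => ?_)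
  exact mul_le_mul_of_nonneg_right (hx a b) (norm_nonneg _)

theorem ae_coercive : ∃ D₀ : ℝ, 0 < D₀ ∧ ∀ i, ∀ᵐ x ∂volume.restrict (M.K i), (c.D x).IsSymm ∧
    ∀ y : E d, D₀ * ‖y‖ ^ 2 ≤ ⟪y, Matrix.toEuclideanCLM (𝕜 := ℝ) (c.D x) y⟫ := by
  obtain ⟨D₀, h0, h⟩ := c.D_pos
  exact ⟨D₀, h0, fun i => (M.restrict_K_absolutelyContinuous i).ae_le (c.D_symm.and h)⟩

theorem ae_norm_D_le (i : Fin M.N) :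
    ∀ᵐ x ∂volume.restrict (M.K i), ‖c.D x‖ ≤ supNorm c.D (M.K i) := by
  obtain ⟨B, hB⟩ := c.exists_bound_D
  exact ae_norm_le_supNorm (hB i)

theorem exists_bound_inv : ∃ B : ℝ, ∀ i, ∀ᵐ x ∂volume.restrict (M.K i), ‖(c.D x)⁻¹‖ ≤ B := by
  obtain ⟨D₀, h0, h⟩ := c.ae_coercive
  refine ⟨D₀⁻¹, fun i => ?_⟩
  filter_upwards [h i] with x hx
  exact norm_inv_le_of_coercive h0 hx.2

theorem ae_norm_sq_le (i : Fin M.N) : ∀ᵐ x ∂volume.restrict (M.K i), ∀ y : E d,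
    ‖y‖ ^ 2 ≤ supNorm (fun x => (c.D x)⁻¹) (M.K i) *
      ⟪Matrix.toEuclideanCLM (𝕜 := ℝ) (c.D x) y, y⟫ := by
  obtain ⟨D₀, h0, h⟩ := c.ae_coercive
  obtain ⟨B, hB⟩ := c.exists_bound_inv
  filter_upwards [h i, ae_norm_le_supNorm (hB i)] with x hx hx' y
  refine (norm_sq_le_of_coercive h0 hx.1 hx.2 y).trans (mul_le_mul_of_nonneg_right hx' ?_)
  rw [real_inner_comm]
  exact (by positivity : 0 ≤ D₀ * ‖y‖ ^ 2).trans (hx.2 y)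

theorem supNorm_D_pos (hd : 1 ≤ d) (i : Fin M.N) (hK : volume (M.K i) ≠ 0) :
    0 < supNorm c.D (M.K i) := by
  obtain ⟨D₀, h0, h⟩ := c.ae_coercive
  obtain ⟨B, hB⟩ := c.exists_bound_D
  refine h0.trans_le (le_supNorm (hB i) hK ?_)
  filter_upwards [h i] with x hx
  have h1 := hx.2 (EuclideanSpace.single ⟨0, hd⟩ 1)
  have h2 := real_inner_le_norm (EuclideanSpace.single (⟨0, hd⟩ : Fin d) (1 : ℝ))
    (Matrix.toEuclideanCLM (𝕜 := ℝ) (c.D x) (EuclideanSpace.single ⟨0, hd⟩ 1))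
  have h3 := norm_toEuclideanCLM_apply_le (c.D x) (EuclideanSpace.single ⟨0, hd⟩ 1)
  rw [PiLp.norm_single, norm_one] at *
  linarith

theorem supNorm_inv_pos (hd : 1 ≤ d) (i : Fin M.N) (hK : volume (M.K i) ≠ 0) :
    0 < supNorm (fun x => (c.D x)⁻¹) (M.K i) := by
  have hne : (ae (volume.restrict (M.K i))).NeBot := by
    rw [ae_neBot]; simpa [Measure.restrict_eq_zero] using hK
  obtain ⟨x, hx⟩ := (c.ae_norm_sq_le i).exists
  have h1 := hx (EuclideanSpace.single ⟨0, hd⟩ 1)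
  rw [PiLp.norm_single, norm_one, one_pow] at h1
  refine lt_of_le_of_ne supNorm_nonneg fun h => ?_
  rw [← h, zero_mul] at h1
  linarith

theorem δ_pos (hd : 1 ≤ d) (i : Fin M.N) (hK : volume (M.K i) ≠ 0) : 0 < c.δ i :=
  mul_pos (pow_pos (c.supNorm_D_pos hd i hK) 2) (c.supNorm_inv_pos hd i hK)

theorem exists_bound_μ : ∃ B : ℝ, ∀ i, ∀ᵐ x ∂volume.restrict (M.K i), ‖c.μ x‖ ≤ B := by
  have h := c.μ_memLp.2
  rw [eLpNorm_exponent_top] at h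
  refine ⟨(eLpNormEssSup c.μ (volume.restrict M.Ω)).toReal, fun i => ?_⟩
  refine (M.restrict_K_absolutelyContinuous i).ae_le ?_
  filter_upwards [ae_le_eLpNormEssSup (f := c.μ) (μ := volume.restrict M.Ω)] with x hx
  rw [← toReal_enorm]
  exact ENNReal.toReal_mono h.ne hx

theorem ae_μ_nonneg (i : Fin M.N) : ∀ᵐ x ∂volume.restrict (M.K i), 0 ≤ c.μ x :=
  (M.restrict_K_absolutelyContinuous i).ae_le c.μ_nonneg

theorem aestronglyMeasurable_D (i : Fin M.N) (a b : Fin d) :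
    AEStronglyMeasurable (fun x => c.D x a b) (volume.restrict (M.K i)) :=
  (c.D_memLp a b).1.mono_ac (M.restrict_K_absolutelyContinuous i)

/-- The trace is an essential limit of values bounded by the supremum norm. This needs a nontrivial
filter, that is, positive volume of the element near each of its boundary points, which the
simplices provide. -/
theorem ae_norm_Dtr_le (i : Fin M.N) : ∀ᵐ x ∂(μHE[d - 1] : Measure (E d)).restrict
    (frontier (M.K i)), ‖c.Dtr i x‖ ≤ supNorm c.D (M.K i) := by
  have hmem : ∀ᵐ x ∂(μHE[d - 1] : Measure (E d)).restrict (frontier (M.K i)),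
      x ∈ frontier (M.K i) := ae_restrict_mem isClosed_frontier.measurableSet
  filter_upwards [c.Dtr_trace i, hmem] with x hx hxf
  have hxK : x ∈ M.K i := (M.isCompact_K i).isClosed.frontier_subset hxf
  have hne : (𝓝[M.K i] x ⊓ ae volume).NeBot := by
    rw [← Filter.frequently_true_iff_neBot, Filter.frequently_iff]
    intro U hU
    obtain ⟨V, hV, W, hW, rfl⟩ := Filter.mem_inf_iff.1 hU
    obtain ⟨O, hO, hxO, hOK⟩ := mem_nhdsWithin.1 hV
    obtain ⟨t, ht⟩ := Set.mem_iUnion.1 hxK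
    have h1 : x ∈ closure (interior (body (M.T i t))) := by
      have := (convex_convexHull ℝ
        (Set.range (M.T i t))).closure_interior_eq_closure_of_nonempty_interior
        (interior_body_nonempty (M.T i t))
      rw [body, this]
      exact subset_closure ht
    obtain ⟨y, hy1, hy2⟩ := mem_closure_iff.1 h1 O hO hxO
    have hpos : 0 < volume (O ∩ interior (body (M.T i t))) :=
      (hO.inter isOpen_interior).measure_pos _ ⟨y, hy1, hy2⟩
    have hpos2 : volume ((O ∩ interior (body (M.T i t))) ∩ W) ≠ 0 := by
      rw [measure_inter_conull (mem_ae_iff.1 hW)]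
      exact hpos.ne'
    obtain ⟨w, hw⟩ := nonempty_of_measure_ne_zero hpos2
    exact ⟨w, ⟨hOK ⟨hw.1.1, M.body_subset_K i t (_root_.interior_subset hw.1.2)⟩, hw.2⟩, trivial⟩
  refine le_of_tendsto hx.norm ?_
  have h2 := c.ae_norm_D_le i
  rw [ae_restrict_iff' (M.isCompact_K i).isClosed.measurableSet] at h2
  have h3 : ∀ᶠ y in 𝓝[M.K i] x ⊓ ae volume, y ∈ M.K i :=
    Filter.mem_inf_of_left self_mem_nhdsWithin
  have h4 : ∀ᶠ y in 𝓝[M.K i] x ⊓ ae volume, y ∈ M.K i → ‖c.D y‖ ≤ supNorm c.D (M.K i) :=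
    Filter.mem_inf_of_right h2
  filter_upwards [h3, h4] with y h5 h6
  exact h6 h5

end Coeff


/-! ### Linearity, monotonicity and one-sided bounds of skeleton integrals. -/

namespace PolytopicMesh

variable {d : ℕ} (M : PolytopicMesh d)

/-- Families of polynomials of degree at most `k` over the simplices of the submesh. -/
def BP (k : ℕ) : Submodule ℝ M.Broken where
  carrier := {w | ∀ i t, w i t ∈ polys d k}
  add_mem' hw hv i t := Submodule.add_mem _ (hw i t) (hv i t)
  zero_mem' _ _ := Submodule.zero_mem _
  smul_mem' a _ hw i t := Submodule.smul_mem _ a (hw i t)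

variable {M} {k : ℕ}

theorem WT_subset_BP {w : M.Broken} (hw : w ∈ M.WT k) : w ∈ M.BP k := hw.1

theorem mem_VP {v : Fin M.N → E d → ℝ} : v ∈ M.VP k ↔ ∀ i, v i ∈ polys d k := by
  simp [VP, Submodule.mem_pi]

theorem toBroken_mem_BP {v : Fin M.N → E d → ℝ} (hv : v ∈ M.VP k) : M.toBroken v ∈ M.BP k :=
  fun i _ => mem_VP.1 hv i

/-- Integrands on the skeleton. -/
abbrev SkelFun (M : PolytopicMesh d) : Type :=
  (i : Fin M.N) → Fin (M.n i) × Fin (d + 1) → (i' : Fin M.N) → Fin (M.n i') × Fin (d + 1) →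
    E d → ℝ

/-- Integrands on the boundary part of the skeleton. -/
abbrev BdFun (M : PolytopicMesh d) : Type :=
  (i : Fin M.N) → Fin (M.n i) × Fin (d + 1) → E d → ℝ

/-- Essential boundedness and measurability of an integrand on the skeleton. -/
def SkelBdd (M : PolytopicMesh d) (g : SkelFun M) (b : BdFun M) : Prop :=
  (∀ i i', ∀ F ∈ M.bdFaces i, ∀ F' ∈ M.bdFaces i',
    BddMeas ((μHE[d - 1] : Measure (E d)).restrict (M.face i F ∩ M.face i' F' ∩ M.Ω))
      (g i F i' F')) ∧
  ∀ i, ∀ F ∈ M.bdFaces i,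
    BddMeas ((μHE[d - 1] : Measure (E d)).restrict (M.face i F ∩ frontier M.Ω)) (b i F)

theorem hausdorff_face_ne_top (hd : 1 ≤ d) (i : Fin M.N) (F : Fin (M.n i) × Fin (d + 1)) :
    μHE[d - 1] (M.face i F) ≠ ∞ := hausdorff_facet_ne_top _ hd _

theorem integrableOn_of_bddMeas_face (hd : 1 ≤ d) {i : Fin M.N} {F : Fin (M.n i) × Fin (d + 1)}
    {S : Set (E d)} (hS : S ⊆ M.face i F) {g : E d → ℝ}
    (hg : BddMeas ((μHE[d - 1] : Measure (E d)).restrict S) g) :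
    IntegrableOn g S μHE[d - 1] := by
  refine hg.integrable ?_
  rw [Measure.restrict_apply_univ]
  exact ((measure_mono hS).trans_lt (hausdorff_face_ne_top hd i F).lt_top).ne

theorem interior_piece_subset (i i' : Fin M.N) (F : Fin (M.n i) × Fin (d + 1))
    (F' : Fin (M.n i') × Fin (d + 1)) : M.face i F ∩ M.face i' F' ∩ M.Ω ⊆ M.face i F :=
  fun _ hx => hx.1.1

theorem SkelBdd.integrable_left (hd : 1 ≤ d) {g : SkelFun M} {b : BdFun M} (h : SkelBdd M g b)
    {i i' : Fin M.N} {F : Fin (M.n i) × Fin (d + 1)} (hF : F ∈ M.bdFaces i)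
    {F' : Fin (M.n i') × Fin (d + 1)} (hF' : F' ∈ M.bdFaces i') :
    IntegrableOn (g i F i' F') (M.face i F ∩ M.face i' F' ∩ M.Ω) μHE[d - 1] :=
  integrableOn_of_bddMeas_face hd (interior_piece_subset i i' F F') (h.1 i i' F hF F' hF')

theorem SkelBdd.integrable_right (hd : 1 ≤ d) {g : SkelFun M} {b : BdFun M} (h : SkelBdd M g b)
    {i : Fin M.N} {F : Fin (M.n i) × Fin (d + 1)} (hF : F ∈ M.bdFaces i) :
    IntegrableOn (b i F) (M.face i F ∩ frontier M.Ω) μHE[d - 1] :=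
  integrableOn_of_bddMeas_face hd Set.inter_subset_left (h.2 i F hF)

theorem SkelBdd.add {g g' : SkelFun M} {b b' : BdFun M} (h : SkelBdd M g b) (h' : SkelBdd M g' b') :
    SkelBdd M (g + g') (b + b') :=
  ⟨fun i i' F hF F' hF' => (h.1 i i' F hF F' hF').add (h'.1 i i' F hF F' hF'),
    fun i F hF => (h.2 i F hF).add (h'.2 i F hF)⟩

theorem SkelBdd.smul {g : SkelFun M} {b : BdFun M} (a : ℝ) (h : SkelBdd M g b) :
    SkelBdd M (a • g) (a • b) :=
  ⟨fun i i' F hF F' hF' => (BddMeas.const a).smul (h.1 i i' F hF F' hF'),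
    fun i F hF => (BddMeas.const a).smul (h.2 i F hF)⟩

theorem skeletonIntegral_add (hd : 1 ≤ d) {g g' : SkelFun M} {b b' : BdFun M}
    (h : SkelBdd M g b) (h' : SkelBdd M g' b') :
    M.skeletonIntegral (g + g') (b + b') =
      M.skeletonIntegral g b + M.skeletonIntegral g' b' := by
  have e1 : ∀ i, ∀ i' ∈ Finset.univ.erase i, ∀ F ∈ M.bdFaces i, ∀ F' ∈ M.bdFaces i',
      ∫ x in M.face i F ∩ M.face i' F' ∩ M.Ω, (g + g') i F i' F' x ∂μHE[d - 1] =
      (∫ x in M.face i F ∩ M.face i' F' ∩ M.Ω, g i F i' F' x ∂μHE[d - 1]) +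
      ∫ x in M.face i F ∩ M.face i' F' ∩ M.Ω, g' i F i' F' x ∂μHE[d - 1] :=
    fun i i' _ F hF F' hF' => integral_add (h.integrable_left hd hF hF') (h'.integrable_left hd hF hF')
  have e2 : ∀ i, ∀ F ∈ M.bdFaces i,
      ∫ x in M.face i F ∩ frontier M.Ω, (b + b') i F x ∂μHE[d - 1] =
      (∫ x in M.face i F ∩ frontier M.Ω, b i F x ∂μHE[d - 1]) +
      ∫ x in M.face i F ∩ frontier M.Ω, b' i F x ∂μHE[d - 1] :=
    fun i F hF => integral_add (h.integrable_right hd hF) (h'.integrable_right hd hF)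
  unfold skeletonIntegral
  rw [Finset.sum_congr rfl fun i _ => Finset.sum_congr rfl fun i' hi' => Finset.sum_congr rfl
    fun F hF => Finset.sum_congr rfl fun F' hF' => e1 i i' hi' F hF F' hF',
    Finset.sum_congr rfl fun i _ => Finset.sum_congr rfl fun F hF => e2 i F hF]
  simp only [Finset.sum_add_distrib]
  ring

theorem skeletonIntegral_smul (a : ℝ) (g : SkelFun M) (b : BdFun M) :
    M.skeletonIntegral (a • g) (a • b) = a * M.skeletonIntegral g b := by
  unfold skeletonIntegral
  simp only [Pi.smul_apply, smul_eq_mul, integral_const_mul, ← Finset.mul_sum]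
  ring

theorem skeletonIntegral_mono (hd : 1 ≤ d) {g g' : SkelFun M} {b b' : BdFun M}
    (h : SkelBdd M g b) (h' : SkelBdd M g' b')
    (hg : ∀ i i', i ≠ i' → ∀ F ∈ M.bdFaces i, ∀ F' ∈ M.bdFaces i',
      ∀ᵐ x ∂(μHE[d - 1] : Measure (E d)).restrict (M.face i F ∩ M.face i' F' ∩ M.Ω),
        g i F i' F' x ≤ g' i F i' F' x)
    (hb : ∀ i, ∀ F ∈ M.bdFaces i, ∀ x, b i F x ≤ b' i F x) :
    M.skeletonIntegral g b ≤ M.skeletonIntegral g' b' := by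
  unfold skeletonIntegral
  refine add_le_add (mul_le_mul_of_nonneg_left ?_ (by norm_num)) ?_
  · refine Finset.sum_le_sum fun i _ => Finset.sum_le_sum fun i' hi' => Finset.sum_le_sum
      fun F hF => Finset.sum_le_sum fun F' hF' => ?_
    exact integral_mono_ae (h.integrable_left hd hF hF') (h'.integrable_left hd hF hF')
      (hg i i' (Finset.ne_of_mem_erase hi').symm F hF F' hF')
  · exact Finset.sum_le_sum fun i _ => Finset.sum_le_sum fun F hF =>
      integral_mono (h.integrable_right hd hF) (h'.integrable_right hd hF) (hb i F hF)

theorem skeletonIntegral_nonneg {g : SkelFun M} {b : BdFun M}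
    (hg : ∀ i i' F F' x, 0 ≤ g i F i' F' x) (hb : ∀ i F x, 0 ≤ b i F x) :
    0 ≤ M.skeletonIntegral g b := by
  unfold skeletonIntegral
  refine add_nonneg (mul_nonneg (by norm_num) ?_) ?_
  · exact Finset.sum_nonneg fun i _ => Finset.sum_nonneg fun i' hi' => Finset.sum_nonneg
      fun F hF => Finset.sum_nonneg fun F' hF' => integral_nonneg fun x => hg i i' F F' x
  · exact Finset.sum_nonneg fun i _ => Finset.sum_nonneg fun F hF =>
      integral_nonneg fun x => hb i F x

/-! ### Skeleton integrals of one-sided quantities -/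

/-- Almost every point of a facet lies only in relative interiors of facets, so at most one boundary
facet of other elements passes through it. -/
theorem sum_indicator_face_le (hd : 1 ≤ d) {i : Fin M.N} {F : Fin (M.n i) × Fin (d + 1)} :
    ∀ᵐ x ∂(μHE[d - 1] : Measure (E d)).restrict (M.face i F),
      ∑ i' ∈ Finset.univ.erase i, ∑ F' ∈ M.bdFaces i',
        (M.face i' F' ∩ M.Ω).indicator (fun _ => (1 : ℝ)) x ≤
      M.Ω.indicator (fun _ => (1 : ℝ)) x := by
  classical
  have h1 : ∀ᵐ x ∂(μHE[d - 1] : Measure (E d)).restrict (M.face i F), x ∈ M.relFace i F := by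
    rw [← Measure.restrict_congr_set (M.relFace_ae_eq_face hd i F)]
    exact ae_restrict_mem (measurableSet_relFacet _ _)
  have h2 : ∀ᵐ x ∂(μHE[d - 1] : Measure (E d)).restrict (M.face i F),
      ∀ i', ∀ F' : Fin (M.n i') × Fin (d + 1), x ∈ M.face i' F' → x ∈ M.relFace i' F' := by
    refine ae_restrict_of_ae (ae_all_iff.2 fun i' => ae_all_iff.2 fun F' => ?_)
    exact (M.relFace_ae_eq_face hd i' F').symm.le
  filter_upwards [h1, h2] with x hx hx'
  by_cases hxΩ : x ∈ M.Ω
  · rw [Set.indicator_of_mem hxΩ]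
    by_cases hex : ∃ i', i' ≠ i ∧ ∃ F' ∈ M.bdFaces i', x ∈ M.face i' F'
    · obtain ⟨i', hi', F', hF', hxF'⟩ := hex
      rw [Finset.sum_eq_single i', Finset.sum_eq_single F']
      · exact Set.indicator_le_self' (fun _ _ => zero_le_one) _
      · intro G hG hne
        refine Set.indicator_of_notMem (fun h => hne ?_) _
        exact bdFaces_eq_of_mem hd hF' (hx' _ _ hxF') (hx' _ _ h.1)
      · exact fun h => absurd hF' h
      · intro i'' hi'' hne
        refine Finset.sum_eq_zero fun G hG => Set.indicator_of_notMem (fun h => hne ?_) _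
        exact bdFaces_neighbour_unique hd (Finset.ne_of_mem_erase hi'') hi' hx (hx' _ _ h.1)
          (hx' _ _ hxF')
      · exact fun h => absurd (Finset.mem_erase.2 ⟨hi', Finset.mem_univ _⟩) h
    · push Not at hex
      rw [Finset.sum_eq_zero]
      · norm_num
      · intro i' hi'
        refine Finset.sum_eq_zero fun G hG => Set.indicator_of_notMem (fun h => ?_) _
        exact hex i' (Finset.ne_of_mem_erase hi') G hG h.1
  · rw [Set.indicator_of_notMem hxΩ, Finset.sum_eq_zero]
    exact fun i' _ => Finset.sum_eq_zero fun G hG => Set.indicator_of_notMem (fun h => hxΩ h.2) _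

theorem measurableSet_face (i : Fin M.N) (F : Fin (M.n i) × Fin (d + 1)) :
    MeasurableSet (M.face i F) := measurableSet_facet _ _

theorem sum_interior_pieces_le (hd : 1 ≤ d) {i : Fin M.N} {F : Fin (M.n i) × Fin (d + 1)}
    {q : E d → ℝ} (hq : ∀ x, 0 ≤ q x) (hqi : IntegrableOn q (M.face i F) μHE[d - 1]) :
    ∑ i' ∈ Finset.univ.erase i, ∑ F' ∈ M.bdFaces i',
      ∫ x in M.face i F ∩ M.face i' F' ∩ M.Ω, q x ∂μHE[d - 1] ≤
    ∫ x in M.face i F ∩ M.Ω, q x ∂μHE[d - 1] := by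
  have hm : ∀ i' F', MeasurableSet (M.face i' F' ∩ M.Ω) := fun i' F' =>
    (measurableSet_face i' F').inter M.isOpen_Ω.measurableSet
  have hq1 : ∀ i' F', IntegrableOn (fun x => (M.face i' F' ∩ M.Ω).indicator (fun _ => (1 : ℝ)) x * q x)
      (M.face i F) μHE[d - 1] := by
    intro i' F'
    have : (fun x => (M.face i' F' ∩ M.Ω).indicator (fun _ => (1 : ℝ)) x * q x) =
        (M.face i' F' ∩ M.Ω).indicator q := by
      ext x
      by_cases hx : x ∈ M.face i' F' ∩ M.Ω <;> simp [hx]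
    rw [this]
    exact hqi.indicator (hm i' F')
  have e : ∀ (S : Set (E d)), MeasurableSet S → ∫ x in M.face i F ∩ S, q x ∂μHE[d - 1] =
      ∫ x in M.face i F, S.indicator (fun _ => (1 : ℝ)) x * q x ∂μHE[d - 1] := by
    intro S hS
    have : (fun x => S.indicator (fun _ => (1 : ℝ)) x * q x) = S.indicator q := by
      ext x
      by_cases hx : x ∈ S <;> simp [hx]
    rw [this, setIntegral_indicator hS]
  simp_rw [Set.inter_assoc]
  simp_rw [e _ (hm _ _)]
  rw [e _ M.isOpen_Ω.measurableSet]
  have : ∀ i', ∑ F' ∈ M.bdFaces i',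
      ∫ x in M.face i F, (M.face i' F' ∩ M.Ω).indicator (fun _ => (1 : ℝ)) x * q x ∂μHE[d - 1] =
      ∫ x in M.face i F, ∑ F' ∈ M.bdFaces i',
        (M.face i' F' ∩ M.Ω).indicator (fun _ => (1 : ℝ)) x * q x ∂μHE[d - 1] := fun i' =>
    (integral_finsetSum _ fun F' _ => hq1 i' F').symm
  simp_rw [this]
  rw [← integral_finsetSum _ fun i' _ => integrable_finsetSum _ fun F' _ => hq1 i' F']
  refine integral_mono_ae (integrable_finsetSum _ fun i' _ => integrable_finsetSum _
    fun F' _ => hq1 i' F') ?_ ?_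
  · have : (fun x => M.Ω.indicator (fun _ => (1 : ℝ)) x * q x) = M.Ω.indicator q := by
      ext x
      by_cases hx : x ∈ M.Ω <;> simp [hx]
    rw [this]
    exact hqi.indicator M.isOpen_Ω.measurableSet
  · filter_upwards [sum_indicator_face_le hd (i := i) (F := F)] with x hx
    simp only [← Finset.sum_mul]
    exact mul_le_mul_of_nonneg_right hx (hq x)

/-- The skeleton integral of a one-sided quantity is bounded by the integrals over the boundaries
of the elements. -/
theorem skeletonIntegral_one_sided_le (hd : 1 ≤ d) {q : BdFun M} (hq : ∀ i F x, 0 ≤ q i F x)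
    (hqb : ∀ i, ∀ F ∈ M.bdFaces i,
      BddMeas ((μHE[d - 1] : Measure (E d)).restrict (M.face i F)) (q i F)) :
    M.skeletonIntegral (fun i F i' F' x => q i F x + q i' F' x) q ≤
      ∑ i, ∑ F ∈ M.bdFaces i, ∫ x in M.face i F, q i F x ∂μHE[d - 1] := by
  have hqi : ∀ i, ∀ F ∈ M.bdFaces i, IntegrableOn (q i F) (M.face i F) μHE[d - 1] :=
    fun i F hF => integrableOn_of_bddMeas_face hd subset_rfl (hqb i F hF)
  set I : (i : Fin M.N) → (i' : Fin M.N) → ℝ := fun i i' => ∑ F ∈ M.bdFaces i,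
    ∑ F' ∈ M.bdFaces i', ∫ x in M.face i F ∩ M.face i' F' ∩ M.Ω, q i F x ∂μHE[d - 1] with hI
  have e1 : ∀ i i', ∑ F ∈ M.bdFaces i, ∑ F' ∈ M.bdFaces i',
      ∫ x in M.face i F ∩ M.face i' F' ∩ M.Ω, (q i F x + q i' F' x) ∂μHE[d - 1] =
      I i i' + I i' i := by
    intro i i'
    rw [hI]
    simp only
    rw [Finset.sum_comm (s := M.bdFaces i'), ← Finset.sum_add_distrib]
    refine Finset.sum_congr rfl fun F hF => ?_
    rw [← Finset.sum_add_distrib]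
    refine Finset.sum_congr rfl fun F' hF' => ?_
    rw [Set.inter_comm (M.face i' F') (M.face i F)]
    exact integral_add ((hqi i F hF).mono_set fun _ hx => hx.1.1)
      ((hqi i' F' hF').mono_set fun _ hx => hx.1.2)
  -- The two sides of an interface contribute equally after relabelling, which cancels the factor
  -- `1/2` of the skeleton integral.
  have e2 : ∑ i, ∑ i' ∈ Finset.univ.erase i, I i' i = ∑ i, ∑ i' ∈ Finset.univ.erase i, I i i' := by
    have h1 : ∀ f : Fin M.N → Fin M.N → ℝ, ∑ i, ∑ i' ∈ Finset.univ.erase i, f i i' =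
        ∑ i, ∑ i', if i' ≠ i then f i i' else 0 := fun f => by
      refine Finset.sum_congr rfl fun i _ => ?_
      rw [← Finset.sum_filter, Finset.filter_ne']
    rw [h1, h1, Finset.sum_comm]
    simp only [ne_comm]
  have e3 : ∑ i, ∑ i' ∈ Finset.univ.erase i, I i i' ≤
      ∑ i, ∑ F ∈ M.bdFaces i, ∫ x in M.face i F ∩ M.Ω, q i F x ∂μHE[d - 1] := by
    refine Finset.sum_le_sum fun i _ => ?_
    rw [hI]
    simp only
    rw [Finset.sum_comm]
    exact Finset.sum_le_sum fun F hF => sum_interior_pieces_le hd (hq i F) (hqi i F hF)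
  unfold skeletonIntegral
  simp_rw [e1, Finset.sum_add_distrib]
  rw [e2]
  have e4 : ∑ i, ∑ F ∈ M.bdFaces i, ∫ x in M.face i F ∩ M.Ω, q i F x ∂μHE[d - 1] +
      ∑ i, ∑ F ∈ M.bdFaces i, ∫ x in M.face i F ∩ frontier M.Ω, q i F x ∂μHE[d - 1] ≤
      ∑ i, ∑ F ∈ M.bdFaces i, ∫ x in M.face i F, q i F x ∂μHE[d - 1] := by
    rw [← Finset.sum_add_distrib]
    refine Finset.sum_le_sum fun i _ => ?_
    rw [← Finset.sum_add_distrib]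
    refine Finset.sum_le_sum fun F hF => ?_
    have hdisj : Disjoint (M.face i F ∩ M.Ω) (M.face i F ∩ frontier M.Ω) := by
      rw [Set.disjoint_left]
      rintro x ⟨-, hx⟩ ⟨-, hx'⟩
      rw [M.isOpen_Ω.frontier_eq] at hx'
      exact hx'.2 hx
    rw [← setIntegral_union hdisj ((measurableSet_face i F).inter isClosed_frontier.measurableSet)
      ((hqi i F hF).mono_set Set.inter_subset_left) ((hqi i F hF).mono_set Set.inter_subset_left)]
    exact setIntegral_mono_set (hqi i F hF) (Eventually.of_forall fun x => hq i F x)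
      (Set.union_subset Set.inter_subset_left Set.inter_subset_left).eventuallyLE
  linarith

end PolytopicMesh


/-! ### The forms as bilinear forms on simplexwise polynomials. -/

namespace Coeff

variable {d k : ℕ} {M : PolytopicMesh d} (c : Coeff M)

/-- The integrand of the volume part. -/
noncomputable def volIntegrand (w v : M.Broken) (i : Fin M.N) (t : Fin (M.n i)) (x : E d) : ℝ :=
  ⟪Matrix.toEuclideanCLM (𝕜 := ℝ) (c.D x) (∇ (w i t) x), ∇ (v i t) x⟫
      + c.μ x * w i t x * v i t x

variable {c} {w w' v v' : M.Broken}

theorem bddMeas_D_gradient (hw : w ∈ M.BP k) (i : Fin M.N) (t : Fin (M.n i)) :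
    BddMeas (volume.restrict (body (M.T i t)))
      (fun x => Matrix.toEuclideanCLM (𝕜 := ℝ) (c.D x) (∇ (w i t) x)) :=
  BddMeas.clm (fun a b => (c.aestronglyMeasurable_D i a b).mono_measure (M.restrict_body_le i t))
    (ae_mono (M.restrict_body_le i t) (c.ae_norm_D_le i))
    (BddMeas.of_continuous (isCompact_body _) (continuous_gradient_of_mem (hw i t)))

theorem bddMeas_μ (i : Fin M.N) (t : Fin (M.n i)) :
    BddMeas (volume.restrict (body (M.T i t))) c.μ := by
  obtain ⟨B, hB⟩ := c.exists_bound_μ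
  exact ⟨(c.μ_memLp.1.mono_ac (M.restrict_K_absolutelyContinuous i)).mono_measure
    (M.restrict_body_le i t), B, ae_mono (M.restrict_body_le i t) (hB i)⟩

theorem bddMeas_volIntegrand (hw : w ∈ M.BP k) (hv : v ∈ M.BP k) (i : Fin M.N)
    (t : Fin (M.n i)) :
    BddMeas (volume.restrict (body (M.T i t))) (c.volIntegrand w v i t) :=
  ((bddMeas_D_gradient hw i t).inner (BddMeas.of_continuous (isCompact_body _)
    (continuous_gradient_of_mem (hv i t)))).add
  (((bddMeas_μ i t).mul (BddMeas.of_continuous (isCompact_body _)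
    (continuous_of_mem_polys (hw i t)))).mul (BddMeas.of_continuous (isCompact_body _)
    (continuous_of_mem_polys (hv i t))))

theorem integrableOn_volIntegrand (hw : w ∈ M.BP k) (hv : v ∈ M.BP k) (i : Fin M.N)
    (t : Fin (M.n i)) : IntegrableOn (c.volIntegrand w v i t) (body (M.T i t)) :=
  (bddMeas_volIntegrand hw hv i t).integrable
    (by rw [Measure.restrict_apply_univ]; exact volume_body_ne_top _)

theorem volumeForm_add_left (hw : w ∈ M.BP k) (hw' : w' ∈ M.BP k) (hv : v ∈ M.BP k) :
    c.volumeForm (w + w') v = c.volumeForm w v + c.volumeForm w' v := by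
  unfold volumeForm
  rw [← Finset.sum_add_distrib]
  refine Finset.sum_congr rfl fun i _ => ?_
  rw [← Finset.sum_add_distrib]
  refine Finset.sum_congr rfl fun t _ => ?_
  refine Eq.trans (integral_congr_ae (Eventually.of_forall fun x => ?_))
    (integral_add (integrableOn_volIntegrand hw hv i t) (integrableOn_volIntegrand hw' hv i t))
  simp only [Pi.add_apply]
  rw [gradient_add_of_mem (hw i t) (hw' i t), map_add, inner_add_left]
  ring

theorem volumeForm_smul_left (a : ℝ) (hw : w ∈ M.BP k) :
    c.volumeForm (a • w) v = a * c.volumeForm w v := by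
  unfold volumeForm
  simp only [Finset.mul_sum]
  refine Finset.sum_congr rfl fun i _ => Finset.sum_congr rfl fun t _ => ?_
  rw [← integral_const_mul]
  refine integral_congr_ae (Eventually.of_forall fun x => ?_)
  simp only [Pi.smul_apply, smul_eq_mul]
  rw [gradient_smul_of_mem a (hw i t), map_smul, inner_smul_left]
  simp only [conj_trivial]
  ring

theorem volumeForm_comm (w v : M.Broken) : c.volumeForm w v = c.volumeForm v w := by
  unfold volumeForm
  obtain ⟨D₀, -, h⟩ := c.ae_coercive
  refine Finset.sum_congr rfl fun i _ => Finset.sum_congr rfl fun t _ => integral_congr_ae ?_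
  filter_upwards [ae_mono (M.restrict_body_le i t) (h i)] with x hx
  rw [inner_toEuclideanCLM_comm hx.1, real_inner_comm]
  ring

theorem jump_add (w w' : M.Broken) (i : Fin M.N) (F) (i' : Fin M.N) (F') (x : E d) :
    M.jump (w + w') i F i' F' x = M.jump w i F i' F' x + M.jump w' i F i' F' x := by
  simp only [PolytopicMesh.jump, Pi.add_apply, add_smul]
  abel

theorem jump_smul (a : ℝ) (w : M.Broken) (i : Fin M.N) (F) (i' : Fin M.N) (F') (x : E d) :
    M.jump (a • w) i F i' F' x = a • M.jump w i F i' F' x := by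
  simp only [PolytopicMesh.jump, Pi.smul_apply, smul_eq_mul, mul_smul, smul_add]

theorem jumpBd_add (w w' : M.Broken) (i : Fin M.N) (F) (x : E d) :
    M.jumpBd (w + w') i F x = M.jumpBd w i F x + M.jumpBd w' i F x := by
  simp only [PolytopicMesh.jumpBd, Pi.add_apply, add_smul]

theorem jumpBd_smul (a : ℝ) (w : M.Broken) (i : Fin M.N) (F) (x : E d) :
    M.jumpBd (a • w) i F x = a • M.jumpBd w i F x := by
  simp only [PolytopicMesh.jumpBd, Pi.smul_apply, smul_eq_mul, mul_smul]

theorem flux_add (hw : w ∈ M.BP k) (hw' : w' ∈ M.BP k) (i : Fin M.N) (t) (x : E d) :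
    c.flux (w + w') i t x = c.flux w i t x + c.flux w' i t x := by
  simp only [flux, Pi.add_apply]
  rw [gradient_add_of_mem (hw i t) (hw' i t), map_add]

theorem flux_smul (a : ℝ) (hw : w ∈ M.BP k) (i : Fin M.N) (t) (x : E d) :
    c.flux (a • w) i t x = a • c.flux w i t x := by
  simp only [flux, Pi.smul_apply]
  rw [gradient_smul_of_mem a (hw i t), map_smul]

theorem avgFlux_add (hw : w ∈ M.BP k) (hw' : w' ∈ M.BP k) (i : Fin M.N) (F) (i' : Fin M.N) (F')
    (x : E d) :
    c.avgFlux (w + w') i F i' F' x = c.avgFlux w i F i' F' x + c.avgFlux w' i F i' F' x := by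
  simp only [avgFlux, flux_add hw hw', smul_add]
  abel

theorem avgFlux_smul (a : ℝ) (hw : w ∈ M.BP k) (i : Fin M.N) (F) (i' : Fin M.N) (F')
    (x : E d) : c.avgFlux (a • w) i F i' F' x = a • c.avgFlux w i F i' F' x := by
  simp only [avgFlux, flux_smul a hw, smul_add, smul_comm a]

theorem bddMeas_face (hw : w ∈ M.BP k) (i : Fin M.N) (F : Fin (M.n i) × Fin (d + 1)) :
    BddMeas ((μHE[d - 1] : Measure (E d)).restrict (M.face i F)) (w i F.1) :=
  BddMeas.of_continuous (isCompact_facet _ _) (continuous_of_mem_polys (hw i F.1))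

theorem bddMeas_flux (hw : w ∈ M.BP k) {i : Fin M.N} {F : Fin (M.n i) × Fin (d + 1)}
    (hF : F ∈ M.bdFaces i) :
    BddMeas ((μHE[d - 1] : Measure (E d)).restrict (M.face i F)) (c.flux w i F.1) :=
  BddMeas.clm (fun a b => (c.Dtr_measurable i a b).aestronglyMeasurable)
    (ae_mono (Measure.restrict_mono_set _ (M.mem_bdFaces.1 hF)) (c.ae_norm_Dtr_le i))
    (BddMeas.of_continuous (isCompact_facet _ _) (continuous_gradient_of_mem (hw i F.1)))

section pieces

variable {F₀ : Type*} [NormedAddCommGroup F₀]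

theorem bddMeas_piece_left {i i' : Fin M.N} {F : Fin (M.n i) × Fin (d + 1)}
    {F' : Fin (M.n i') × Fin (d + 1)} {g : E d → F₀}
    (hg : BddMeas ((μHE[d - 1] : Measure (E d)).restrict (M.face i F)) g) :
    BddMeas ((μHE[d - 1] : Measure (E d)).restrict (M.face i F ∩ M.face i' F' ∩ M.Ω)) g :=
  hg.mono (Measure.restrict_mono_set _ fun _ hx => hx.1.1)

theorem bddMeas_piece_right {i i' : Fin M.N} {F : Fin (M.n i) × Fin (d + 1)}
    {F' : Fin (M.n i') × Fin (d + 1)} {g : E d → F₀}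
    (hg : BddMeas ((μHE[d - 1] : Measure (E d)).restrict (M.face i' F')) g) :
    BddMeas ((μHE[d - 1] : Measure (E d)).restrict (M.face i F ∩ M.face i' F' ∩ M.Ω)) g :=
  hg.mono (Measure.restrict_mono_set _ fun _ hx => hx.1.2)

theorem bddMeas_piece_bd {i : Fin M.N} {F : Fin (M.n i) × Fin (d + 1)} {g : E d → F₀}
    (hg : BddMeas ((μHE[d - 1] : Measure (E d)).restrict (M.face i F)) g) :
    BddMeas ((μHE[d - 1] : Measure (E d)).restrict (M.face i F ∩ frontier M.Ω)) g :=
  hg.mono (Measure.restrict_mono_set _ Set.inter_subset_left)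

end pieces

theorem bddMeas_jump (hw : w ∈ M.BP k) (i i' : Fin M.N) (F : Fin (M.n i) × Fin (d + 1))
    (F' : Fin (M.n i') × Fin (d + 1)) :
    BddMeas ((μHE[d - 1] : Measure (E d)).restrict (M.face i F ∩ M.face i' F' ∩ M.Ω))
      (M.jump w i F i' F') :=
  ((bddMeas_piece_left (bddMeas_face hw i F)).smul (BddMeas.const _)).add
    ((bddMeas_piece_right (bddMeas_face hw i' F')).smul (BddMeas.const _))

theorem bddMeas_jumpBd (hw : w ∈ M.BP k) (i : Fin M.N) (F : Fin (M.n i) × Fin (d + 1)) :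
    BddMeas ((μHE[d - 1] : Measure (E d)).restrict (M.face i F ∩ frontier M.Ω))
      (M.jumpBd w i F) :=
  (bddMeas_piece_bd (bddMeas_face hw i F)).smul (BddMeas.const _)

theorem bddMeas_avgFlux (hw : w ∈ M.BP k) {i i' : Fin M.N} {F : Fin (M.n i) × Fin (d + 1)}
    (hF : F ∈ M.bdFaces i) {F' : Fin (M.n i') × Fin (d + 1)} (hF' : F' ∈ M.bdFaces i') :
    BddMeas ((μHE[d - 1] : Measure (E d)).restrict (M.face i F ∩ M.face i' F' ∩ M.Ω))
      (c.avgFlux w i F i' F') :=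
  (BddMeas.const _).smul ((bddMeas_piece_left (bddMeas_flux hw hF)).add
    (bddMeas_piece_right (bddMeas_flux hw hF')))

variable (c) in
/-- The interior integrand of the penalty part. -/
noncomputable def penFun (k : ℕ) (Cstar : ℝ) (w v : M.Broken) : PolytopicMesh.SkelFun M :=
  fun i F i' F' x => c.σ k Cstar i i' * ⟪M.jump w i F i' F' x, M.jump v i F i' F' x⟫

variable (c) in
/-- The boundary integrand of the penalty part. -/
noncomputable def penBd (k : ℕ) (Cstar : ℝ) (w v : M.Broken) : PolytopicMesh.BdFun M :=
  fun i F x => c.σBd k Cstar i * ⟪M.jumpBd w i F x, M.jumpBd v i F x⟫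

variable (c) in
/-- The interior integrand of the consistency part. -/
noncomputable def consFun (w v : M.Broken) : PolytopicMesh.SkelFun M :=
  fun i F i' F' x => ⟪c.avgFlux w i F i' F' x, M.jump v i F i' F' x⟫

variable (c) in
/-- The boundary integrand of the consistency part. -/
noncomputable def consBd (w v : M.Broken) : PolytopicMesh.BdFun M :=
  fun i F x => ⟪c.flux w i F.1 x, M.jumpBd v i F x⟫

theorem penaltyForm_eq (Cstar : ℝ) (w v : M.Broken) : c.penaltyForm k Cstar w v =
    M.skeletonIntegral (c.penFun k Cstar w v) (c.penBd k Cstar w v) := rfl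

theorem consistencyForm_eq (w v : M.Broken) : c.consistencyForm w v =
    M.skeletonIntegral (c.consFun w v) (c.consBd w v) := rfl

theorem skelBdd_pen {k' : ℕ} (Cstar : ℝ) (hw : w ∈ M.BP k) (hv : v ∈ M.BP k) :
    PolytopicMesh.SkelBdd M (c.penFun k' Cstar w v) (c.penBd k' Cstar w v) :=
  ⟨fun i i' F _ F' _ => (BddMeas.const _).mul ((bddMeas_jump hw i i' F F').inner
    (bddMeas_jump hv i i' F F')),
   fun i F _ => (BddMeas.const _).mul ((bddMeas_jumpBd hw i F).inner (bddMeas_jumpBd hv i F))⟩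

theorem skelBdd_cons (hw : w ∈ M.BP k) (hv : v ∈ M.BP k) :
    PolytopicMesh.SkelBdd M (c.consFun w v) (c.consBd w v) :=
  ⟨fun i i' F hF F' hF' => (bddMeas_avgFlux hw hF hF').inner (bddMeas_jump hv i i' F F'),
   fun i F hF => (bddMeas_piece_bd (bddMeas_flux hw hF)).inner (bddMeas_jumpBd hv i F)⟩

variable {Cstar : ℝ} {k' : ℕ}

theorem penaltyForm_comm (w v : M.Broken) :
    c.penaltyForm k Cstar w v = c.penaltyForm k Cstar v w := by
  simp only [penaltyForm, real_inner_comm]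

theorem penaltyForm_add_left (hd : 1 ≤ d) (hw : w ∈ M.BP k) (hw' : w' ∈ M.BP k)
    (hv : v ∈ M.BP k) : c.penaltyForm k' Cstar (w + w') v =
      c.penaltyForm k' Cstar w v + c.penaltyForm k' Cstar w' v := by
  simp only [penaltyForm_eq]
  rw [← PolytopicMesh.skeletonIntegral_add hd (skelBdd_pen Cstar hw hv) (skelBdd_pen Cstar hw' hv)]
  congr 1
  · ext i F i' F' x
    simp only [penFun, jump_add, inner_add_left, Pi.add_apply]
    ring
  · ext i F x
    simp only [penBd, jumpBd_add, inner_add_left, Pi.add_apply]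
    ring

theorem penaltyForm_smul_left (a : ℝ) (w v : M.Broken) :
    c.penaltyForm k' Cstar (a • w) v = a * c.penaltyForm k' Cstar w v := by
  simp only [penaltyForm_eq]
  rw [← PolytopicMesh.skeletonIntegral_smul]
  congr 1
  · ext i F i' F' x
    simp only [penFun, jump_smul, inner_smul_left, Pi.smul_apply, smul_eq_mul, conj_trivial]
    ring
  · ext i F x
    simp only [penBd, jumpBd_smul, inner_smul_left, Pi.smul_apply, smul_eq_mul, conj_trivial]
    ring

theorem consistencyForm_add_left (hd : 1 ≤ d) (hw : w ∈ M.BP k) (hw' : w' ∈ M.BP k)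
    (hv : v ∈ M.BP k) :
    c.consistencyForm (w + w') v = c.consistencyForm w v + c.consistencyForm w' v := by
  simp only [consistencyForm_eq]
  rw [← PolytopicMesh.skeletonIntegral_add hd (skelBdd_cons hw hv) (skelBdd_cons hw' hv)]
  congr 1
  · ext i F i' F' x
    simp only [consFun, avgFlux_add hw hw', inner_add_left, Pi.add_apply]
  · ext i F x
    simp only [consBd, flux_add hw hw', inner_add_left, Pi.add_apply]

theorem consistencyForm_smul_left (a : ℝ) (hw : w ∈ M.BP k) :
    c.consistencyForm (a • w) v = a * c.consistencyForm w v := by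
  simp only [consistencyForm_eq]
  rw [← PolytopicMesh.skeletonIntegral_smul]
  congr 1
  · ext i F i' F' x
    simp only [consFun, avgFlux_smul a hw, inner_smul_left, Pi.smul_apply, smul_eq_mul,
      conj_trivial]
  · ext i F x
    simp only [consBd, flux_smul a hw, inner_smul_left, Pi.smul_apply, smul_eq_mul, conj_trivial]

theorem consistencyForm_add_right (hd : 1 ≤ d) (hw : w ∈ M.BP k) (hv : v ∈ M.BP k)
    (hv' : v' ∈ M.BP k) :
    c.consistencyForm w (v + v') = c.consistencyForm w v + c.consistencyForm w v' := by
  simp only [consistencyForm_eq]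
  rw [← PolytopicMesh.skeletonIntegral_add hd (skelBdd_cons hw hv) (skelBdd_cons hw hv')]
  congr 1
  · ext i F i' F' x
    simp only [consFun, jump_add, inner_add_right, Pi.add_apply]
  · ext i F x
    simp only [consBd, jumpBd_add, inner_add_right, Pi.add_apply]

theorem consistencyForm_smul_right (a : ℝ) (w v : M.Broken) :
    c.consistencyForm w (a • v) = a * c.consistencyForm w v := by
  simp only [consistencyForm_eq]
  rw [← PolytopicMesh.skeletonIntegral_smul]
  congr 1
  · ext i F i' F' x
    simp only [consFun, jump_smul, inner_smul_right, Pi.smul_apply, smul_eq_mul]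
  · ext i F x
    simp only [consBd, jumpBd_smul, inner_smul_right, Pi.smul_apply, smul_eq_mul]

variable (c)

/-- The bilinear form of the DG-norm, on piecewise polynomials. -/
noncomputable def dgForm (hd : 1 ≤ d) (k : ℕ) (Cstar : ℝ) : LinearMap.BilinForm ℝ (M.BP k) :=
  LinearMap.mk₂ ℝ (fun w v => c.volumeForm w.1 v.1 + c.penaltyForm k Cstar w.1 v.1)
    (fun w w' v => by
      simp only [Submodule.coe_add]
      rw [volumeForm_add_left w.2 w'.2 v.2, penaltyForm_add_left hd w.2 w'.2 v.2]
      ring)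
    (fun a w v => by
      simp only [Submodule.coe_smul, smul_eq_mul]
      rw [volumeForm_smul_left a w.2, penaltyForm_smul_left]
      ring)
    (fun w v v' => by
      simp only [Submodule.coe_add]
      rw [volumeForm_comm, penaltyForm_comm, volumeForm_add_left v.2 v'.2 w.2,
        penaltyForm_add_left hd v.2 v'.2 w.2, volumeForm_comm v.1, volumeForm_comm v'.1,
        penaltyForm_comm v.1, penaltyForm_comm v'.1]
      ring)
    (fun a w v => by
      simp only [Submodule.coe_smul, smul_eq_mul]
      rw [volumeForm_comm, penaltyForm_comm, volumeForm_smul_left a v.2, penaltyForm_smul_left,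
        volumeForm_comm v.1, penaltyForm_comm v.1]
      ring)

/-- The bilinear form of the consistency part, on piecewise polynomials. -/
noncomputable def consForm (hd : 1 ≤ d) (k : ℕ) : LinearMap.BilinForm ℝ (M.BP k) :=
  LinearMap.mk₂ ℝ (fun w v => c.consistencyForm w.1 v.1)
    (fun w w' v => consistencyForm_add_left hd w.2 w'.2 v.2)
    (fun a w _ => consistencyForm_smul_left a w.2)
    (fun w v v' => consistencyForm_add_right hd w.2 v.2 v'.2)
    (fun a w v => consistencyForm_smul_right a w.1 v.1)

/-- The stabilising bilinear form, on piecewise polynomials. -/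
noncomputable def stabForm (k : ℕ) (α : Fin M.N → ℝ) : LinearMap.BilinForm ℝ (M.BP k) :=
  LinearMap.mk₂ ℝ (fun w v => c.stab k α w.1 v.1)
    (fun w w' v => by
      simp only [stab, Submodule.coe_add, Pi.add_apply, ← Finset.sum_add_distrib,
        Finset.mul_sum]
      refine Finset.sum_congr rfl fun i _ => Finset.sum_congr rfl fun t _ =>
        Finset.sum_congr rfl fun a _ => ?_
      ring)
    (fun b w v => by
      simp only [stab, Submodule.coe_smul, Pi.smul_apply, smul_eq_mul, Finset.mul_sum]
      refine Finset.sum_congr rfl fun i _ => Finset.sum_congr rfl fun t _ =>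
        Finset.sum_congr rfl fun a _ => ?_
      ring)
    (fun w v v' => by
      simp only [stab, Submodule.coe_add, Pi.add_apply, ← Finset.sum_add_distrib,
        Finset.mul_sum]
      refine Finset.sum_congr rfl fun i _ => Finset.sum_congr rfl fun t _ =>
        Finset.sum_congr rfl fun a _ => ?_
      ring)
    (fun b w v => by
      simp only [stab, Submodule.coe_smul, Pi.smul_apply, smul_eq_mul, Finset.mul_sum]
      refine Finset.sum_congr rfl fun i _ => Finset.sum_congr rfl fun t _ =>
        Finset.sum_congr rfl fun a _ => ?_
      ring)

theorem dgForm_apply (hd : 1 ≤ d) (w v : M.BP k) :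
    c.dgForm hd k Cstar w v = c.volumeForm w.1 v.1 + c.penaltyForm k Cstar w.1 v.1 := rfl

theorem consForm_apply (hd : 1 ≤ d) (w v : M.BP k) :
    c.consForm hd k w v = c.consistencyForm w.1 v.1 := rfl

theorem dgForm_comm (hd : 1 ≤ d) (w v : M.BP k) :
    c.dgForm hd k Cstar w v = c.dgForm hd k Cstar v w := by
  rw [dgForm_apply, dgForm_apply, volumeForm_comm, penaltyForm_comm]

theorem ae_volIntegrand_nonneg (w : M.Broken) (i : Fin M.N) (t : Fin (M.n i)) :
    ∀ᵐ x ∂volume.restrict (body (M.T i t)), 0 ≤ c.volIntegrand w w i t x := by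
  obtain ⟨D₀, h0, h⟩ := c.ae_coercive
  filter_upwards [ae_mono (M.restrict_body_le i t) (h i),
    ae_mono (M.restrict_body_le i t) (c.ae_μ_nonneg i)] with x hx hμ
  rw [volIntegrand, real_inner_comm, mul_assoc]
  refine add_nonneg ((by positivity : 0 ≤ D₀ * ‖∇ (w i t) x‖ ^ 2).trans (hx.2 _)) ?_
  exact mul_nonneg hμ (mul_self_nonneg _)

/-- The volume part on one simplex. -/
noncomputable def volTerm (w : M.Broken) (i : Fin M.N) (t : Fin (M.n i)) : ℝ :=
  ∫ x in body (M.T i t), c.volIntegrand w w i t x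

theorem volTerm_nonneg (w : M.Broken) (i : Fin M.N) (t : Fin (M.n i)) : 0 ≤ c.volTerm w i t :=
  integral_nonneg_of_ae (c.ae_volIntegrand_nonneg w i t)

theorem volumeForm_self (w : M.Broken) : c.volumeForm w w = ∑ i, ∑ t, c.volTerm w i t := rfl

theorem volumeForm_self_nonneg (w : M.Broken) : 0 ≤ c.volumeForm w w :=
  Finset.sum_nonneg fun i _ => Finset.sum_nonneg fun t _ => c.volTerm_nonneg w i t

theorem penFactor_nonneg (hk : 1 ≤ k) (hC : 0 < Cstar) : 0 ≤ penFactor d k Cstar := by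
  unfold penFactor
  have : (1 : ℝ) ≤ k := by exact_mod_cast hk
  have : (0 : ℝ) ≤ (k : ℝ) - 1 + d := by
    have : (0 : ℝ) ≤ d := by positivity
    linarith
  positivity

theorem penFactor_pos (hd : 1 ≤ d) (hk : 1 ≤ k) (hC : 0 < Cstar) : 0 < penFactor d k Cstar := by
  unfold penFactor
  have h1 : (1 : ℝ) ≤ k := by exact_mod_cast hk
  have h2 : (1 : ℝ) ≤ d := by exact_mod_cast hd
  have : (0 : ℝ) < (k : ℝ) - 1 + d := by linarith
  positivity

theorem δ_div_nonneg (i : Fin M.N) : 0 ≤ c.δ i * (M.H i)⁻¹ :=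
  mul_nonneg (mul_nonneg (sq_nonneg _) supNorm_nonneg) (inv_nonneg.2 Metric.diam_nonneg)

theorem penaltyForm_self_nonneg (hk : 1 ≤ k) (hC : 0 < Cstar) (w : M.Broken) :
    0 ≤ c.penaltyForm k Cstar w w := by
  refine PolytopicMesh.skeletonIntegral_nonneg (fun i i' F F' x => ?_) fun i F x => ?_
  · exact mul_nonneg (mul_nonneg (penFactor_nonneg hk hC)
      ((c.δ_div_nonneg i).trans (le_max_left _ _))) real_inner_self_nonneg
  · exact mul_nonneg (mul_nonneg (penFactor_nonneg hk hC) (c.δ_div_nonneg i))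
      real_inner_self_nonneg

theorem dgForm_self_nonneg (hd : 1 ≤ d) (hk : 1 ≤ k) (hC : 0 < Cstar) (w : M.BP k) :
    0 ≤ c.dgForm hd k Cstar w w :=
  add_nonneg (c.volumeForm_self_nonneg _) (c.penaltyForm_self_nonneg hk hC _)

theorem dgNorm_sq (hk : 1 ≤ k) (hC : 0 < Cstar) (w : M.Broken) :
    c.dgNorm k Cstar w ^ 2 = c.volumeForm w w + c.penaltyForm k Cstar w w :=
  Real.sq_sqrt (add_nonneg (c.volumeForm_self_nonneg _) (c.penaltyForm_self_nonneg hk hC _))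

theorem weight_nonneg (i : Fin M.N) (t : Fin (M.n i)) : 0 ≤ c.weight i t := by
  unfold weight
  have h : 0 ≤ M.h i t := Metric.diam_nonneg
  exact add_nonneg (mul_nonneg supNorm_nonneg (pow_nonneg h _))
    (mul_nonneg supNorm_nonneg (pow_nonneg h _))

end Coeff


/-! ### Trace inequalities for gradients and bounds for the boundary fluxes. -/

namespace PolytopicMesh

variable {d k : ℕ} {M : PolytopicMesh d}

theorem integrableOn_face_of_continuous (hd : 1 ≤ d) (i : Fin M.N) (F : Fin (M.n i) × Fin (d + 1))
    {g : E d → ℝ} (hg : Continuous g) : IntegrableOn g (M.face i F) μHE[d - 1] :=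
  integrableOn_of_bddMeas_face hd subset_rfl (BddMeas.of_continuous (isCompact_facet _ _) hg)

theorem integrableOn_body_of_continuous (i : Fin M.N) (t : Fin (M.n i)) {g : E d → ℝ}
    (hg : Continuous g) : IntegrableOn g (body (M.T i t)) :=
  hg.continuousOn.integrableOn_compact (isCompact_body _)

theorem ofReal_integral_face (hd : 1 ≤ d) (i : Fin M.N) (F : Fin (M.n i) × Fin (d + 1))
    {p : E d → ℝ} (hp : p ∈ polys d k) :
    ENNReal.ofReal (∫ x in M.face i F, p x ^ 2 ∂μHE[d - 1]) =
      ∫⁻ x in M.face i F, ENNReal.ofReal (p x ^ 2) ∂μHE[d - 1] :=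
  ofReal_integral_eq_lintegral_ofReal
    (integrableOn_face_of_continuous hd i F ((continuous_of_mem_polys hp).pow 2))
    (Eventually.of_forall fun _ => sq_nonneg _)

theorem ofReal_integral_body (i : Fin M.N) (t : Fin (M.n i)) {p : E d → ℝ} (hp : p ∈ polys d k) :
    ENNReal.ofReal (∫ x in body (M.T i t), p x ^ 2) =
      ∫⁻ x in body (M.T i t), ENNReal.ofReal (p x ^ 2) :=
  ofReal_integral_eq_lintegral_ofReal
    (integrableOn_body_of_continuous i t ((continuous_of_mem_polys hp).pow 2))
    (Eventually.of_forall fun _ => sq_nonneg _)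

theorem sum_integral_sq_face_le (hd : 1 ≤ d) {i : Fin M.N} {z : E d} {ρ : ℝ} (hρ : 0 < ρ)
    (hstar : ∀ y ∈ Metric.closedBall z ρ, StarConvex ℝ y (M.K i)) {p : E d → ℝ}
    (hp : p ∈ polys d k) :
    ∑ F ∈ M.bdFaces i, ∫ x in M.face i F, p x ^ 2 ∂μHE[d - 1] ≤
      (((k : ℝ) + 1) * (k + d) * ρ⁻¹) * ∑ t, ∫ y in body (M.T i t), p y ^ 2 := by
  have hnn : ∀ t, 0 ≤ ∫ y in body (M.T i t), p y ^ 2 := fun t => integral_nonneg fun _ => sq_nonneg _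
  rw [← ENNReal.ofReal_le_ofReal_iff
    (mul_nonneg (by positivity) (Finset.sum_nonneg fun t _ => hnn t)),
    ENNReal.ofReal_sum_of_nonneg fun F _ => integral_nonneg fun _ => sq_nonneg _,
    ENNReal.ofReal_mul (by positivity), ENNReal.ofReal_sum_of_nonneg fun t _ => hnn t]
  simp_rw [ofReal_integral_face hd _ _ hp, ofReal_integral_body _ _ hp]
  refine (sum_lintegral_sq_face_le hd hρ hstar hp).trans (mul_le_mul_right ?_ _)
  have := lintegral_iUnion_le (μ := volume) (fun t => body (M.T i t))
    (fun y => ENNReal.ofReal (p y ^ 2))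
  rwa [tsum_fintype] at this

theorem integral_sq_face_le (hd : 1 ≤ d) (i : Fin M.N) (F : Fin (M.n i) × Fin (d + 1))
    {p : E d → ℝ} (hp : p ∈ polys d k) :
    ∫ x in M.face i F, p x ^ 2 ∂μHE[d - 1] ≤
      (((k : ℝ) + 1) * (k + d) * ‖grad (M.T i F.1) F.2‖) * ∫ y in body (M.T i F.1), p y ^ 2 := by
  have hnn : 0 ≤ ∫ y in body (M.T i F.1), p y ^ 2 := integral_nonneg fun _ => sq_nonneg _
  rw [← ENNReal.ofReal_le_ofReal_iff (by positivity), ENNReal.ofReal_mul (by positivity),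
    ofReal_integral_face hd _ _ hp, ofReal_integral_body _ _ hp]
  exact lintegral_sq_facet_le _ hd _ hp

theorem norm_gradient_sq (p : E d → ℝ) (x : E d) : ‖∇ p x‖ ^ 2 = ∑ j, (∇ p x) j ^ 2 :=
  EuclideanSpace.real_norm_sq_eq _

/-- The trace inequality is applied to each partial derivative, of degree `k - 1`; this turns `(k +
1)(k + d)` into the factor `k (k - 1 + d)` of the penalty. -/
theorem sum_integral_gradient_face_le (hd : 1 ≤ d) (hk : 1 ≤ k) {i : Fin M.N} {z : E d} {ρ : ℝ}
    (hρ : 0 < ρ) (hstar : ∀ y ∈ Metric.closedBall z ρ, StarConvex ℝ y (M.K i)) {p : E d → ℝ}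
    (hp : p ∈ polys d k) :
    ∑ F ∈ M.bdFaces i, ∫ x in M.face i F, ‖∇ p x‖ ^ 2 ∂μHE[d - 1] ≤
      ((k : ℝ) * (k - 1 + d) * ρ⁻¹) * ∑ t, ∫ y in body (M.T i t), ‖∇ p y‖ ^ 2 := by
  have hj : ∀ j, Continuous fun x => (∇ p x) j ^ 2 := fun j =>
    (continuous_of_mem_polys (gradient_apply_mem_polys hp j)).pow 2
  simp_rw [norm_gradient_sq]
  have e1 : ∀ F, ∫ x in M.face i F, ∑ j, (∇ p x) j ^ 2 ∂μHE[d - 1] =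
      ∑ j, ∫ x in M.face i F, (∇ p x) j ^ 2 ∂μHE[d - 1] := fun F =>
    integral_finsetSum _ fun j _ => integrableOn_face_of_continuous hd i F (hj j)
  have e2 : ∀ t, ∫ x in body (M.T i t), ∑ j, (∇ p x) j ^ 2 =
      ∑ j, ∫ x in body (M.T i t), (∇ p x) j ^ 2 := fun t =>
    integral_finsetSum _ fun j _ => integrableOn_body_of_continuous i t (hj j)
  simp_rw [e1, e2]
  rw [Finset.sum_comm, Finset.sum_comm (s := Finset.univ (α := Fin (M.n i))), Finset.mul_sum]
  refine Finset.sum_le_sum fun j _ => ?_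
  refine (sum_integral_sq_face_le hd hρ hstar (gradient_apply_mem_polys hp j)).trans (le_of_eq ?_)
  rw [Nat.cast_sub hk]
  push_cast
  ring

theorem integral_gradient_face_le (hd : 1 ≤ d) (hk : 1 ≤ k) (i : Fin M.N)
    (F : Fin (M.n i) × Fin (d + 1)) {p : E d → ℝ} (hp : p ∈ polys d k) :
    ∫ x in M.face i F, ‖∇ p x‖ ^ 2 ∂μHE[d - 1] ≤
      ((k : ℝ) * (k - 1 + d) * ‖grad (M.T i F.1) F.2‖) *
        ∫ y in body (M.T i F.1), ‖∇ p y‖ ^ 2 := by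
  have hj : ∀ j, Continuous fun x => (∇ p x) j ^ 2 := fun j =>
    (continuous_of_mem_polys (gradient_apply_mem_polys hp j)).pow 2
  simp_rw [norm_gradient_sq]
  rw [integral_finsetSum _ fun j _ => integrableOn_face_of_continuous hd i F (hj j),
    integral_finsetSum _ fun j _ => integrableOn_body_of_continuous i F.1 (hj j), Finset.mul_sum]
  refine Finset.sum_le_sum fun j _ => ?_
  refine (integral_sq_face_le hd i F (gradient_apply_mem_polys hp j)).trans (le_of_eq ?_)
  rw [Nat.cast_sub hk]
  push_cast
  ring

theorem facet_ratio (hd : 1 ≤ d) (i : Fin M.N) (F : Fin (M.n i) × Fin (d + 1)) :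
    (μHE[d - 1] (M.face i F)).toReal / (volume (body (M.T i F.1))).toReal =
      d * ‖grad (M.T i F.1) F.2‖ := by
  have hT : (volume (body (M.T i F.1))).toReal ≠ 0 :=
    (ENNReal.toReal_pos (volume_body_pos _).ne' (volume_body_ne_top _)).ne'
  rw [face, hausdorff_facet _ hd, ENNReal.toReal_mul, ENNReal.toReal_mul, toReal_enorm,
    ENNReal.toReal_natCast]
  field_simp

end PolytopicMesh

namespace Coeff

variable {d k : ℕ} {M : PolytopicMesh d} (c : Coeff M) {w v : M.Broken} {Cstar : ℝ}

/-- The weighted `L²`-norm of the fluxes on the boundaries of the elements. -/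
noncomputable def fluxNorm (k : ℕ) (Cstar : ℝ) (w : M.Broken) : ℝ :=
  ∑ i, ∑ F ∈ M.bdFaces i, ∫ x in M.face i F, (c.σBd k Cstar i)⁻¹ * ‖c.flux w i F.1 x‖ ^ 2
    ∂μHE[d - 1]

theorem two_inner_le {V : Type*} [NormedAddCommGroup V] [InnerProductSpace ℝ V] {s : ℝ} (hs : 0 < s)
    (a b : V) : 2 * ⟪a, b⟫ ≤ s * ‖a‖ ^ 2 + s⁻¹ * ‖b‖ ^ 2 := by
  have h := norm_sub_sq_real (s • a) b
  rw [norm_smul, inner_smul_left, Real.norm_of_nonneg hs.le] at h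
  have h2 := sq_nonneg ‖s • a - b‖
  rw [h] at h2
  simp only [conj_trivial] at h2
  have h3 : 0 ≤ s⁻¹ * ((s * ‖a‖) ^ 2 - 2 * (s * ⟪a, b⟫) + ‖b‖ ^ 2) := by positivity
  have h4 : s⁻¹ * ((s * ‖a‖) ^ 2 - 2 * (s * ⟪a, b⟫) + ‖b‖ ^ 2) =
      s * ‖a‖ ^ 2 - 2 * ⟪a, b⟫ + s⁻¹ * ‖b‖ ^ 2 := by
    field_simp
  linarith

/-- Young's inequality pointwise with weight `l / σ`. Since `σ` dominates the one-sided penalties,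
`σ⁻¹` times the squared average splits into one-sided fluxes, whose skeleton integral is at most the
sum over element boundaries. The parameter `l` is left free for the later balance. -/
theorem two_consistencyForm_le (hd : 1 ≤ d) (hσ : ∀ i, 0 < c.σBd k Cstar i)
    (hσ' : ∀ i i', c.σBd k Cstar i ≤ c.σ k Cstar i i' ∧ c.σBd k Cstar i' ≤ c.σ k Cstar i i')
    (hw : w ∈ M.BP k) (hv : v ∈ M.BP k) {l : ℝ} (hl : 0 < l) :
    2 * c.consistencyForm w v ≤ l * c.fluxNorm k Cstar w + l⁻¹ * c.penaltyForm k Cstar v v := by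
  set q : PolytopicMesh.BdFun M := fun i F x => (c.σBd k Cstar i)⁻¹ * ‖c.flux w i F.1 x‖ ^ 2 with hq
  have hq0 : ∀ i F x, 0 ≤ q i F x := fun i F x =>
    mul_nonneg (inv_nonneg.2 (hσ i).le) (sq_nonneg _)
  have hqb : ∀ i, ∀ F ∈ M.bdFaces i,
      BddMeas ((μHE[d - 1] : Measure (E d)).restrict (M.face i F)) (q i F) := fun i F hF => by
    have := (BddMeas.const (ν := (μHE[d - 1] : Measure (E d)).restrict (M.face i F))
      (c.σBd k Cstar i)⁻¹).mul ((bddMeas_flux (c := c) hw hF).inner (bddMeas_flux (c := c) hw hF))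
    simpa only [real_inner_self_eq_norm_sq] using this
  set qq : PolytopicMesh.SkelFun M := fun i F i' F' x => q i F x + q i' F' x with hqq
  have hqs : PolytopicMesh.SkelBdd M qq q :=
    ⟨fun i i' F hF F' hF' => (bddMeas_piece_left (hqb i F hF)).add
      (bddMeas_piece_right (hqb i' F' hF')), fun i F hF => bddMeas_piece_bd (hqb i F hF)⟩
  have hone := PolytopicMesh.skeletonIntegral_one_sided_le hd hq0 hqb
  have hpen := skelBdd_pen (c := c) (k' := k) Cstar hv hv
  have hmono := PolytopicMesh.skeletonIntegral_mono hd ((skelBdd_cons (c := c) hw hv).smul 2)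
    ((hqs.smul l).add (hpen.smul l⁻¹)) ?_ ?_
  · rw [PolytopicMesh.skeletonIntegral_smul, PolytopicMesh.skeletonIntegral_add hd (hqs.smul l)
      (hpen.smul l⁻¹), PolytopicMesh.skeletonIntegral_smul, PolytopicMesh.skeletonIntegral_smul,
      ← consistencyForm_eq, ← penaltyForm_eq] at hmono
    have h2 : l * M.skeletonIntegral qq q ≤ l * c.fluxNorm k Cstar w :=
      mul_le_mul_of_nonneg_left hone hl.le
    linarith
  · refine fun i i' _ F _ F' _ => Eventually.of_forall fun x => ?_
    simp only [Pi.smul_apply, Pi.add_apply, smul_eq_mul, consFun, penFun, hqq, hq,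
      real_inner_self_eq_norm_sq]
    have hs : 0 < c.σ k Cstar i i' := (hσ i).trans_le (hσ' i i').1
    refine (two_inner_le (mul_pos hl (inv_pos.2 hs)) _ _).trans ?_
    have e : (l * (c.σ k Cstar i i')⁻¹)⁻¹ = l⁻¹ * c.σ k Cstar i i' := by
      rw [mul_inv, inv_inv]
    rw [e, mul_assoc, mul_assoc]
    refine add_le_add (mul_le_mul_of_nonneg_left ?_ hl.le) le_rfl
    have h1 : ‖c.avgFlux w i F i' F' x‖ ^ 2 ≤
        ‖c.flux w i F.1 x‖ ^ 2 + ‖c.flux w i' F'.1 x‖ ^ 2 := by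
      rw [avgFlux, norm_smul, mul_pow]
      have := norm_add_le (c.flux w i F.1 x) (c.flux w i' F'.1 x)
      have h0 := norm_nonneg (c.flux w i F.1 x + c.flux w i' F'.1 x)
      norm_num
      nlinarith [sq_nonneg (‖c.flux w i F.1 x‖ - ‖c.flux w i' F'.1 x‖)]
    have h2 := inv_anti₀ (hσ i) (hσ' i i').1
    have h3 := inv_anti₀ (hσ i') (hσ' i i').2
    calc (c.σ k Cstar i i')⁻¹ * ‖c.avgFlux w i F i' F' x‖ ^ 2
        ≤ (c.σ k Cstar i i')⁻¹ * (‖c.flux w i F.1 x‖ ^ 2 + ‖c.flux w i' F'.1 x‖ ^ 2) :=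
          mul_le_mul_of_nonneg_left h1 (inv_nonneg.2 hs.le)
      _ ≤ _ := by
          rw [mul_add]
          exact add_le_add (mul_le_mul_of_nonneg_right h2 (sq_nonneg _))
            (mul_le_mul_of_nonneg_right h3 (sq_nonneg _))
  · intro i F _ x
    simp only [Pi.smul_apply, Pi.add_apply, smul_eq_mul, consBd, penBd, hq,
      real_inner_self_eq_norm_sq]
    refine (two_inner_le (mul_pos hl (inv_pos.2 (hσ i))) _ _).trans ?_
    have e : (l * (c.σBd k Cstar i)⁻¹)⁻¹ = l⁻¹ * c.σBd k Cstar i := by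
      rw [mul_inv, inv_inv]
    rw [e, mul_assoc, mul_assoc]

theorem two_abs_consistencyForm_le (hd : 1 ≤ d) (hσ : ∀ i, 0 < c.σBd k Cstar i)
    (hσ' : ∀ i i', c.σBd k Cstar i ≤ c.σ k Cstar i i' ∧ c.σBd k Cstar i' ≤ c.σ k Cstar i i')
    (hw : w ∈ M.BP k) (hv : v ∈ M.BP k) {l : ℝ} (hl : 0 < l) :
    2 * |c.consistencyForm w v| ≤
      l * c.fluxNorm k Cstar w + l⁻¹ * c.penaltyForm k Cstar v v := by
  have h1 := c.two_consistencyForm_le hd hσ hσ' hw hv hl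
  have h2 := c.two_consistencyForm_le hd hσ hσ' hw (Submodule.smul_mem _ (-1) hv) hl
  rw [consistencyForm_smul_right, penaltyForm_smul_left, penaltyForm_comm,
    penaltyForm_smul_left] at h2
  rcases abs_cases (c.consistencyForm w v) with ⟨h, -⟩ | ⟨h, -⟩ <;> rw [h] <;> linarith

theorem integral_flux_face_le (hd : 1 ≤ d) (hw : w ∈ M.BP k) {i : Fin M.N}
    {F : Fin (M.n i) × Fin (d + 1)} (hF : F ∈ M.bdFaces i) :
    ∫ x in M.face i F, ‖c.flux w i F.1 x‖ ^ 2 ∂μHE[d - 1] ≤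
      supNorm c.D (M.K i) ^ 2 * ∫ x in M.face i F, ‖∇ (w i F.1) x‖ ^ 2 ∂μHE[d - 1] := by
  rw [← integral_const_mul]
  have hc : Continuous fun x => ‖∇ (w i F.1) x‖ ^ 2 :=
    (continuous_gradient_of_mem (hw i F.1)).norm.pow 2
  refine integral_mono_ae ?_ ((PolytopicMesh.integrableOn_face_of_continuous hd i F hc).const_mul _)
    ?_
  · have := (bddMeas_flux (c := c) hw hF).inner (bddMeas_flux (c := c) hw hF)
    simp only [real_inner_self_eq_norm_sq] at this
    exact PolytopicMesh.integrableOn_of_bddMeas_face hd subset_rfl this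
  · filter_upwards [ae_mono (Measure.restrict_mono_set _ (M.mem_bdFaces.1 hF))
      (c.ae_norm_Dtr_le i)] with x hx
    rw [← mul_pow]
    refine pow_le_pow_left₀ (norm_nonneg _) ?_ 2
    exact (norm_toEuclideanCLM_apply_le _ _).trans (mul_le_mul_of_nonneg_right hx (norm_nonneg _))

theorem integral_gradient_body_le (hw : w ∈ M.BP k) (i : Fin M.N) (t : Fin (M.n i)) :
    ∫ x in body (M.T i t), ‖∇ (w i t) x‖ ^ 2 ≤
      supNorm (fun x => (c.D x)⁻¹) (M.K i) * c.volTerm w i t := by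
  rw [volTerm, ← integral_const_mul]
  refine integral_mono_ae (PolytopicMesh.integrableOn_body_of_continuous i t
    ((continuous_gradient_of_mem (hw i t)).norm.pow 2))
    ((integrableOn_volIntegrand hw hw i t).const_mul _) ?_
  filter_upwards [ae_mono (M.restrict_body_le i t) (c.ae_norm_sq_le i),
    ae_mono (M.restrict_body_le i t) (c.ae_μ_nonneg i)] with x hx hμ
  refine (hx _).trans (mul_le_mul_of_nonneg_left ?_ supNorm_nonneg)
  rw [volIntegrand, mul_assoc]
  have := mul_nonneg hμ (mul_self_nonneg (w i t x))
  linarith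

/-- Bounding the flux by the gradient costs `‖D‖²`, and the gradient by the energy `‖D⁻¹‖`: together
`δ_K`. The trace inequality contributes `k (k - 1 + d) / ρ`. Division by the penalty leaves `(d / 8)
H_K / (C_star ρ)`, which is at most `d / 8`. -/
theorem fluxNorm_toBroken_le (hd : 1 ≤ d) (hk : 1 ≤ k) (hC : 0 < Cstar)
    (hδ : ∀ i, 0 < c.δ i) (hH : ∀ i, 0 < M.H i)
    (hstar : ∀ i, ∃ (z : E d) (ρ : ℝ), 0 < ρ ∧ Metric.closedBall z ρ ⊆ M.K i ∧
      (∀ y ∈ Metric.closedBall z ρ, StarConvex ℝ y (M.K i)) ∧ M.H i ≤ Cstar * ρ)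
    {v : Fin M.N → E d → ℝ} (hv : v ∈ M.VP k) :
    c.fluxNorm k Cstar (M.toBroken v) ≤
      (d : ℝ) / 8 * c.volumeForm (M.toBroken v) (M.toBroken v) := by
  have hd1 : (1 : ℝ) ≤ d := by exact_mod_cast hd
  have hk1 : (1 : ℝ) ≤ k := by exact_mod_cast hk
  rw [fluxNorm, volumeForm_self, Finset.mul_sum]
  refine Finset.sum_le_sum fun i _ => ?_
  obtain ⟨z, ρ, hρ, -, hst, hHρ⟩ := hstar i
  have hpf := penFactor_pos hd hk hC
  set N1 := supNorm c.D (M.K i)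
  set N2 := supNorm (fun x => (c.D x)⁻¹) (M.K i)
  have hvB := PolytopicMesh.toBroken_mem_BP hv
  have h1 : ∑ F ∈ M.bdFaces i, ∫ x in M.face i F, ‖c.flux (M.toBroken v) i F.1 x‖ ^ 2 ∂μHE[d - 1] ≤
      N1 ^ 2 * (((k : ℝ) * (k - 1 + d) * ρ⁻¹) * (N2 * ∑ t, c.volTerm (M.toBroken v) i t)) := by
    refine (Finset.sum_le_sum fun F hF => c.integral_flux_face_le hd hvB hF).trans ?_
    rw [← Finset.mul_sum]
    refine mul_le_mul_of_nonneg_left ?_ (sq_nonneg _)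
    refine (PolytopicMesh.sum_integral_gradient_face_le hd hk hρ hst
      (PolytopicMesh.mem_VP.1 hv i)).trans ?_
    refine mul_le_mul_of_nonneg_left ?_ ?_
    · rw [Finset.mul_sum]
      exact Finset.sum_le_sum fun t _ => c.integral_gradient_body_le hvB i t
    · have : (0 : ℝ) ≤ k - 1 + d := by linarith
      positivity
  simp_rw [integral_const_mul]
  rw [← Finset.mul_sum]
  have hσ : 0 < c.σBd k Cstar i := mul_pos hpf (mul_pos (hδ i) (inv_pos.2 (hH i)))
  refine (mul_le_mul_of_nonneg_left h1 (inv_nonneg.2 hσ.le)).trans ?_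
  set V := ∑ t, c.volTerm (M.toBroken v) i t
  have hV : 0 ≤ V := Finset.sum_nonneg fun t _ => c.volTerm_nonneg _ i t
  have hkd : (0 : ℝ) < k - 1 + d := by linarith
  have hδi := hδ i
  have hHi := hH i
  have e : (c.σBd k Cstar i)⁻¹ * (N1 ^ 2 * (((k : ℝ) * (k - 1 + d) * ρ⁻¹) * (N2 * V))) =
      (M.H i * ρ⁻¹ / Cstar) * ((d : ℝ) / 8 * V) := by
    have : c.σBd k Cstar i = penFactor d k Cstar * ((N1 ^ 2 * N2) * (M.H i)⁻¹) := rfl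
    rw [this, penFactor]
    have hN : N1 ^ 2 * N2 ≠ 0 := hδi.ne'
    have hN1 : N1 ≠ 0 := fun h => hN (by rw [h]; ring)
    have hN2 : N2 ≠ 0 := fun h => hN (by rw [h]; ring)
    field_simp
  rw [e]
  have h2 : M.H i * ρ⁻¹ / Cstar ≤ 1 := by
    rw [div_le_one hC, ← div_eq_mul_inv, div_le_iff₀ hρ]
    exact hHρ
  exact mul_le_of_le_one_left (by positivity) h2

/-- The mesh-dependent factor in the choice of `α`. -/
noncomputable def alphaFactor (M : PolytopicMesh d) (Cstar : ℝ) (i : Fin M.N) : ℝ :=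
  max 1 (M.H i / (8 * Cstar) *
    ⨆ F : {F // F ∈ M.bdFaces i},
      (μHE[d - 1] (M.face i F.1)).toReal / (volume (body (M.T i F.1.1))).toReal)

theorem alphaChoice_eq (M : PolytopicMesh d) (Cstar γ : ℝ) (i : Fin M.N) :
    alphaChoice M Cstar γ i = γ * alphaFactor M Cstar i := rfl

theorem one_le_alphaFactor (i : Fin M.N) : 1 ≤ alphaFactor M Cstar i := le_max_left _ _

theorem le_alphaFactor (hd : 1 ≤ d) (hC : 0 < Cstar) {i : Fin M.N}
    {F : Fin (M.n i) × Fin (d + 1)} (hF : F ∈ M.bdFaces i) :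
    M.H i / (8 * Cstar) * (d * ‖grad (M.T i F.1) F.2‖) ≤ alphaFactor M Cstar i := by
  refine le_trans (mul_le_mul_of_nonneg_left ?_ ?_) (le_max_right _ _)
  · rw [← PolytopicMesh.facet_ratio hd]
    exact le_ciSup (f := fun F : {F // F ∈ M.bdFaces i} => (μHE[d - 1] (M.face i F.1)).toReal /
      (volume (body (M.T i F.1.1))).toReal) (Set.finite_range _).bddAbove ⟨F, hF⟩
  · exact div_nonneg Metric.diam_nonneg (by positivity)

/-- For simplexwise polynomials only the trace inequality on single simplices is available, with
`‖grad‖` in place of `ρ⁻¹`. As `d ‖grad‖ = |f| / |T|`, the quotient by the penalty is the expression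
in `alphaFactor`; each simplex is counted at most `d + 1` times. -/
theorem fluxNorm_le (hd : 1 ≤ d) (hk : 1 ≤ k) (hC : 0 < Cstar)
    (hδ : ∀ i, 0 < c.δ i) (hH : ∀ i, 0 < M.H i) (hw : w ∈ M.BP k) :
    c.fluxNorm k Cstar w ≤
      ((d : ℝ) + 1) * ∑ i, alphaFactor M Cstar i * ∑ t, c.volTerm w i t := by
  have hd1 : (1 : ℝ) ≤ d := by exact_mod_cast hd
  have hk1 : (1 : ℝ) ≤ k := by exact_mod_cast hk
  rw [fluxNorm, Finset.mul_sum]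
  refine Finset.sum_le_sum fun i _ => ?_
  have hpf := penFactor_pos hd hk hC
  have hσ : 0 < c.σBd k Cstar i := mul_pos hpf (mul_pos (hδ i) (inv_pos.2 (hH i)))
  have hkd : (0 : ℝ) < k - 1 + d := by linarith
  have hα : 0 ≤ alphaFactor M Cstar i := zero_le_one.trans (one_le_alphaFactor i)
  have h1 : ∀ F ∈ M.bdFaces i, ∫ x in M.face i F, (c.σBd k Cstar i)⁻¹ * ‖c.flux w i F.1 x‖ ^ 2
      ∂μHE[d - 1] ≤ alphaFactor M Cstar i * c.volTerm w i F.1 := by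
    intro F hF
    set N1 := supNorm c.D (M.K i)
    set N2 := supNorm (fun x => (c.D x)⁻¹) (M.K i)
    rw [integral_const_mul]
    have h2 : ∫ x in M.face i F, ‖c.flux w i F.1 x‖ ^ 2 ∂μHE[d - 1] ≤
        N1 ^ 2 * (((k : ℝ) * (k - 1 + d) * ‖grad (M.T i F.1) F.2‖) *
          (N2 * c.volTerm w i F.1)) := by
      refine (c.integral_flux_face_le hd hw hF).trans (mul_le_mul_of_nonneg_left ?_ (sq_nonneg _))
      refine (PolytopicMesh.integral_gradient_face_le hd hk i F (hw i F.1)).trans ?_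
      exact mul_le_mul_of_nonneg_left (c.integral_gradient_body_le hw i F.1) (by positivity)
    refine (mul_le_mul_of_nonneg_left h2 (inv_nonneg.2 hσ.le)).trans ?_
    have hHi := hH i
    have hV := c.volTerm_nonneg w i F.1
    have hg := norm_nonneg (grad (M.T i F.1) F.2)
    have e : (c.σBd k Cstar i)⁻¹ * (N1 ^ 2 * (((k : ℝ) * (k - 1 + d) *
        ‖grad (M.T i F.1) F.2‖) * (N2 * c.volTerm w i F.1))) =
        (M.H i / (8 * Cstar) * (d * ‖grad (M.T i F.1) F.2‖)) * c.volTerm w i F.1 := by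
      have : c.σBd k Cstar i = penFactor d k Cstar * ((N1 ^ 2 * N2) * (M.H i)⁻¹) := rfl
      rw [this, penFactor]
      have hN : N1 ^ 2 * N2 ≠ 0 := (hδ i).ne'
      have hN1 : N1 ≠ 0 := fun h => hN (by rw [h]; ring)
      have hN2 : N2 ≠ 0 := fun h => hN (by rw [h]; ring)
      field_simp
    rw [e]
    exact mul_le_mul_of_nonneg_right (le_alphaFactor hd hC hF) hV
  refine (Finset.sum_le_sum h1).trans ?_
  refine (Finset.sum_le_sum_of_subset_of_nonneg (Finset.subset_univ _) fun F _ _ =>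
    mul_nonneg hα (c.volTerm_nonneg w i F.1)).trans (le_of_eq ?_)
  rw [Fintype.sum_prod_type]
  simp only [Finset.sum_const, Finset.card_univ, Fintype.card_fin, nsmul_eq_mul]
  rw [← Finset.mul_sum, ← Finset.mul_sum]
  push_cast
  ring

end Coeff


/-! ### Continuity of nodal interpolation across simplices, and the truncation of nodal values. -/

section Geometry

variable {d k : ℕ}

theorem le_diam_of_closedBall_subset (hd : 1 ≤ d) {z : E d} {ρ : ℝ} (hρ : 0 ≤ ρ) {S : Set (E d)}
    (hS : Bornology.IsBounded S) (h : Metric.closedBall z ρ ⊆ S) : ρ ≤ Metric.diam S := by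
  set e : E d := EuclideanSpace.single ⟨0, hd⟩ 1
  have he : ‖e‖ = 1 := by simp [e]
  have h1 : dist (z + ρ • e) z = ρ := by
    rw [dist_eq_norm, add_sub_cancel_left, norm_smul, he, mul_one, Real.norm_of_nonneg hρ]
  calc ρ = dist (z + ρ • e) z := h1.symm
    _ ≤ _ := Metric.dist_le_diam_of_mem hS (h (Metric.mem_closedBall.2 h1.le))
      (h (Metric.mem_closedBall_self hρ))

theorem lagrange_eq_zero (T : Simplex d) {a : Fin (d + 1) → ℕ} {j : Fin (d + 1)} (ha : a j ≠ 0)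
    {x : E d} (hx : T.coord j x = 0) : lagrange T k a x = 0 := by
  refine Finset.prod_eq_zero (Finset.mem_univ j) ?_
  refine Finset.prod_eq_zero (Finset.mem_range.2 (Nat.pos_of_ne_zero ha)) ?_
  simp [hx]

theorem exists_node_eq (T T' : Simplex d) {a : Fin (d + 1) → ℕ} (ha : a ∈ nodeIdx d k)
    (h : ∀ j, a j ≠ 0 → T j ∈ Set.range T') :
    ∃ a' ∈ nodeIdx d k, node T' k a' = node T k a := by
  classical
  -- Sums over vertices of `T` are regrouped by the equal vertices of `T'`. It is used with natural
  -- numbers for the sum of the indices and with vectors for the position of the node.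
  have key : ∀ {V : Type} [AddCommMonoid V] (f : Fin (d + 1) → Fin (d + 1) → V) (g : Fin (d + 1) → V),
      (∀ j l, T j = T' l → a j ≠ 0 → f j l = g j) → (∀ j, a j = 0 → g j = 0) →
      (∀ j l, a j = 0 → f j l = 0) →
      ∑ l, ∑ j, (if T j = T' l then f j l else 0) = ∑ j, g j := by
    intro V _ f g h1 h2 h3
    rw [Finset.sum_comm]
    refine Finset.sum_congr rfl fun j _ => ?_
    by_cases haj : a j = 0
    · rw [h2 j haj]
      refine Finset.sum_eq_zero fun l _ => ?_
      rw [h3 j l haj, ite_self]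
    · obtain ⟨l, hl⟩ := h j haj
      rw [Finset.sum_eq_single l]
      · rw [if_pos hl.symm, h1 j l hl.symm haj]
      · intro l' _ hl'
        rw [if_neg]
        intro hh
        exact hl' (simplex_injective T' (hh.symm.trans hl.symm))
      · exact fun hh => absurd (Finset.mem_univ l) hh
  refine ⟨fun l => ∑ j, if T j = T' l then a j else 0, ?_, ?_⟩
  · have := key (fun j _ => a j) a (fun _ _ _ _ => rfl) (fun _ h => h) (fun _ _ h => h)
    simp only [nodeIdx, Finset.mem_piAntidiag, Finset.mem_univ, implies_true, and_true]
    rw [this, sum_of_mem_nodeIdx ha]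
  · unfold node
    rw [← key (fun j l => ((a j : ℝ) / (k : ℝ)) • T' l) (fun j => ((a j : ℝ) / (k : ℝ)) • T j)
      (fun j l hjl _ => by rw [hjl]) (fun j hj => by simp [hj]) (fun j l hj => by simp [hj])]
    refine Finset.sum_congr rfl fun l _ => ?_
    push_cast
    rw [Finset.sum_div, Finset.sum_smul]
    refine Finset.sum_congr rfl fun j _ => ?_
    split_ifs <;> simp

/-- On the common face, basis functions of nodes off that face vanish, and the nodes on it are nodes
of both simplices. Hence the recovery `E⁺` stays continuous on each element although truncation is
nonlinear. -/
theorem nodal_interpolant_eq (hk : 1 ≤ k) {T T' : Simplex d}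
    (hsub : body T ∩ body T' ⊆ convexHull ℝ (Set.range T ∩ Set.range T')) (g : E d → ℝ) {x : E d}
    (hx : x ∈ body T ∩ body T') :
    ∑ a ∈ nodeIdx d k, g (node T k a) * lagrange T k a x =
      ∑ a ∈ nodeIdx d k, g (node T' k a) * lagrange T' k a x := by
  have hx' : ∀ j, T j ∉ Set.range T' → T.coord j x = 0 := by
    have e : Set.range T ∩ Set.range T' = T '' {j | T j ∈ Set.range T'} := by
      ext y
      constructor
      · rintro ⟨⟨j, rfl⟩, h⟩
        exact ⟨j, h, rfl⟩
      · rintro ⟨j, h, rfl⟩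
        exact ⟨⟨j, rfl⟩, h⟩
    have := hsub hx
    rw [e, mem_convexHull_image] at this
    exact fun j hj => (this j).2 hj
  rw [lagrange_interpolation T hk (lagrange_sum_mem_polys T' fun a => g (node T' k a)) x]
  refine Finset.sum_congr rfl fun a ha => ?_
  by_cases h : ∀ j, a j ≠ 0 → T j ∈ Set.range T'
  · obtain ⟨a', ha', e⟩ := exists_node_eq T T' ha h
    rw [← e, lagrange_sum_node T' hk (fun a => g (node T' k a)) ha']
  · push Not at h
    obtain ⟨j, hj, hj'⟩ := h
    rw [lagrange_eq_zero T hj (hx' j hj'), mul_zero, mul_zero]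

end Geometry

namespace PolytopicMesh

variable {d k : ℕ} {M : PolytopicMesh d} {v : Fin M.N → E d → ℝ} {κ : ℝ}

/-- The truncation to the interval `[0, κ]`. -/
def clip (κ s : ℝ) : ℝ := max 0 (min s κ)

theorem Eplus_apply (i : Fin M.N) (t : Fin (M.n i)) (x : E d) : M.Eplus k κ v i t x =
    ∑ a ∈ nodeIdx d k, clip κ (v i (node (M.T i t) k a)) * lagrange (M.T i t) k a x := rfl

theorem Eplus_mem_WT (hk : 1 ≤ k) : M.Eplus k κ v ∈ M.WT k := by
  refine ⟨fun i t => lagrange_sum_mem_polys _ fun a => clip κ (v i (node (M.T i t) k a)),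
    fun i t t' x hx => ?_⟩
  by_cases h : t = t'
  · rw [h]
  · exact nodal_interpolant_eq hk (M.conforming i t t' h).2 (fun y => clip κ (v i y)) hx

theorem Eminus_mem_WT (hk : 1 ≤ k) (hv : v ∈ M.VP k) : M.Eminus k κ v ∈ M.WT k := by
  refine ⟨fun i t => Submodule.sub_mem _ (mem_VP.1 hv i) ((Eplus_mem_WT hk).1 i t),
    fun i t t' x hx => ?_⟩
  have := (Eplus_mem_WT (M := M) (v := v) (κ := κ) hk).2 i t t' x hx
  simp only [Eminus, toBroken, Pi.sub_apply, this]

theorem Eplus_node (hk : 1 ≤ k) (i : Fin M.N) (t : Fin (M.n i)) {a : Fin (d + 1) → ℕ}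
    (ha : a ∈ nodeIdx d k) : M.Eplus k κ v i t (node (M.T i t) k a) =
      clip κ (v i (node (M.T i t) k a)) := by
  rw [Eplus_apply]
  exact lagrange_sum_node (M.T i t) hk (fun a => clip κ (v i (node (M.T i t) k a))) ha

theorem Eminus_node (hk : 1 ≤ k) (i : Fin M.N) (t : Fin (M.n i)) {a : Fin (d + 1) → ℕ}
    (ha : a ∈ nodeIdx d k) : M.Eminus k κ v i t (node (M.T i t) k a) =
      v i (node (M.T i t) k a) - clip κ (v i (node (M.T i t) k a)) := by
  rw [← Eplus_node hk i t ha]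
  rfl

theorem clip_monotone (κ : ℝ) : Monotone (clip κ) := fun _ _ h =>
  max_le_max le_rfl (min_le_min h le_rfl)

theorem abs_clip_sub_le (κ a b : ℝ) : |clip κ a - clip κ b| ≤ |a - b| := by
  unfold clip
  refine (abs_max_sub_max_le_max _ _ _ _).trans ?_
  rw [sub_self, abs_zero]
  refine max_le (abs_nonneg _) ((abs_min_sub_min_le_max _ _ _ _).trans ?_)
  simp

/-- The difference of the right and left sides is the product of the increments of `clip κ` and of
its complement. Both have the sign of `a - b`, as `clip κ` is monotone and 1-Lipschitz. -/
theorem sq_sub_clip_le (κ a b : ℝ) :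
    ((a - clip κ a) - (b - clip κ b)) ^ 2 ≤ ((a - clip κ a) - (b - clip κ b)) * (a - b) := by
  have h1 := clip_monotone κ
  have h2 := abs_clip_sub_le κ a b
  rcases le_total a b with h | h
  · have := h1 h
    rw [abs_of_nonpos (by linarith), abs_of_nonpos (by linarith)] at h2
    nlinarith
  · have := h1 h
    rw [abs_of_nonneg (by linarith), abs_of_nonneg (by linarith)] at h2
    nlinarith

end PolytopicMesh

/-! ### Positivity from the mesh assumptions. -/

namespace Admissible

variable {d k : ℕ} {M : PolytopicMesh d} {c : Coeff M} {Cstar Csh χ : ℝ}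

theorem volume_K_ne_zero (h : Admissible M c Cstar Csh χ) (i : Fin M.N) : volume (M.K i) ≠ 0 := by
  obtain ⟨z, ρ, hρ, hb, -⟩ := h.star i
  exact ((Metric.measure_closedBall_pos volume z hρ).trans_le (measure_mono hb)).ne'

theorem H_pos (h : Admissible M c Cstar Csh χ) (hd : 1 ≤ d) (i : Fin M.N) : 0 < M.H i := by
  obtain ⟨z, ρ, hρ, hb, -⟩ := h.star i
  exact hρ.trans_le (le_diam_of_closedBall_subset hd hρ.le (M.isCompact_K i).isBounded hb)

theorem h_pos (h : Admissible M c Cstar Csh χ) (hd : 1 ≤ d) (i : Fin M.N) (t : Fin (M.n i)) :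
    0 < M.h i t := by
  obtain ⟨z, ρ, hρ, hb, -⟩ := h.shape i t
  exact hρ.trans_le (le_diam_of_closedBall_subset hd hρ.le (isCompact_body _).isBounded hb)

theorem δ_pos (h : Admissible M c Cstar Csh χ) (hd : 1 ≤ d) (i : Fin M.N) : 0 < c.δ i :=
  c.δ_pos hd i (h.volume_K_ne_zero i)

theorem σBd_pos (h : Admissible M c Cstar Csh χ) (hd : 1 ≤ d) (hk : 1 ≤ k) (hC : 0 < Cstar)
    (i : Fin M.N) : 0 < c.σBd k Cstar i :=
  mul_pos (Coeff.penFactor_pos hd hk hC) (mul_pos (h.δ_pos hd i) (inv_pos.2 (h.H_pos hd i)))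

end Admissible

theorem Coeff.σBd_le_σ {d k : ℕ} {M : PolytopicMesh d} (c : Coeff M) {Cstar : ℝ} (hk : 1 ≤ k)
    (hC : 0 < Cstar) (i i' : Fin M.N) :
    c.σBd k Cstar i ≤ c.σ k Cstar i i' ∧ c.σBd k Cstar i' ≤ c.σ k Cstar i i' :=
  ⟨mul_le_mul_of_nonneg_left (le_max_left _ _) (Coeff.penFactor_nonneg hk hC),
    mul_le_mul_of_nonneg_left (le_max_right _ _) (Coeff.penFactor_nonneg hk hC)⟩


/-! ### The stabilisation against the energy, and strong monotonicity. -/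

namespace Coeff

variable {d k : ℕ} {M : PolytopicMesh d} (c : Coeff M) {w v : M.Broken} {Cstar C γ : ℝ}

/-- The contribution of the element `i` to the stabilisation, without the factor `α`. -/
noncomputable def nodeTerm (k : ℕ) (w : M.Broken) (i : Fin M.N) : ℝ :=
  ∑ t, ∑ a ∈ nodeIdx d k,
    c.weight i t * w i t (node (M.T i t) k a) * w i t (node (M.T i t) k a)

theorem stab_self (α : Fin M.N → ℝ) (w : M.Broken) :
    c.stab k α w w = ∑ i, α i * c.nodeTerm k w i := rfl

theorem nodeTerm_nonneg (w : M.Broken) (i : Fin M.N) : 0 ≤ c.nodeTerm k w i :=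
  Finset.sum_nonneg fun t _ => Finset.sum_nonneg fun a _ => by
    rw [mul_assoc]
    exact mul_nonneg (c.weight_nonneg i t) (mul_self_nonneg _)

/-- The restriction of a family of functions to the element `i`. -/
def single (w : M.Broken) (i : Fin M.N) : M.Broken := fun i' t => if i' = i then w i' t else 0

theorem single_mem_WT (hw : w ∈ M.WT k) (i : Fin M.N) : single w i ∈ M.WT k := by
  refine ⟨fun i' t => ?_, fun i' t t' x hx => ?_⟩
  · unfold single
    split_ifs
    · exact hw.1 i' t
    · exact Submodule.zero_mem _
  · unfold single
    split_ifs
    · exact hw.2 i' t t' x hx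
    · rfl

/-- The equivalence is global, but `α` varies between elements. Testing it with a function supported
on one element and dropping the penalty gives the local version. -/
theorem sum_volTerm_le (hk : 1 ≤ k) (hC : 0 < Cstar) (hE : c.IsEquivConst k Cstar C)
    (hw : w ∈ M.WT k) (i : Fin M.N) : ∑ t, c.volTerm w i t ≤ C * c.nodeTerm k w i := by
  have h := hE _ (single_mem_WT hw i)
  rw [c.dgNorm_sq hk hC, stab_self] at h
  have h1 : ∑ t, c.volTerm w i t = c.volumeForm (single w i) (single w i) := by
    rw [volumeForm_self, Finset.sum_eq_single i]
    · simp [volTerm, volIntegrand, single]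
    · intro i' _ hi'
      refine Finset.sum_eq_zero fun t _ => ?_
      simp [volTerm, volIntegrand, single, hi']
    · exact fun hh => absurd (Finset.mem_univ i) hh
  have h2 : ∑ i', 1 * c.nodeTerm k (single w i) i' = c.nodeTerm k w i := by
    rw [Finset.sum_eq_single i]
    · simp [nodeTerm, single]
    · intro i' _ hi'
      simp [nodeTerm, single, hi']
    · exact fun hh => absurd (Finset.mem_univ i) hh
  rw [h2] at h
  linarith [c.penaltyForm_self_nonneg hk hC (single w i)]

theorem alphaChoice_nonneg (hγ : 0 ≤ γ) (i : Fin M.N) : 0 ≤ alphaChoice M Cstar γ i :=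
  mul_nonneg hγ (zero_le_one.trans (one_le_alphaFactor i))

theorem stab_self_nonneg (hγ : 0 ≤ γ) (w : M.Broken) :
    0 ≤ c.stab k (alphaChoice M Cstar γ) w w := by
  rw [stab_self]
  exact Finset.sum_nonneg fun i _ => mul_nonneg (alphaChoice_nonneg hγ i) (c.nodeTerm_nonneg w i)

theorem sum_alphaFactor_le (hγ : 25 * C ≤ γ) {q : Fin M.N → ℝ}
    (hq : ∀ i, q i ≤ C * c.nodeTerm k w i) :
    25 * ∑ i, alphaFactor M Cstar i * q i ≤ c.stab k (alphaChoice M Cstar γ) w w := by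
  rw [stab_self, Finset.mul_sum]
  refine Finset.sum_le_sum fun i _ => ?_
  have hα : 0 ≤ alphaFactor M Cstar i := zero_le_one.trans (one_le_alphaFactor i)
  have hn := c.nodeTerm_nonneg (k := k) w i
  rw [alphaChoice_eq]
  calc 25 * (alphaFactor M Cstar i * q i)
      ≤ 25 * (alphaFactor M Cstar i * (C * c.nodeTerm k w i)) := by
        have := mul_le_mul_of_nonneg_left (hq i) hα
        linarith
    _ = (25 * C) * (alphaFactor M Cstar i * c.nodeTerm k w i) := by ring
    _ ≤ γ * (alphaFactor M Cstar i * c.nodeTerm k w i) :=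
        mul_le_mul_of_nonneg_right hγ (mul_nonneg hα hn)
    _ = _ := by ring

theorem fluxNorm_le_stab (hd : 1 ≤ d) (hk : 1 ≤ k) (hCs : 0 < Cstar)
    (hδ : ∀ i, 0 < c.δ i) (hH : ∀ i, 0 < M.H i) (hE : c.IsEquivConst k Cstar C)
    (hγ : 25 * C ≤ γ) (hw : w ∈ M.WT k) :
    25 * c.fluxNorm k Cstar w ≤ ((d : ℝ) + 1) * c.stab k (alphaChoice M Cstar γ) w w := by
  have h1 := c.fluxNorm_le hd hk hCs hδ hH (PolytopicMesh.WT_subset_BP hw)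
  have h2 := c.sum_alphaFactor_le (Cstar := Cstar) hγ (c.sum_volTerm_le hk hCs hE hw)
  have hd0 : (0 : ℝ) ≤ (d : ℝ) + 1 := by positivity
  have := mul_le_mul_of_nonneg_left h2 hd0
  linarith

theorem dgNorm_sq_le_stab (hC : 0 < C) (hE : c.IsEquivConst k Cstar C)
    (hγ : 25 * C ≤ γ) (hw : w ∈ M.WT k) :
    25 * c.dgNorm k Cstar w ^ 2 ≤ c.stab k (alphaChoice M Cstar γ) w w := by
  have h2 := c.sum_alphaFactor_le (Cstar := Cstar) hγ
    (fun i => le_refl (C * c.nodeTerm k w i))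
  refine le_trans ?_ h2
  refine mul_le_mul_of_nonneg_left ((hE w hw).trans ?_) (by norm_num)
  rw [stab_self, Finset.mul_sum]
  refine Finset.sum_le_sum fun i _ => ?_
  rw [one_mul]
  exact le_mul_of_one_le_left (mul_nonneg hC.le (c.nodeTerm_nonneg w i)) (one_le_alphaFactor i)

theorem two_dgForm_le (hd : 1 ≤ d) (hk : 1 ≤ k) (hC : 0 < Cstar) (w v : M.BP k) {l : ℝ}
    (hl : 0 < l) :
    2 * c.dgForm hd k Cstar w v ≤ l * c.dgForm hd k Cstar v v + l⁻¹ * c.dgForm hd k Cstar w w := by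
  have h := c.dgForm_self_nonneg hd hk hC (l • v - w)
  simp only [map_sub, map_smul, LinearMap.sub_apply, LinearMap.smul_apply, smul_eq_mul] at h
  rw [c.dgForm_comm hd v w] at h
  have h3 := mul_nonneg (inv_nonneg.2 hl.le) h
  have h4 : l⁻¹ * (l * (l * c.dgForm hd k Cstar v v - c.dgForm hd k Cstar w v) -
      (l * c.dgForm hd k Cstar w v - c.dgForm hd k Cstar w w)) =
      l * c.dgForm hd k Cstar v v - 2 * c.dgForm hd k Cstar w v +
        l⁻¹ * c.dgForm hd k Cstar w w := by
    field_simp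
    ring
  linarith

/-- The interior penalty form as a bilinear form on the broken polynomials. -/
noncomputable def ipForm (hd : 1 ≤ d) (k : ℕ) (Cstar θ : ℝ) : LinearMap.BilinForm ℝ (M.BP k) :=
  c.dgForm hd k Cstar - (c.consForm hd k + θ • LinearMap.flip (c.consForm hd k))

theorem ipForm_eq (hd : 1 ≤ d) (θ : ℝ) (w v : M.BP k) :
    c.ipForm hd k Cstar θ w v = c.dgForm hd k Cstar w v -
      (c.consForm hd k w v + θ * c.consForm hd k v w) := rfl

/-- With `X`, `Y` the volume and penalty parts of `e` and `S = s(e⁻, e⁻)`, the Young parameters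
below leave `5/16` of `X`, `9/40` of `Y` and `3/10` of `S`, hence the factor `1/5`. The dimension
enters through the flux bounds: `d ≤ 3` gives `3/8 X` for `e` and `4/25 S` for `e⁻`. -/
theorem ipForm_add_stabForm_ge (hd : 1 ≤ d) (hd3 : d ≤ 3) (hk : 1 ≤ k) (hCs : 0 < Cstar)
    (hδ : ∀ i, 0 < c.δ i) (hH : ∀ i, 0 < M.H i)
    (hstar : ∀ i, ∃ (z : E d) (ρ : ℝ), 0 < ρ ∧ Metric.closedBall z ρ ⊆ M.K i ∧
      (∀ y ∈ Metric.closedBall z ρ, StarConvex ℝ y (M.K i)) ∧ M.H i ≤ Cstar * ρ)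
    (hC : 0 < C) (hE : c.IsEquivConst k Cstar C) (hγ : 25 * C ≤ γ) {θ : ℝ}
    (hθ : θ ∈ Set.Icc (-1 : ℝ) 1) {e : Fin M.N → E d → ℝ} (he : e ∈ M.VP k)
    {em : M.Broken} (hem : em ∈ M.WT k) :
    1 / 5 * c.dgNorm k Cstar (M.toBroken e) ^ 2 ≤
      c.ipForm hd k Cstar θ (⟨M.toBroken e, PolytopicMesh.toBroken_mem_BP he⟩ -
        ⟨em, PolytopicMesh.WT_subset_BP hem⟩) ⟨M.toBroken e, PolytopicMesh.toBroken_mem_BP he⟩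
      + c.stab k (alphaChoice M Cstar γ) em em := by
  set eB : M.BP k := ⟨M.toBroken e, PolytopicMesh.toBroken_mem_BP he⟩ with heB
  set eM : M.BP k := ⟨em, PolytopicMesh.WT_subset_BP hem⟩ with heM
  have hd3' : (d : ℝ) ≤ 3 := by exact_mod_cast hd3
  have hσ : ∀ i, 0 < c.σBd k Cstar i := fun i =>
    mul_pos (penFactor_pos hd hk hCs) (mul_pos (hδ i) (inv_pos.2 (hH i)))
  have hσ' := c.σBd_le_σ (k := k) hk hCs
  set S := c.stab k (alphaChoice M Cstar γ) em em with hS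
  have hS0 : 0 ≤ S := c.stab_self_nonneg (by linarith) em
  have hX0 := c.volumeForm_self_nonneg (M.toBroken e)
  have hY0 := c.penaltyForm_self_nonneg hk hCs (M.toBroken e)
  have hXm := c.volumeForm_self_nonneg em
  have hFe := c.fluxNorm_toBroken_le hd hk hCs hδ hH hstar he
  have hFm := c.fluxNorm_le_stab hd hk hCs hδ hH hE hγ hem
  have hBm := c.dgNorm_sq_le_stab hC hE hγ hem
  rw [c.dgNorm_sq hk hCs] at hBm ⊢
  -- This is the main cost: `8/5 · 3/8 = 3/5` of `X` and `5/8` of `Y`. The other three parameters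
  -- put the weight on `e⁻`, which the factor 25 pays for.
  have c1 := c.two_abs_consistencyForm_le hd hσ hσ' eB.2 eB.2 (l := 8 / 5) (by norm_num)
  have c2 := c.two_dgForm_le hd hk hCs eM eB (l := 1 / 10) (by norm_num)
  have c3 := c.two_abs_consistencyForm_le hd hσ hσ' eM.2 eB.2 (l := 5) (by norm_num)
  have c4 := c.two_abs_consistencyForm_le hd hσ hσ' eB.2 eM.2 (l := 1 / 5) (by norm_num)
  rw [dgForm_apply c hd eB eB, dgForm_apply c hd eM eM] at c2
  simp only [heB, heM] at c1 c3 c4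
  rw [map_sub, LinearMap.sub_apply, ipForm_eq, ipForm_eq, dgForm_apply, consForm_apply,
    consForm_apply, consForm_apply]
  simp only [← hS, heB, heM] at *
  set X := c.volumeForm (M.toBroken e) (M.toBroken e)
  set Y := c.penaltyForm k Cstar (M.toBroken e) (M.toBroken e)
  set Fe := c.fluxNorm k Cstar (M.toBroken e)
  set Fm := c.fluxNorm k Cstar em
  set a := c.consistencyForm (M.toBroken e) (M.toBroken e)
  set b := c.consistencyForm em (M.toBroken e)
  set g := c.consistencyForm (M.toBroken e) em
  have hFe' : Fe ≤ 3 / 8 * X := hFe.trans (mul_le_mul_of_nonneg_right (by linarith) hX0)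
  have hFm' : 25 * Fm ≤ 4 * S := hFm.trans (mul_le_mul_of_nonneg_right (by linarith) hS0)
  have t1 : a + θ * a ≤ 2 * |a| := by
    have : (1 + θ) * a ≤ 2 * |a| :=
      mul_le_mul_of_nonneg (by linarith [hθ.2]) (le_abs_self a) (by linarith [hθ.1]) (abs_nonneg a)
    linarith
  have t2 : -|b| ≤ b := neg_abs_le b
  have t3 : -|g| ≤ θ * g := by
    have h1 : |θ * g| ≤ |g| := by
      rw [abs_mul]
      exact mul_le_of_le_one_left (abs_nonneg g) (abs_le.2 ⟨hθ.1, hθ.2⟩)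
    linarith [neg_abs_le (θ * g)]
  norm_num at c1 c2 c3 c4
  linarith

/-- The nodal remainders `E⁻(u) - E⁻(w)` are controlled by the stabilisation. -/
theorem stab_Eminus_le (hk : 1 ≤ k) (hγ : 0 ≤ γ) (κ : ℝ) (u w : Fin M.N → E d → ℝ) :
    c.stab k (alphaChoice M Cstar γ) (M.Eminus k κ u - M.Eminus k κ w)
        (M.Eminus k κ u - M.Eminus k κ w) ≤
      c.stab k (alphaChoice M Cstar γ) (M.Eminus k κ u - M.Eminus k κ w) (M.toBroken (u - w)) := by
  unfold stab
  refine Finset.sum_le_sum fun i _ => mul_le_mul_of_nonneg_left ?_ (alphaChoice_nonneg hγ i)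
  refine Finset.sum_le_sum fun t _ => Finset.sum_le_sum fun a ha => ?_
  rw [mul_assoc, mul_assoc]
  refine mul_le_mul_of_nonneg_left ?_ (c.weight_nonneg i t)
  simp only [Pi.sub_apply, PolytopicMesh.Eminus_node hk i t ha, PolytopicMesh.toBroken]
  rw [← sq]
  exact PolytopicMesh.sq_sub_clip_le κ _ _

end Coeff

/-! ### The operator of the method. -/

namespace PolytopicMesh

variable {d k : ℕ} {M : PolytopicMesh d}

/-- Elementwise polynomials as broken polynomials on the submesh. -/
def incl (M : PolytopicMesh d) (k : ℕ) : M.VP k →ₗ[ℝ] M.BP k where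
  toFun v := ⟨M.toBroken v, toBroken_mem_BP v.2⟩
  map_add' _ _ := rfl
  map_smul' _ _ := rfl

/-- The recovery `E⁺` as a map into the broken polynomials. -/
noncomputable def plus (M : PolytopicMesh d) (hk : 1 ≤ k) (κ : ℝ) (v : M.VP k) : M.BP k :=
  ⟨M.Eplus k κ v, WT_subset_BP (Eplus_mem_WT hk)⟩

/-- The remainder `E⁻` as a map into the broken polynomials. -/
noncomputable def minus (M : PolytopicMesh d) (hk : 1 ≤ k) (κ : ℝ) (v : M.VP k) : M.BP k :=
  ⟨M.Eminus k κ v, WT_subset_BP (Eminus_mem_WT hk v.2)⟩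

theorem plus_add_minus (hk : 1 ≤ k) (κ : ℝ) (v : M.VP k) :
    M.plus hk κ v + M.minus hk κ v = incl M k v :=
  Subtype.ext (add_sub_cancel _ _)

theorem sub_mem_WT {w w' : M.Broken} (hw : w ∈ M.WT k) (hw' : w' ∈ M.WT k) : w - w' ∈ M.WT k :=
  ⟨fun i t => Submodule.sub_mem _ (hw.1 i t) (hw'.1 i t), fun i t t' x hx => by
    simp only [Pi.sub_apply, hw.2 i t t' x hx, hw'.2 i t t' x hx]⟩

end PolytopicMesh

namespace Coeff

open PolytopicMesh

variable {d k : ℕ} {M : PolytopicMesh d} (c : Coeff M) {Cstar C γ θ κ : ℝ}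

/-- The operator `u ↦ a_h(u; ·)` of the bound-preserving method. -/
noncomputable def operator (hd : 1 ≤ d) (hk : 1 ≤ k) (Cstar θ κ : ℝ) (α : Fin M.N → ℝ)
    (u : M.VP k) : Module.Dual ℝ (M.VP k) :=
  (c.ipForm hd k Cstar θ (M.plus hk κ u)).comp (incl M k) +
    (c.stabForm k α (M.minus hk κ u)).comp (incl M k)

theorem operator_strongly_monotone (hd : 1 ≤ d) (hd3 : d ≤ 3) (hk : 1 ≤ k) (hCs : 0 < Cstar)
    {Csh χ : ℝ} (hM : Admissible M c Cstar Csh χ) (hC : 0 < C) (hE : c.IsEquivConst k Cstar C)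
    (hγ : 25 * C ≤ γ) (hθ : θ ∈ Set.Icc (-1 : ℝ) 1) (u w : M.VP k) :
    1 / 5 * c.dgNorm k Cstar (M.toBroken ((u - w : M.VP k) : Fin M.N → E d → ℝ)) ^ 2 ≤
      c.operator hd hk Cstar θ κ (alphaChoice M Cstar γ) u (u - w) -
      c.operator hd hk Cstar θ κ (alphaChoice M Cstar γ) w (u - w) := by
  have hem := sub_mem_WT (Eminus_mem_WT (κ := κ) hk u.2) (Eminus_mem_WT (κ := κ) hk w.2)
  have h1 := c.ipForm_add_stabForm_ge hd hd3 hk hCs (hM.δ_pos hd) (hM.H_pos hd) hM.star hC hE hγ hθ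
    (u - w).2 hem
  have h2 := c.stab_Eminus_le (Cstar := Cstar) hk (by linarith : 0 ≤ γ) κ u.1 w.1
  refine h1.trans ?_
  -- Replacing the difference of the `E⁺` parts by `e - e⁻` leaves an expression that is linear in
  -- `e` and `e⁻`, to which the bilinear estimate applies.
  have e1 : c.operator hd hk Cstar θ κ (alphaChoice M Cstar γ) u (u - w) -
      c.operator hd hk Cstar θ κ (alphaChoice M Cstar γ) w (u - w) =
      c.ipForm hd k Cstar θ (incl M k (u - w) - (M.minus hk κ u - M.minus hk κ w))
        (incl M k (u - w)) +
      c.stabForm k (alphaChoice M Cstar γ) (M.minus hk κ u - M.minus hk κ w)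
        (incl M k (u - w)) := by
    have e2 : incl M k (u - w) - (M.minus hk κ u - M.minus hk κ w) =
        M.plus hk κ u - M.plus hk κ w := by
      rw [map_sub, ← plus_add_minus hk κ u, ← plus_add_minus hk κ w]
      abel
    rw [e2]
    simp only [operator, LinearMap.add_apply, LinearMap.comp_apply, map_sub, LinearMap.sub_apply]
    ring
  rw [e1]
  exact add_le_add le_rfl h2

end Coeff


/-! ### Scaling bounds on shape-regular simplices. -/

section ShapeRegular

variable {d k : ℕ}

/-- The Lagrange basis functions in barycentric coordinates. -/
noncomputable def lagrangeBary (d k : ℕ) (a : Fin (d + 1) → ℕ) (y : Fin (d + 1) → ℝ) : ℝ :=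
  ∏ j, ∏ l ∈ Finset.range (a j), ((k : ℝ) * y j - l) / ((a j : ℝ) - l)

theorem contDiff_lagrangeBary (a : Fin (d + 1) → ℕ) : ContDiff ℝ 1 (lagrangeBary d k a) := by
  unfold lagrangeBary
  refine contDiff_prod fun j _ => contDiff_prod fun l _ => ?_
  exact ((contDiff_const.mul (contDiff_apply ℝ ℝ j)).sub contDiff_const).div_const _

/-- In barycentric coordinates the basis does not depend on the simplex, so compactness of the cube
gives bounds depending on `d` and `k` only. -/
theorem exists_lagrangeBary_bound (d k : ℕ) : ∃ B : ℝ, 0 ≤ B ∧ ∀ a ∈ nodeIdx d k,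
    ∀ y ∈ Set.Icc (0 : Fin (d + 1) → ℝ) 1,
      |lagrangeBary d k a y| ≤ B ∧ ‖fderiv ℝ (lagrangeBary d k a) y‖ ≤ B := by
  have hcpt : IsCompact (Set.Icc (0 : Fin (d + 1) → ℝ) 1) := isCompact_Icc
  have h1 : ∀ a, ∃ B : ℝ, ∀ y ∈ Set.Icc (0 : Fin (d + 1) → ℝ) 1,
      |lagrangeBary d k a y| ≤ B ∧ ‖fderiv ℝ (lagrangeBary d k a) y‖ ≤ B := by
    intro a
    have hc := contDiff_lagrangeBary (k := k) a
    obtain ⟨B₁, hB₁⟩ := hcpt.exists_bound_of_continuousOn hc.continuous.continuousOn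
    obtain ⟨B₂, hB₂⟩ := hcpt.exists_bound_of_continuousOn
      (hc.continuous_fderiv one_ne_zero).continuousOn
    exact ⟨max B₁ B₂, fun y hy => ⟨(hB₁ y hy).trans (le_max_left _ _),
      (hB₂ y hy).trans (le_max_right _ _)⟩⟩
  choose B hB using h1
  refine ⟨∑ a ∈ nodeIdx d k, |B a|, Finset.sum_nonneg fun a _ => abs_nonneg _,
    fun a ha y hy => ?_⟩
  have h2 : B a ≤ ∑ a ∈ nodeIdx d k, |B a| := (le_abs_self _).trans
    (Finset.single_le_sum (f := fun a => |B a|) (fun a _ => abs_nonneg _) ha)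
  exact ⟨(hB a y hy).1.trans h2, (hB a y hy).2.trans h2⟩

variable (T : Simplex d)

theorem coord_mem_Icc {x : E d} (hx : x ∈ body T) :
    (fun j => T.coord j x) ∈ Set.Icc (0 : Fin (d + 1) → ℝ) 1 := by
  rw [mem_body] at hx
  refine ⟨fun j => hx j, fun j => ?_⟩
  have := Finset.single_le_sum (f := fun j => T.coord j x) (fun i _ => hx i) (Finset.mem_univ j)
  simpa [sum_coord] using this

/-- Moving from the centre by `ρ` along the gradient raises the coordinate by `ρ ‖grad T j‖`, and it
stays in `[0, 1]`. -/
theorem norm_grad_le (j : Fin (d + 1)) {z : E d} {ρ : ℝ} (hρ : 0 < ρ)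
    (hz : Metric.closedBall z ρ ⊆ body T) : ‖grad T j‖ ≤ ρ⁻¹ := by
  by_cases h0 : grad T j = 0
  · rw [h0, norm_zero]; positivity
  have hg : 0 < ‖grad T j‖ := norm_pos_iff.2 h0
  set x : E d := z + (ρ / ‖grad T j‖) • grad T j
  have hx : x ∈ Metric.closedBall z ρ := by
    rw [Metric.mem_closedBall, dist_eq_norm, add_sub_cancel_left, norm_smul,
      Real.norm_of_nonneg (by positivity)]
    field_simp
    exact le_rfl
  have h1 := coord_sub T j x z
  rw [add_sub_cancel_left, inner_smul_right, real_inner_self_eq_norm_sq] at h1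
  have h2 := (coord_mem_Icc T (hz hx)).2 j
  have h3 := (coord_mem_Icc T (hz (Metric.mem_closedBall_self hρ.le))).1 j
  simp only [Pi.zero_apply, Pi.one_apply] at h2 h3
  have h4 : ρ / ‖grad T j‖ * ‖grad T j‖ ^ 2 = ‖grad T j‖ * ρ := by field_simp
  rw [h4] at h1
  rw [← one_div, le_div_iff₀ hρ]
  linarith

theorem hasFDerivAt_coord (j : Fin (d + 1)) (x : E d) :
    HasFDerivAt (fun x => T.coord j x) (innerSL ℝ (grad T j)) x := by
  have e : (fun x => T.coord j x) = fun x => innerSL ℝ (grad T j) x + T.coord j 0 := by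
    ext x
    have := coord_sub T j x 0
    rw [sub_zero] at this
    rw [innerSL_apply_apply, ← this]
    ring
  rw [e]
  exact (innerSL ℝ (grad T j)).hasFDerivAt.add_const _

theorem norm_gradient (p : E d → ℝ) (x : E d) : ‖∇ p x‖ = ‖fderiv ℝ p x‖ := by
  rw [gradient, LinearIsometryEquiv.norm_map]

theorem norm_gradient_lagrange_le {B : ℝ} {a : Fin (d + 1) → ℕ}
    (hB : ∀ y ∈ Set.Icc (0 : Fin (d + 1) → ℝ) 1, ‖fderiv ℝ (lagrangeBary d k a) y‖ ≤ B)
    {z : E d} {ρ : ℝ} (hρ : 0 < ρ) (hz : Metric.closedBall z ρ ⊆ body T) {x : E d}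
    (hx : x ∈ body T) : ‖∇ (lagrange T k a) x‖ ≤ B * ρ⁻¹ := by
  have h1 : HasFDerivAt (fun x j => T.coord j x)
      (ContinuousLinearMap.pi fun j => innerSL ℝ (grad T j)) x :=
    hasFDerivAt_pi.2 fun j => hasFDerivAt_coord T j x
  have h2 := ((contDiff_lagrangeBary (k := k) a).differentiable one_ne_zero
    (fun j => T.coord j x)).hasFDerivAt
  have h3 : HasFDerivAt (lagrangeBary d k a ∘ fun x j => T.coord j x) _ x := h2.comp x h1
  have h4 : lagrange T k a = lagrangeBary d k a ∘ fun x j => T.coord j x := rfl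
  rw [norm_gradient, h4, h3.fderiv]
  refine (ContinuousLinearMap.opNorm_comp_le _ _).trans ?_
  refine mul_le_mul (hB _ (coord_mem_Icc T hx)) ?_ (norm_nonneg _)
    ((norm_nonneg _).trans (hB _ (coord_mem_Icc T hx)))
  refine ContinuousLinearMap.opNorm_le_bound _ (by positivity) fun y => ?_
  rw [pi_norm_le_iff_of_nonneg (by positivity)]
  intro j
  rw [ContinuousLinearMap.pi_apply, innerSL_apply_apply]
  exact (norm_inner_le_norm _ _).trans
    (mul_le_mul_of_nonneg_right (norm_grad_le T j hρ hz) (norm_nonneg _))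

theorem sq_sum_mul_le {ι : Type*} (s : Finset ι) (c f : ι → ℝ) {B : ℝ} (hf : ∀ i ∈ s, |f i| ≤ B) :
    (∑ i ∈ s, |c i| * |f i|) ^ 2 ≤ s.card * B ^ 2 * ∑ i ∈ s, c i ^ 2 := by
  refine (sq_sum_le_card_mul_sum_sq (s := s) (f := fun i => |c i| * |f i|)).trans ?_
  rw [mul_assoc]
  refine mul_le_mul_of_nonneg_left ?_ (by positivity)
  rw [Finset.mul_sum]
  refine Finset.sum_le_sum fun i hi => ?_
  rw [mul_pow, sq_abs, mul_comm]
  exact mul_le_mul_of_nonneg_right (pow_le_pow_left₀ (abs_nonneg _) (hf i hi) 2) (sq_nonneg _)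

/-- The sum of the squares of the nodal values. -/
noncomputable def nodalSq (T : Simplex d) (k : ℕ) (p : E d → ℝ) : ℝ :=
  ∑ a ∈ nodeIdx d k, p (node T k a) ^ 2

theorem nodalSq_nonneg (p : E d → ℝ) : 0 ≤ nodalSq T k p := Finset.sum_nonneg fun _ _ => sq_nonneg _

variable {T} {B : ℝ} {p : E d → ℝ}

theorem sq_le_nodalSq (hk : 1 ≤ k) (hp : p ∈ polys d k)
    (hB : ∀ a ∈ nodeIdx d k, ∀ y ∈ Set.Icc (0 : Fin (d + 1) → ℝ) 1, |lagrangeBary d k a y| ≤ B)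
    {x : E d} (hx : x ∈ body T) :
    p x ^ 2 ≤ (nodeIdx d k).card * B ^ 2 * nodalSq T k p := by
  refine le_trans ?_ (sq_sum_mul_le (nodeIdx d k) (fun a => p (node T k a))
    (fun a => lagrange T k a x) fun a ha => hB a ha _ (coord_mem_Icc T hx))
  rw [← sq_abs]
  refine pow_le_pow_left₀ (abs_nonneg _) ?_ 2
  rw [lagrange_interpolation T hk hp x]
  refine (Finset.abs_sum_le_sum_abs _ _).trans (le_of_eq ?_)
  simp only [abs_mul]

theorem norm_gradient_sq_le_nodalSq (hk : 1 ≤ k) (hp : p ∈ polys d k)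
    (hB : ∀ a ∈ nodeIdx d k, ∀ y ∈ Set.Icc (0 : Fin (d + 1) → ℝ) 1,
      ‖fderiv ℝ (lagrangeBary d k a) y‖ ≤ B)
    {z : E d} {ρ : ℝ} (hρ : 0 < ρ) (hz : Metric.closedBall z ρ ⊆ body T)
    {x : E d} (hx : x ∈ body T) :
    ‖∇ p x‖ ^ 2 ≤ (nodeIdx d k).card * B ^ 2 * (ρ⁻¹) ^ 2 * nodalSq T k p := by
  have h := sq_sum_mul_le (nodeIdx d k) (fun a => p (node T k a))
    (fun a => ‖∇ (lagrange T k a) x‖) (B := B * ρ⁻¹) fun a ha => by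
      rw [abs_norm]; exact norm_gradient_lagrange_le T (hB a ha) hρ hz hx
  rw [mul_pow, ← mul_assoc] at h
  refine le_trans ?_ h
  refine pow_le_pow_left₀ (norm_nonneg _) ?_ 2
  have e : ∇ p x = ∑ a ∈ nodeIdx d k, p (node T k a) • ∇ (lagrange T k a) x := by
    have e1 : p = fun x => ∑ a ∈ nodeIdx d k, p (node T k a) * lagrange T k a x :=
      funext fun x => lagrange_interpolation T hk hp x
    have e2 : HasFDerivAt p (∑ a ∈ nodeIdx d k, p (node T k a) • fderiv ℝ (lagrange T k a) x) x := by
      have e3 : HasFDerivAt (fun x => ∑ a ∈ nodeIdx d k, p (node T k a) * lagrange T k a x)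
          (∑ a ∈ nodeIdx d k, p (node T k a) • fderiv ℝ (lagrange T k a) x) x :=
        HasFDerivAt.fun_sum fun a ha =>
          ((differentiable_of_mem_polys (lagrange_mem_polys T ha) x).hasFDerivAt).const_mul _
      rwa [← e1] at e3
    rw [gradient, e2.fderiv, map_sum]
    refine Finset.sum_congr rfl fun a _ => ?_
    rw [map_smulₛₗ]
    rfl
  rw [e]
  refine (norm_sum_le _ _).trans (le_of_eq ?_)
  simp only [norm_smul, Real.norm_eq_abs, abs_norm]

/-- The volume of the unit ball. -/
noncomputable def ballVol (d : ℕ) : ℝ := (volume (Metric.ball (0 : E d) 1)).toReal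

theorem volume_body_le (T : Simplex d) :
    (volume (body T)).toReal ≤ ballVol d * Metric.diam (body T) ^ d := by
  obtain ⟨x, hx⟩ := interior_body_nonempty T
  have hx' := interior_subset hx
  have h1 : body T ⊆ Metric.closedBall x (Metric.diam (body T)) := fun y hy =>
    Metric.dist_le_diam_of_mem (isCompact_body T).isBounded hy hx'
  have h2 := measure_mono (μ := volume) h1
  rw [Measure.addHaar_closedBall _ _ Metric.diam_nonneg, finrank_euclideanSpace_fin] at h2
  have h3 := ENNReal.toReal_mono (ENNReal.mul_ne_top ENNReal.ofReal_ne_top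
    Metric.isBounded_ball.measure_lt_top.ne) h2
  rwa [ENNReal.toReal_mul, ENNReal.toReal_ofReal (pow_nonneg Metric.diam_nonneg _), mul_comm] at h3

theorem hausdorff_facet_le (hd : 1 ≤ d) (T : Simplex d) (j : Fin (d + 1)) {z : E d} {ρ : ℝ}
    (hρ : 0 < ρ) (hz : Metric.closedBall z ρ ⊆ body T) :
    (μHE[d - 1] (facet T j)).toReal ≤ d * ρ⁻¹ * (ballVol d * Metric.diam (body T) ^ d) := by
  rw [hausdorff_facet T hd, ENNReal.toReal_mul, ENNReal.toReal_mul, toReal_enorm,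
    ENNReal.toReal_natCast]
  exact mul_le_mul (mul_le_mul_of_nonneg_left (norm_grad_le T j hρ hz) (by positivity))
    (volume_body_le T) ENNReal.toReal_nonneg (by positivity)

end ShapeRegular


/-! ### Existence of the equivalence constant. -/

theorem PolytopicMesh.h_le_H {d : ℕ} (M : PolytopicMesh d) (i : Fin M.N) (t : Fin (M.n i)) :
    M.h i t ≤ M.H i :=
  Metric.diam_mono (M.body_subset_K i t) (M.isCompact_K i).isBounded

namespace Coeff

variable {d k : ℕ} {M : PolytopicMesh d} (c : Coeff M) {w v : M.Broken} {Cstar Csh χ : ℝ}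

/-- The maximum of the diffusion tensor on the patch of the element `i`. -/
noncomputable def patchNorm (i : Fin M.N) : ℝ := supNorm c.D (⋃ i' ∈ M.neighbours i, M.K i')

theorem patchNorm_nonneg (i : Fin M.N) : 0 ≤ c.patchNorm i := supNorm_nonneg

theorem supNorm_le_patchNorm {i i' : Fin M.N} (h : i' ∈ M.neighbours i) :
    supNorm c.D (M.K i') ≤ c.patchNorm i := by
  obtain ⟨B, hB⟩ := c.exists_bound_D
  refine supNorm_mono (B := B) ?_ (Set.subset_biUnion_of_mem (u := fun i' => M.K i') h)
  rw [ae_restrict_biUnion_iff _ (Set.to_countable _)]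
  exact fun i' _ => hB i'

theorem self_mem_neighbours (i : Fin M.N) : i ∈ M.neighbours i := Or.inl rfl

theorem δ_div_H_le (hM : Admissible M c Cstar Csh χ) (hχ : 0 < χ) {i i' : Fin M.N}
    (hi : i' ∈ M.neighbours i) {h : ℝ} (h0 : 0 < h) (hH : h ≤ M.H i') :
    c.δ i' * (M.H i')⁻¹ ≤ χ * c.patchNorm i * h⁻¹ := by
  have h1 := hM.contrast i'
  have h2 := c.supNorm_le_patchNorm hi
  have h3 : 0 ≤ supNorm c.D (M.K i') := supNorm_nonneg
  refine mul_le_mul ?_ (inv_anti₀ h0 hH) (inv_nonneg.2 (h0.le.trans hH))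
    (mul_nonneg hχ.le (c.patchNorm_nonneg i))
  calc c.δ i' = (supNorm c.D (M.K i') * supNorm (fun x => (c.D x)⁻¹) (M.K i')) *
        supNorm c.D (M.K i') := by rw [δ]; ring
    _ ≤ χ * c.patchNorm i := mul_le_mul h1 h2 h3 hχ.le

/-- A bound for the penalty on the facet `F` of the element `i`. -/
noncomputable def penBound (k : ℕ) (Cstar χ : ℝ) (i : Fin M.N) (t : Fin (M.n i)) : ℝ :=
  penFactor d k Cstar * (χ * c.patchNorm i * (M.h i t)⁻¹)

theorem penBound_nonneg (hk : 1 ≤ k) (hC : 0 < Cstar) (hχ : 0 < χ) (i : Fin M.N)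
    (t : Fin (M.n i)) : 0 ≤ c.penBound k Cstar χ i t := by
  have h1 : 0 ≤ M.h i t := Metric.diam_nonneg
  have h2 := c.patchNorm_nonneg i
  exact mul_nonneg (penFactor_nonneg hk hC) (by positivity)

theorem σBd_le_penBound (hM : Admissible M c Cstar Csh χ) (hd : 1 ≤ d) (hk : 1 ≤ k)
    (hC : 0 < Cstar) (hχ : 0 < χ) (i : Fin M.N) (t : Fin (M.n i)) :
    c.σBd k Cstar i ≤ c.penBound k Cstar χ i t :=
  mul_le_mul_of_nonneg_left (c.δ_div_H_le hM hχ (self_mem_neighbours i) (hM.h_pos hd i t)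
    (M.h_le_H i t)) (penFactor_nonneg hk hC)

/-- The contrast turns `δ` into `χ ‖D‖` on the patch, and both element diameters are at least `h_T`,
the one across the facet by the assumption on neighbours. Positive measure of the piece is what
makes `i'` a neighbour. -/
theorem σ_le_penBound (hM : Admissible M c Cstar Csh χ) (hd : 1 ≤ d) (hk : 1 ≤ k)
    (hC : 0 < Cstar) (hχ : 0 < χ) {i i' : Fin M.N} (hi : i ≠ i')
    {F : Fin (M.n i) × Fin (d + 1)} (hF : F ∈ M.bdFaces i) {F' : Fin (M.n i') × Fin (d + 1)}
    (hpos : μHE[d - 1] (M.face i F ∩ M.face i' F' ∩ M.Ω) ≠ 0) :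
    c.σ k Cstar i i' ≤ c.penBound k Cstar χ i F.1 := by
  have hf : ∀ {i} {F : Fin (M.n i) × Fin (d + 1)}, M.face i F ⊆ M.K i := fun {i F} =>
    (M.face_subset_body i F).trans (M.body_subset_K i F.1)
  have hn : i' ∈ M.neighbours i := Or.inr ((pos_iff_ne_zero.2 hpos).trans_le
    (measure_mono fun x hx => ⟨⟨hf hx.1.1, hf hx.1.2⟩, hx.2⟩))
  have hh : M.h i F.1 ≤ M.H i' := hM.neighbour i i' hi F hF ((pos_iff_ne_zero.2 hpos).trans_le
    (measure_mono fun x hx => ⟨⟨hx.1.1, hf hx.1.2⟩, hx.2⟩))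
  refine mul_le_mul_of_nonneg_left (max_le ?_ ?_) (penFactor_nonneg hk hC)
  · exact c.δ_div_H_le hM hχ (self_mem_neighbours i) (hM.h_pos hd i F.1) (M.h_le_H i F.1)
  · exact c.δ_div_H_le hM hχ hn (hM.h_pos hd i F.1) hh

theorem σ_comm (i i' : Fin M.N) : c.σ k Cstar i i' = c.σ k Cstar i' i := by
  unfold σ
  rw [max_comm]

theorem norm_jump_sq_le (hd : 1 ≤ d) (i : Fin M.N) (F : Fin (M.n i) × Fin (d + 1)) (i' : Fin M.N)
    (F' : Fin (M.n i') × Fin (d + 1)) (x : E d) :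
    ‖M.jump w i F i' F' x‖ ^ 2 ≤ 2 * (w i F.1 x ^ 2 + w i' F'.1 x ^ 2) := by
  have h1 : ‖M.jump w i F i' F' x‖ ≤ |w i F.1 x| + |w i' F'.1 x| := by
    refine (norm_add_le _ _).trans (le_of_eq ?_)
    rw [norm_smul, norm_smul, PolytopicMesh.nrm, PolytopicMesh.nrm, norm_normal _ hd,
      norm_normal _ hd, mul_one, mul_one, Real.norm_eq_abs, Real.norm_eq_abs]
  refine (pow_le_pow_left₀ (norm_nonneg _) h1 2).trans ?_
  rw [← sq_abs (w i F.1 x), ← sq_abs (w i' F'.1 x)]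
  nlinarith [sq_nonneg (|w i F.1 x| - |w i' F'.1 x|)]

theorem norm_jumpBd_sq (hd : 1 ≤ d) (i : Fin M.N) (F : Fin (M.n i) × Fin (d + 1)) (x : E d) :
    ‖M.jumpBd w i F x‖ ^ 2 = w i F.1 x ^ 2 := by
  rw [PolytopicMesh.jumpBd, norm_smul, PolytopicMesh.nrm, norm_normal _ hd, mul_one,
    Real.norm_eq_abs, sq_abs]

theorem penaltyForm_self_le (hM : Admissible M c Cstar Csh χ) (hd : 1 ≤ d) (hk : 1 ≤ k)
    (hC : 0 < Cstar) (hχ : 0 < χ) (hw : w ∈ M.BP k) :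
    c.penaltyForm k Cstar w w ≤ ∑ i, ∑ F ∈ M.bdFaces i,
      ∫ x in M.face i F, 2 * c.penBound k Cstar χ i F.1 * w i F.1 x ^ 2 ∂μHE[d - 1] := by
  set q : PolytopicMesh.BdFun M := fun i F x => 2 * c.penBound k Cstar χ i F.1 * w i F.1 x ^ 2
    with hq
  have hP := c.penBound_nonneg hk hC hχ
  have hq0 : ∀ i F x, 0 ≤ q i F x := fun i F x => by have := hP i F.1; positivity
  have hqb : ∀ i, ∀ F ∈ M.bdFaces i,
      BddMeas ((μHE[d - 1] : Measure (E d)).restrict (M.face i F)) (q i F) := fun i F _ =>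
    BddMeas.of_continuous (isCompact_facet _ _)
      (((continuous_of_mem_polys (hw i F.1)).pow 2).const_mul _)
  have hqs : PolytopicMesh.SkelBdd M (fun i F i' F' x => q i F x + q i' F' x) q :=
    ⟨fun i i' F hF F' hF' => (bddMeas_piece_left (hqb i F hF)).add
      (bddMeas_piece_right (hqb i' F' hF')), fun i F hF => bddMeas_piece_bd (hqb i F hF)⟩
  refine le_trans ?_ (PolytopicMesh.skeletonIntegral_one_sided_le hd hq0 hqb)
  rw [penaltyForm_eq]
  refine PolytopicMesh.skeletonIntegral_mono hd (skelBdd_pen Cstar hw hw) hqs ?_ ?_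
  · intro i i' hi F hF F' hF'
    -- On pieces of measure zero the mesh assumptions give no comparison of the penalties, but
    -- nothing has to be shown there.
    by_cases h0 : μHE[d - 1] (M.face i F ∩ M.face i' F' ∩ M.Ω) = 0
    · rw [Measure.restrict_eq_zero.2 h0, ae_zero]
      exact eventually_bot
    · refine Eventually.of_forall fun x => ?_
      have h1 := c.σ_le_penBound hM hd hk hC hχ hi hF h0
      have h2 : c.σ k Cstar i i' ≤ c.penBound k Cstar χ i' F'.1 := by
        rw [σ_comm]
        refine c.σ_le_penBound hM hd hk hC hχ hi.symm hF' (F' := F) ?_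
        rwa [Set.inter_comm (M.face i' F')]
      have h3 := norm_jump_sq_le (w := w) hd i F i' F' x
      have h4 : 0 ≤ c.σ k Cstar i i' := mul_nonneg (penFactor_nonneg hk hC)
        ((c.δ_div_nonneg i).trans (le_max_left _ _))
      simp only [penFun, real_inner_self_eq_norm_sq]
      have h5 := mul_le_mul_of_nonneg_right h1 (sq_nonneg (w i F.1 x))
      have h6 := mul_le_mul_of_nonneg_right h2 (sq_nonneg (w i' F'.1 x))
      have h7 := mul_le_mul_of_nonneg_left h3 h4
      linarith
  · intro i F hF x
    simp only [penBd, real_inner_self_eq_norm_sq, norm_jumpBd_sq hd]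
    have h1 := c.σBd_le_penBound hM hd hk hC hχ i F.1
    have h5 := mul_le_mul_of_nonneg_right h1 (sq_nonneg (w i F.1 x))
    have := mul_nonneg (hP i F.1) (sq_nonneg (w i F.1 x))
    linarith

/-- The constant in the bound of the volume part. -/
noncomputable def nodeConst (d k : ℕ) (B : ℝ) : ℝ := ballVol d * ((nodeIdx d k).card * B ^ 2)

theorem nodeConst_nonneg (B : ℝ) : 0 ≤ nodeConst d k B :=
  mul_nonneg ENNReal.toReal_nonneg (by positivity)

theorem inv_le_of_shape {h ρ : ℝ} (hh : 0 < h) (hρ : 0 < ρ) (hs : h ≤ Csh * ρ) :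
    ρ⁻¹ ≤ Csh * h⁻¹ := by
  rw [← div_eq_mul_inv, inv_le_iff_one_le_mul₀ hρ]
  rw [div_mul_eq_mul_div, le_div_iff₀ hh, one_mul]
  exact hs

theorem weight_eq (i : Fin M.N) (t : Fin (M.n i)) :
    c.weight i t = c.patchNorm i * M.h i t ^ (d - 2)
      + supNorm c.μ (body (M.T i t)) * M.h i t ^ d := rfl

theorem volTerm_le (hM : Admissible M c Cstar Csh χ) (hd : 2 ≤ d) (hk : 1 ≤ k)
    {B : ℝ} (hB : ∀ a ∈ nodeIdx d k, ∀ y ∈ Set.Icc (0 : Fin (d + 1) → ℝ) 1,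
      |lagrangeBary d k a y| ≤ B ∧ ‖fderiv ℝ (lagrangeBary d k a) y‖ ≤ B)
    (hw : w ∈ M.BP k) (i : Fin M.N) (t : Fin (M.n i)) :
    c.volTerm w i t ≤ nodeConst d k B * (Csh ^ 2 + 1) *
      (c.weight i t * nodalSq (M.T i t) k (w i t)) := by
  have hd1 : 1 ≤ d := by omega
  obtain ⟨z, ρ, hρ, hz, hs⟩ := hM.shape i t
  have hh := hM.h_pos hd1 i t
  have hinv := inv_le_of_shape hh hρ hs
  set N := nodalSq (M.T i t) k (w i t)
  have hN : 0 ≤ N := nodalSq_nonneg _ _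
  set A : ℝ := (nodeIdx d k).card * B ^ 2 with hA
  have hA0 : 0 ≤ A := by positivity
  set m := supNorm c.μ (body (M.T i t)) with hm
  have hm0 : 0 ≤ m := supNorm_nonneg
  have hP0 := c.patchNorm_nonneg i
  obtain ⟨Bμ, hBμ⟩ := c.exists_bound_μ
  have hle : ∀ᵐ x ∂volume.restrict (body (M.T i t)),
      c.volIntegrand w w i t x ≤ c.patchNorm i * (A * (ρ⁻¹) ^ 2 * N) + m * (A * N) := by
    filter_upwards [ae_mono (M.restrict_body_le i t) (c.ae_norm_D_le i),
      ae_norm_le_supNorm (ae_mono (M.restrict_body_le i t) (hBμ i)),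
      ae_restrict_mem (isCompact_body (M.T i t)).measurableSet] with x hD hμ hx
    have g1 := norm_gradient_sq_le_nodalSq hk (hw i t) (fun a ha y hy => (hB a ha y hy).2) hρ hz hx
    have g2 := sq_le_nodalSq hk (hw i t) (fun a ha y hy => (hB a ha y hy).1) hx
    refine add_le_add ?_ ?_
    · refine (real_inner_le_norm _ _).trans ?_
      have h1 := norm_toEuclideanCLM_apply_le (c.D x) (∇ (w i t) x)
      calc _ ≤ (‖c.D x‖ * ‖∇ (w i t) x‖) * ‖∇ (w i t) x‖ :=
            mul_le_mul_of_nonneg_right h1 (norm_nonneg _)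
        _ = ‖c.D x‖ * ‖∇ (w i t) x‖ ^ 2 := by ring
        _ ≤ _ := mul_le_mul (hD.trans (c.supNorm_le_patchNorm (self_mem_neighbours i))) g1
            (sq_nonneg _) hP0
    · rw [mul_assoc, ← sq]
      exact mul_le_mul ((le_abs_self _).trans hμ) g2 (sq_nonneg _) hm0
  have h1 : c.volTerm w i t ≤ ∫ _ in body (M.T i t),
      (c.patchNorm i * (A * (ρ⁻¹) ^ 2 * N) + m * (A * N)) := by
    refine integral_mono_ae (integrableOn_volIntegrand hw hw i t) ?_ hle
    exact integrableOn_const (volume_body_ne_top _)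
  rw [setIntegral_const, smul_eq_mul, measureReal_def] at h1
  have hV := volume_body_le (M.T i t)
  have hω : 0 ≤ ballVol d := ENNReal.toReal_nonneg
  set H := M.h i t with hHdef
  change _ ≤ ballVol d * H ^ d at hV
  have hρ2 : (ρ⁻¹) ^ 2 ≤ Csh ^ 2 * (H⁻¹) ^ 2 := by
    rw [← mul_pow]
    exact pow_le_pow_left₀ (by positivity) hinv 2
  -- Two powers of the diameter cancel the `H⁻¹ ^ 2` of the gradient bound; the exponent `d - 2` is
  -- a true difference since `2 ≤ d`.
  have e : H ^ d = H ^ 2 * H ^ (d - 2) := by rw [← pow_add]; congr 1; omega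
  calc c.volTerm w i t ≤ _ := h1
    _ ≤ (ballVol d * H ^ d) * (c.patchNorm i * (A * (Csh ^ 2 * (H⁻¹) ^ 2) * N) + m * (A * N)) := by
        refine mul_le_mul hV ?_ (by positivity) (by positivity)
        gcongr
    _ = (ballVol d * A) * N * (Csh ^ 2 * (c.patchNorm i * H ^ (d - 2)) + m * H ^ d) := by
        rw [e]; field_simp
    _ ≤ (ballVol d * A) * N * ((Csh ^ 2 + 1) * (c.patchNorm i * H ^ (d - 2) + m * H ^ d)) := by
        refine mul_le_mul_of_nonneg_left ?_ (by positivity)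
        have h2 : 0 ≤ c.patchNorm i * H ^ (d - 2) := by positivity
        have h3 : 0 ≤ m * H ^ d := by positivity
        nlinarith [sq_nonneg Csh]
    _ = _ := by rw [weight_eq, nodeConst, ← hA, ← hm, ← hHdef]; ring

theorem integral_penBound_face_le (hM : Admissible M c Cstar Csh χ) (hd : 2 ≤ d) (hk : 1 ≤ k)
    (hC : 0 < Cstar) (hχ : 0 < χ) (hCsh : 0 < Csh)
    {B : ℝ} (hB : ∀ a ∈ nodeIdx d k, ∀ y ∈ Set.Icc (0 : Fin (d + 1) → ℝ) 1,
      |lagrangeBary d k a y| ≤ B)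
    (hw : w ∈ M.BP k) (i : Fin M.N) (F : Fin (M.n i) × Fin (d + 1)) :
    ∫ x in M.face i F, 2 * c.penBound k Cstar χ i F.1 * w i F.1 x ^ 2 ∂μHE[d - 1] ≤
      2 * penFactor d k Cstar * χ * d * Csh * nodeConst d k B *
      (c.weight i F.1 * nodalSq (M.T i F.1) k (w i F.1)) := by
  have hd1 : 1 ≤ d := by omega
  obtain ⟨z, ρ, hρ, hz, hs⟩ := hM.shape i F.1
  have hh := hM.h_pos hd1 i F.1
  have hinv := inv_le_of_shape hh hρ hs
  set N := nodalSq (M.T i F.1) k (w i F.1)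
  have hN : 0 ≤ N := nodalSq_nonneg _ _
  set A : ℝ := (nodeIdx d k).card * B ^ 2 with hA
  have hA0 : 0 ≤ A := by positivity
  have hP0 := c.patchNorm_nonneg i
  have hpb := c.penBound_nonneg (k := k) hk hC hχ i F.1
  have hpf := penFactor_nonneg (d := d) hk hC
  have h1 : ∫ x in M.face i F, 2 * c.penBound k Cstar χ i F.1 * w i F.1 x ^ 2 ∂μHE[d - 1] ≤
      ∫ _ in M.face i F, 2 * c.penBound k Cstar χ i F.1 * (A * N) ∂μHE[d - 1] := by
    refine setIntegral_mono_on (PolytopicMesh.integrableOn_face_of_continuous hd1 i F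
      (((continuous_of_mem_polys (hw i F.1)).pow 2).const_mul _))
      (integrableOn_const (PolytopicMesh.hausdorff_face_ne_top hd1 i F))
      (PolytopicMesh.measurableSet_face i F) fun x hx => ?_
    exact mul_le_mul_of_nonneg_left (sq_le_nodalSq hk (hw i F.1) hB (M.face_subset_body i F hx))
      (by positivity)
  rw [setIntegral_const, smul_eq_mul, measureReal_def] at h1
  have hV := hausdorff_facet_le hd1 (M.T i F.1) F.2 hρ hz
  have hω : 0 ≤ ballVol d := ENNReal.toReal_nonneg
  set H := M.h i F.1 with hHdef
  change (μHE[d - 1] (M.face i F)).toReal ≤ d * ρ⁻¹ * (ballVol d * H ^ d) at hV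
  have e : H ^ d = H ^ 2 * H ^ (d - 2) := by rw [← pow_add]; congr 1; omega
  have hm0 : 0 ≤ supNorm c.μ (body (M.T i F.1)) := supNorm_nonneg
  refine h1.trans ?_
  calc _ ≤ (d * (Csh * H⁻¹) * (ballVol d * H ^ d)) * (2 * c.penBound k Cstar χ i F.1 * (A * N)) := by
        refine mul_le_mul_of_nonneg_right (hV.trans ?_) (by positivity)
        gcongr
    _ = 2 * penFactor d k Cstar * χ * d * Csh * (ballVol d * A) *
          ((c.patchNorm i * H ^ (d - 2)) * N) := by
        rw [e, penBound, ← hHdef]; field_simp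
    _ ≤ _ := by
        rw [weight_eq, nodeConst, ← hA, ← hHdef]
        refine mul_le_mul_of_nonneg_left (mul_le_mul_of_nonneg_right ?_ hN) (by positivity)
        have : 0 ≤ supNorm c.μ (body (M.T i F.1)) * H ^ d := by positivity
        linarith

theorem nodeTerm_eq (w : M.Broken) (i : Fin M.N) : c.nodeTerm k w i =
    ∑ t, c.weight i t * nodalSq (M.T i t) k (w i t) := by
  unfold nodeTerm nodalSq
  refine Finset.sum_congr rfl fun t _ => ?_
  rw [Finset.mul_sum]
  exact Finset.sum_congr rfl fun a _ => by ring

theorem exists_isEquivConst (hd : 2 ≤ d) (hk : 1 ≤ k) (hC : 0 < Cstar) (hCsh : 0 < Csh)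
    (hχ : 0 < χ) : ∃ C : ℝ, 0 < C ∧ ∀ (M : PolytopicMesh d) (c : Coeff M),
      Admissible M c Cstar Csh χ → c.IsEquivConst k Cstar C := by
  -- All constants are fixed before the mesh and the coefficients are introduced, which gives the
  -- required uniformity.
  obtain ⟨B, -, hB⟩ := exists_lagrangeBary_bound d k
  set C₁ := nodeConst d k B * (Csh ^ 2 + 1) with hC₁
  set C₂ := 2 * penFactor d k Cstar * χ * d * Csh * nodeConst d k B with hC₂
  have hn := nodeConst_nonneg (d := d) (k := k) B
  have hpf := penFactor_nonneg (d := d) hk hC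
  have h₁ : 0 ≤ C₁ := by positivity
  have h₂ : 0 ≤ C₂ := by positivity
  -- The factor `d + 1` counts the facets of a simplex; the summand 1 only ensures positivity.
  refine ⟨C₁ + (d + 1) * C₂ + 1, by positivity, fun M c hM w hw => ?_⟩
  have hwB := PolytopicMesh.WT_subset_BP hw
  rw [c.dgNorm_sq hk hC, stab_self, volumeForm_self]
  have hpen := c.penaltyForm_self_le hM (by omega) hk hC hχ hwB
  have hvol : ∑ i, ∑ t, c.volTerm w i t ≤ C₁ * ∑ i, c.nodeTerm k w i := by
    rw [Finset.mul_sum]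
    refine Finset.sum_le_sum fun i _ => ?_
    rw [nodeTerm_eq, Finset.mul_sum]
    exact Finset.sum_le_sum fun t _ => c.volTerm_le hM hd hk hB hwB i t
  have hpen2 : ∑ i, ∑ F ∈ M.bdFaces i,
      ∫ x in M.face i F, 2 * c.penBound k Cstar χ i F.1 * w i F.1 x ^ 2 ∂μHE[d - 1] ≤
      ((d + 1) * C₂) * ∑ i, c.nodeTerm k w i := by
    rw [Finset.mul_sum]
    refine Finset.sum_le_sum fun i _ => ?_
    refine (Finset.sum_le_sum fun F _ => c.integral_penBound_face_le hM hd hk hC hχ hCsh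
      (fun a ha y hy => (hB a ha y hy).1) hwB i F).trans ?_
    refine (Finset.sum_le_sum_of_subset_of_nonneg (Finset.subset_univ _) fun F _ _ =>
      mul_nonneg h₂ (mul_nonneg (c.weight_nonneg i F.1) (nodalSq_nonneg _ _))).trans (le_of_eq ?_)
    rw [Fintype.sum_prod_type, nodeTerm_eq, Finset.mul_sum]
    refine Finset.sum_congr rfl fun t _ => ?_
    simp only [Finset.sum_const, Finset.card_univ, Fintype.card_fin, nsmul_eq_mul]
    push_cast
    ring
  simp only [one_mul]
  have hs : 0 ≤ ∑ i, c.nodeTerm k w i := Finset.sum_nonneg fun i _ => c.nodeTerm_nonneg w i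
  calc _ ≤ C₁ * ∑ i, c.nodeTerm k w i + ((d + 1) * C₂) * ∑ i, c.nodeTerm k w i :=
        add_le_add hvol (hpen.trans hpen2)
    _ ≤ _ := by rw [← add_mul]; exact mul_le_mul_of_nonneg_right (by linarith) hs

end Coeff


/-! ### Generic boundary points, and functions without jumps. -/

section Generic

variable {d : ℕ}

theorem volume_affineMap_eq_zero (f : E d →ᵃ[ℝ] ℝ) {y : E d} (hy : f y ≠ 0) :
    volume {x : E d | f x = 0} = 0 := by
  let S : AffineSubspace ℝ (E d) := (AffineSubspace.mk' (0 : ℝ) ⊥).comap f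
  have hS : (S : Set (E d)) = {x : E d | f x = 0} := by
    ext x
    simp [S, AffineSubspace.mem_mk']
  rw [← hS]
  refine Measure.addHaar_affineSubspace _ _ fun h => ?_
  have : y ∈ (S : Set (E d)) := by rw [h]; trivial
  rw [hS] at this
  exact hy this

theorem exists_mem_avoiding {ι : Type*} [Countable ι] {U : Set (E d)} (hU : IsOpen U)
    (hne : U.Nonempty) (f : ι → E d →ᵃ[ℝ] ℝ) (hf : ∀ i, ∃ y, f i y ≠ 0) :
    ∃ x ∈ U, ∀ i, f i x ≠ 0 := by
  have h0 : volume (⋃ i, {x : E d | f i x = 0}) = 0 :=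
    measure_iUnion_null fun i => by
      obtain ⟨y, hy⟩ := hf i
      exact volume_affineMap_eq_zero (f i) hy
  have h1 : (U \ ⋃ i, {x : E d | f i x = 0}).Nonempty := by
    by_contra h
    exact (hU.measure_pos volume hne).ne'
      (measure_mono_null (fun x hx => by_contra fun hx' => h ⟨x, hx, hx'⟩) h0)
  obtain ⟨x, hx, hx'⟩ := h1
  refine ⟨x, hx, fun i hi => hx' (Set.mem_iUnion.2 ⟨i, hi⟩)⟩

/-- The combination `λ_l(q) λ_j - λ_j(q) λ_l` vanishes at `q`, so on the line it equals `1 - s`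
times its nonzero value at `p`; it would vanish wherever both coordinates do. -/
theorem coord_ne_zero_on_segment (T : Simplex d) {p q : E d} {j l : Fin (d + 1)}
    (h : T.coord l q * T.coord j p - T.coord j q * T.coord l p ≠ 0) {s : ℝ} (hs : s ≠ 1) :
    ¬ (T.coord j (AffineMap.lineMap p q s) = 0 ∧ T.coord l (AffineMap.lineMap p q s) = 0) := by
  rintro ⟨h1, h2⟩
  rw [AffineMap.apply_lineMap, AffineMap.lineMap_apply_module] at h1 h2
  simp only [smul_eq_mul] at h1 h2
  have h3 : (1 - s) * (T.coord l q * T.coord j p - T.coord j q * T.coord l p) = 0 := by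
    linear_combination T.coord l q * h1 - T.coord j q * h2
  rcases mul_eq_zero.1 h3 with h4 | h4
  · exact hs (by linarith)
  · exact h h4

theorem mem_relFacet_of_generic {T : Simplex d} {x : E d} (hx : x ∈ body T)
    (hx' : x ∉ interior (body T))
    (hg : ∀ j l, j ≠ l → ¬ (T.coord j x = 0 ∧ T.coord l x = 0)) : ∃ j, x ∈ relFacet T j := by
  rw [mem_body] at hx
  rw [mem_interior_body] at hx'
  push Not at hx'
  obtain ⟨j, hj⟩ := hx'
  have hj0 := le_antisymm hj (hx j)
  exact ⟨j, hj0, fun i hi => lt_of_le_of_ne (hx i) fun h => hg i j hi ⟨h.symm, hj0⟩⟩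

/-- The last parameter in `[0, 1]` for which the segment is in `U`. -/
theorem exists_exit_point {p q : E d} {U : Set (E d)} (hU : IsCompact U) (hp : p ∈ U)
    (hq : q ∉ U) : ∃ s : ℝ, s ≠ 1 ∧ AffineMap.lineMap p q s ∈ U ∧
      AffineMap.lineMap p q s ∉ interior U := by
  have hc : Continuous fun s : ℝ => (AffineMap.lineMap p q s : E d) := AffineMap.lineMap_continuous
  set S : Set ℝ := Set.Icc 0 1 ∩ (fun s : ℝ => (AffineMap.lineMap p q s : E d)) ⁻¹' U
  have hS : IsCompact S := isCompact_Icc.inter_right (hU.isClosed.preimage hc)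
  have h0 : (0 : ℝ) ∈ S := ⟨by simp, by simpa using hp⟩
  obtain ⟨s, ⟨hs1, hs2⟩, hs3⟩ := hS.exists_isGreatest ⟨0, h0⟩
  have hne : s ≠ 1 := by
    rintro rfl
    exact hq (by simpa using hs2)
  refine ⟨s, hne, hs2, fun hi => ?_⟩
  have h1 : ∀ᶠ r in 𝓝 s, (AffineMap.lineMap p q r : E d) ∈ U :=
    hc.continuousAt.eventually (mem_interior_iff_mem_nhds.1 hi)
  have h2 : ∀ᶠ r in 𝓝 s, r < 1 := eventually_lt_nhds (lt_of_le_of_ne hs1.2 hne)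
  obtain ⟨r, ⟨hr1, hr2⟩, hr3⟩ :=
    (((h1.and h2).filter_mono nhdsWithin_le_nhds).and
      (self_mem_nhdsWithin (s := Set.Ioi s))).exists
  have hr3' : s < r := hr3
  exact absurd (hs3 ⟨⟨hs1.1.trans hr3'.le, hr2.le⟩, hr1⟩) (not_le.2 hr3')

end Generic

namespace PolytopicMesh

variable {d : ℕ} {M : PolytopicMesh d}

/-- A union of elements has a point on its boundary in the relative interior of a facet, which lies
on no simplex of the mesh in codimension two. -/
theorem exists_generic_boundary_point (hd : 1 ≤ d) {I : Set (Fin M.N)} {i₀ : Fin M.N}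
    (hi₀ : i₀ ∈ I) (t₀ : Fin (M.n i₀)) :
    ∃ i ∈ I, ∃ F, ∃ x ∈ M.relFace i F, x ∉ interior (⋃ i ∈ I, M.K i) ∧
      ∀ i' t' j l, j ≠ l →
        ¬ ((M.T i' t').coord j x = 0 ∧ (M.T i' t').coord l x = 0) := by
  set U : Set (E d) := ⋃ i ∈ I, M.K i with hUdef
  have hU : IsCompact U := I.toFinite.isCompact_biUnion fun i _ => M.isCompact_K i
  have : Nonempty (Fin d) := ⟨⟨0, hd⟩⟩
  have : Nontrivial (E d) := inferInstance
  have : NoncompactSpace (E d) := NormedSpace.noncompactSpace ℝ (E d)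
  have hUc : Uᶜ.Nonempty := by
    rw [Set.nonempty_compl]
    exact fun h => noncompact_univ (E d) (h ▸ hU)
  -- The end point `q` avoids all facet planes. The starting point `p` can then avoid the planes
  -- spanned by `q` and a face of codimension two, so that the segment meets no such face.
  obtain ⟨q, hqU, hq⟩ := exists_mem_avoiding hU.isClosed.isOpen_compl hUc
    (fun m : (Σ i : Fin M.N, Fin (M.n i)) × Fin (d + 1) => (M.T m.1.1 m.1.2).coord m.2)
    fun m => ⟨M.T m.1.1 m.1.2 m.2, by simp⟩
  obtain ⟨p, hp, hpg⟩ := exists_mem_avoiding (isOpen_interior (s := body (M.T i₀ t₀)))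
    (interior_body_nonempty _)
    (fun m : (Σ i : Fin M.N, Fin (M.n i)) × {jl : Fin (d + 1) × Fin (d + 1) // jl.1 ≠ jl.2} =>
      (M.T m.1.1 m.1.2).coord m.2.1.2 q • (M.T m.1.1 m.1.2).coord m.2.1.1 -
        (M.T m.1.1 m.1.2).coord m.2.1.1 q • (M.T m.1.1 m.1.2).coord m.2.1.2)
    fun m => ⟨M.T m.1.1 m.1.2 m.2.1.1, by
      simpa [AffineBasis.coord_apply_ne _ m.2.2.symm] using hq (m.1, m.2.1.2)⟩
  have hpU : p ∈ U := Set.mem_biUnion hi₀ (M.body_subset_K i₀ t₀ (_root_.interior_subset hp))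
  obtain ⟨s, hs, hxU, hxi⟩ := exists_exit_point hU hpU hqU
  set x : E d := AffineMap.lineMap p q s
  have hg : ∀ i' t' j l, j ≠ l →
      ¬ ((M.T i' t').coord j x = 0 ∧ (M.T i' t').coord l x = 0) := fun i' t' j l hjl =>
    coord_ne_zero_on_segment (M.T i' t') (by simpa using hpg (⟨i', t'⟩, ⟨(j, l), hjl⟩)) hs
  obtain ⟨i, hi, hxK⟩ := Set.mem_iUnion₂.1 hxU
  obtain ⟨t, ht⟩ := Set.mem_iUnion.1 hxK
  obtain ⟨j, hj⟩ := mem_relFacet_of_generic ht (fun h => hxi (interior_mono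
    ((M.body_subset_K i t).trans (Set.subset_biUnion_of_mem (u := fun i => M.K i) hi)) h))
    (hg i t)
  exact ⟨i, hi, (t, j), x, hj, hxi, hg⟩

theorem notMem_interior_K {i i' : Fin M.N} (h : i ≠ i') {t : Fin (M.n i)} {x : E d}
    (hx : x ∈ body (M.T i t)) : x ∉ interior (M.K i') := by
  intro hi
  have h1 : x ∈ closure (interior (body (M.T i t))) := by
    have := (convex_convexHull ℝ (Set.range (M.T i t))).closure_interior_eq_closure_of_nonempty_interior
      (interior_body_nonempty (M.T i t))
    rw [body, this]
    exact subset_closure hx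
  obtain ⟨y, hy1, hy2⟩ := mem_closure_iff.1 h1 _ isOpen_interior hi
  exact Set.disjoint_left.1 (M.interior_disjoint i i' h) (interior_mono (M.body_subset_K i t) hy2) hy1

/-- An elementwise constant function without jumps that vanishes on the boundary is zero. -/
theorem eq_zero_of_no_jumps (hd : 1 ≤ d) (b : Fin M.N → ℝ) (hn : ∀ i, Nonempty (Fin (M.n i)))
    (hjump : ∀ i i', i ≠ i' → ∀ F ∈ M.bdFaces i, ∀ F' ∈ M.bdFaces i',
      μHE[d - 1] (M.face i F ∩ M.face i' F' ∩ M.Ω) ≠ 0 → b i = b i')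
    (hbd : ∀ i, ∀ F ∈ M.bdFaces i, μHE[d - 1] (M.face i F ∩ frontier M.Ω) ≠ 0 → b i = 0) :
    b = 0 := by
  funext i₀
  by_contra h0
  obtain ⟨t₀⟩ := hn i₀
  -- If the value `b i₀` is nonzero, the union of the elements carrying it has a generic boundary
  -- point `x`. Across the facet at `x` there is either an element with the same value, making `x`
  -- interior, or part of `∂Ω`, where the value is zero.
  set I : Set (Fin M.N) := {i | b i = b i₀} with hI
  obtain ⟨i, hi, F, x, hxF, hxU, hg⟩ := exists_generic_boundary_point hd (I := I) (i₀ := i₀) rfl t₀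
  have hbi : b i = b i₀ := hi
  have hbi0 : b i ≠ 0 := by rw [hbi]; exact h0
  have hKU : ∀ {i}, b i = b i₀ → M.K i ⊆ ⋃ i ∈ I, M.K i := fun {i} h =>
    Set.subset_biUnion_of_mem (u := fun i => M.K i) (show i ∈ I from h)
  have hxT : x ∈ body (M.T i F.1) := M.relFace_subset_body i F hxF
  have hxK : x ∈ M.K i := M.body_subset_K i F.1 hxT
  have hxfr : x ∈ frontier (M.K i) :=
    ⟨subset_closure hxK, fun h => hxU (interior_mono (hKU hbi) h)⟩
  have hF : F ∈ M.bdFaces i := mem_bdFaces_of_mem_relFace hd hxfr hxF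
  have hclos : M.face i F ⊆ closure M.Ω := by
    rw [M.closure_Ω]
    exact (M.face_subset_body i F).trans ((M.body_subset_K i F.1).trans
      (Set.subset_iUnion (fun i => M.K i) i))
  by_cases hother : ∃ i' t', (⟨i', t'⟩ : Σ i, Fin (M.n i)) ≠ ⟨i, F.1⟩ ∧ x ∈ body (M.T i' t')
  · obtain ⟨i', t', hne, hx'⟩ := hother
    have hii : i ≠ i' := by
      rintro rfl
      exact hne (by rw [eq_of_mem_body_of_mem_relFace hd hxfr hxF hxF hx'])
    have hdisj := M.disjoint_of_ne hii F.1 t'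
    obtain ⟨j', hj'⟩ := mem_relFacet_of_generic hx'
      (notMem_interior_of_mem_relFacet hdisj.symm hxT) (hg i' t')
    set F' : Fin (M.n i') × Fin (d + 1) := (t', j') with hF'def
    have hxF' : x ∈ M.relFace i' F' := hj'
    have hF' : F' ∈ M.bdFaces i' := mem_bdFaces_of_mem_relFace hd
      ⟨subset_closure (M.body_subset_K i' t' hx'), notMem_interior_K hii hxT⟩ hxF'
    obtain ⟨a, -, hcoord⟩ := exists_coord_eq_neg hd hdisj hxF hj'
    obtain ⟨V, hV, hVo, hxV⟩ := eventually_nhds_iff.1 (eventually_mem_body (T := M.T i' t') hj')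
    have hsub : M.face i F ∩ V ⊆ M.face i' F' := by
      rintro y ⟨hy, hyV⟩
      have hy0 := ((mem_facet _).1 hy).1
      have hy1 : (M.T i' t').coord j' y = 0 := by rw [hcoord, hy0]; simp
      refine (mem_facet _).2 ⟨hy1, fun l => ?_⟩
      by_cases hl : l = j'
      · rw [hl]; exact hy1.ge
      · exact (hV y hyV l hl).le
    have hpos := hausdorff_facet_inter_pos (M.T i F.1) hd F.2 hVo hxF hxV
    -- Near `x` the facet consists of a piece of the interface with the other element and a piece of
    -- `∂Ω`; one of them has positive measure.
    have hcov : M.face i F ∩ V ⊆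
        (M.face i F ∩ M.face i' F' ∩ M.Ω) ∪ (M.face i F ∩ frontier M.Ω) := by
      intro y hy
      by_cases hyΩ : y ∈ M.Ω
      · exact Or.inl ⟨⟨hy.1, hsub hy⟩, hyΩ⟩
      · refine Or.inr ⟨hy.1, ?_⟩
        rw [M.isOpen_Ω.frontier_eq]
        exact ⟨hclos hy.1, hyΩ⟩
    have hpos2 := hpos.trans_le ((measure_mono hcov).trans (measure_union_le _ _))
    by_cases hz : μHE[d - 1] (M.face i F ∩ frontier M.Ω) = 0
    · rw [hz, add_zero] at hpos2
      have hb' := hjump i i' hii F hF F' hF' hpos2.ne'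
      refine hxU (mem_interior_iff_mem_nhds.2 ?_)
      filter_upwards [eventually_mem_union hd hdisj hxF hj'] with y hy
      rcases hy with hy | hy
      · exact hKU hbi (M.body_subset_K i _ hy)
      · exact hKU (hb'.symm.trans hbi) (M.body_subset_K i' _ hy)
    · exact hbi0 (hbd i F hF hz)
  · push Not at hother
    set V : Set (E d) := ⋂ m : {m : Σ i, Fin (M.n i) // m ≠ ⟨i, F.1⟩},
      (body (M.T m.1.1 m.1.2))ᶜ with hVdef
    have hVo : IsOpen V := isOpen_iInter_of_finite fun m =>
      (isCompact_body _).isClosed.isOpen_compl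
    have hxV : x ∈ V := Set.mem_iInter.2 fun m => hother m.1.1 m.1.2 m.2
    have hpos := hausdorff_facet_inter_pos (M.T i F.1) hd F.2 hVo hxF hxV
    suffices h : M.face i F ∩ V ⊆ M.face i F ∩ frontier M.Ω from
      hbi0 (hbd i F hF (hpos.trans_le (measure_mono h)).ne')
    refine fun y hy => ⟨hy.1, ?_⟩
    rw [M.isOpen_Ω.frontier_eq]
    refine ⟨hclos hy.1, fun hyΩ => ?_⟩
    -- If `y` were in `Ω`, a neighbourhood of it in `Ω` would be covered by this simplex alone, but
    -- `y` lies on one of its facets.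
    have hyi : y ∈ interior (body (M.T i F.1)) := by
      refine mem_interior.2 ⟨M.Ω ∩ V, fun w hw => ?_, M.isOpen_Ω.inter hVo, hyΩ, hy.2⟩
      have hw1 : w ∈ closure M.Ω := subset_closure hw.1
      rw [M.closure_Ω] at hw1
      obtain ⟨i', hw1⟩ := Set.mem_iUnion.1 hw1
      obtain ⟨t', hw1⟩ := Set.mem_iUnion.1 hw1
      by_cases hm : (⟨i', t'⟩ : Σ i, Fin (M.n i)) = ⟨i, F.1⟩
      · obtain ⟨rfl, hm⟩ := Sigma.mk.inj hm
        rwa [eq_of_heq hm] at hw1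
      · exact absurd hw1 (Set.mem_iInter.1 hw.2 ⟨⟨i', t'⟩, hm⟩)
    exact absurd ((mem_facet _).1 hy.1).1 ((mem_interior_body _).1 hyi F.2).ne'

end PolytopicMesh


/-! ### Definiteness of the DG-norm on elementwise polynomials. -/

section Vanishing

variable {d k : ℕ} {p : E d → ℝ}

theorem eqOn_interior_of_setIntegral_eq_zero {S : Set (E d)} (hS : IsCompact S) {g : E d → ℝ}
    (hg : Continuous g) (h0 : ∀ x, 0 ≤ g x) (h : ∫ x in S, g x = 0) :
    ∀ x ∈ interior S, g x = 0 := by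
  rw [setIntegral_eq_zero_iff_of_nonneg_ae (Eventually.of_forall h0)
    (hg.continuousOn.integrableOn_compact hS)] at h
  have h1 : g =ᵐ[volume.restrict (interior S)] fun _ => (0 : ℝ) :=
    ae_mono (Measure.restrict_mono_set _ interior_subset) h
  exact Measure.eqOn_open_of_ae_eq h1 isOpen_interior hg.continuousOn continuousOn_const

theorem eq_const_of_gradient_eq_zero (hp : p ∈ polys d k) {U : Set (E d)} (hU : IsOpen U)
    (hne : U.Nonempty) (h : ∀ x ∈ U, ‖∇ p x‖ ^ 2 = 0) (x : E d) : p x = p 0 := by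
  have h1 : ∀ j, (fun x => (∇ p x) j) = 0 := fun j =>
    eq_zero_of_mem_polys_of_eqOn_open (gradient_apply_mem_polys hp j) hU hne fun x hx => by
      have := norm_eq_zero.1 (pow_eq_zero_iff two_ne_zero |>.1 (h x hx))
      rw [this]
      rfl
  have h2 : ∀ x, fderiv ℝ p x = 0 := fun x => by
    rw [← norm_eq_zero, ← norm_gradient, norm_eq_zero]
    ext j
    exact congrFun (h1 j) x
  exact is_const_of_fderiv_eq_zero (differentiable_of_mem_polys hp) h2 x 0

end Vanishing

namespace Coeff

open PolytopicMesh

variable {d k : ℕ} {M : PolytopicMesh d} (c : Coeff M) {Cstar Csh χ : ℝ}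

theorem nonempty_simplices (hM : Admissible M c Cstar Csh χ) (i : Fin M.N) :
    Nonempty (Fin (M.n i)) := by
  by_contra h
  rw [not_nonempty_iff] at h
  refine hM.volume_K_ne_zero i ?_
  rw [PolytopicMesh.K, Set.iUnion_of_empty, measure_empty]

theorem eq_const_of_volumeForm_eq_zero (hM : Admissible M c Cstar Csh χ)
    {v : Fin M.N → E d → ℝ} (hv : v ∈ M.VP k)
    (h : c.volumeForm (M.toBroken v) (M.toBroken v) = 0) (i : Fin M.N) (x : E d) :
    v i x = v i 0 := by
  obtain ⟨t⟩ := c.nonempty_simplices hM i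
  have h1 : c.volTerm (M.toBroken v) i t = 0 := by
    rw [volumeForm_self, Finset.sum_eq_zero_iff_of_nonneg fun i _ =>
      Finset.sum_nonneg fun t _ => c.volTerm_nonneg _ i t] at h
    have := h i (Finset.mem_univ i)
    rw [Finset.sum_eq_zero_iff_of_nonneg fun t _ => c.volTerm_nonneg _ i t] at this
    exact this t (Finset.mem_univ t)
  have h2 := c.integral_gradient_body_le (toBroken_mem_BP hv) i t
  rw [h1, mul_zero] at h2
  have h3 := eqOn_interior_of_setIntegral_eq_zero (isCompact_body (M.T i t))
    ((continuous_gradient_of_mem (mem_VP.1 hv i)).norm.pow 2) (fun _ => sq_nonneg _)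
    (le_antisymm h2 (integral_nonneg fun _ => sq_nonneg _))
  exact eq_const_of_gradient_eq_zero (mem_VP.1 hv i) isOpen_interior (interior_body_nonempty _) h3 x

theorem skeletonIntegral_eq_zero {g : SkelFun M} {b : BdFun M}
    (hg : ∀ i i' F F' x, 0 ≤ g i F i' F' x) (hb : ∀ i F x, 0 ≤ b i F x)
    (h : M.skeletonIntegral g b = 0) :
    (∀ i i', i ≠ i' → ∀ F ∈ M.bdFaces i, ∀ F' ∈ M.bdFaces i',
      ∫ x in M.face i F ∩ M.face i' F' ∩ M.Ω, g i F i' F' x ∂μHE[d - 1] = 0) ∧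
    ∀ i, ∀ F ∈ M.bdFaces i, ∫ x in M.face i F ∩ frontier M.Ω, b i F x ∂μHE[d - 1] = 0 := by
  have h1 : ∀ i i' F F', 0 ≤
      ∫ x in M.face i F ∩ M.face i' F' ∩ M.Ω, g i F i' F' x ∂μHE[d - 1] :=
    fun i i' F F' => integral_nonneg fun x => hg i i' F F' x
  have h2 : ∀ i F, 0 ≤ ∫ x in M.face i F ∩ frontier M.Ω, b i F x ∂μHE[d - 1] :=
    fun i F => integral_nonneg fun x => hb i F x
  have s1 : ∀ i i' F, 0 ≤ ∑ F' ∈ M.bdFaces i',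
      ∫ x in M.face i F ∩ M.face i' F' ∩ M.Ω, g i F i' F' x ∂μHE[d - 1] :=
    fun i i' F => Finset.sum_nonneg fun F' _ => h1 i i' F F'
  have s2 : ∀ i i', 0 ≤ ∑ F ∈ M.bdFaces i, ∑ F' ∈ M.bdFaces i',
      ∫ x in M.face i F ∩ M.face i' F' ∩ M.Ω, g i F i' F' x ∂μHE[d - 1] :=
    fun i i' => Finset.sum_nonneg fun F _ => s1 i i' F
  have s3 : ∀ i, 0 ≤ ∑ i' ∈ Finset.univ.erase i, ∑ F ∈ M.bdFaces i, ∑ F' ∈ M.bdFaces i',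
      ∫ x in M.face i F ∩ M.face i' F' ∩ M.Ω, g i F i' F' x ∂μHE[d - 1] :=
    fun i => Finset.sum_nonneg fun i' _ => s2 i i'
  have s4 := Finset.sum_nonneg fun i (_ : i ∈ Finset.univ) => s3 i
  have s5 : ∀ i, 0 ≤ ∑ F ∈ M.bdFaces i, ∫ x in M.face i F ∩ frontier M.Ω, b i F x ∂μHE[d - 1] :=
    fun i => Finset.sum_nonneg fun F _ => h2 i F
  have s6 := Finset.sum_nonneg fun i (_ : i ∈ Finset.univ) => s5 i
  unfold skeletonIntegral at h
  have e1 := le_antisymm (by linarith) s4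
  have e2 := le_antisymm (by linarith) s6
  rw [Finset.sum_eq_zero_iff_of_nonneg fun i _ => s3 i] at e1
  rw [Finset.sum_eq_zero_iff_of_nonneg fun i _ => s5 i] at e2
  refine ⟨fun i i' hi F hF F' hF' => ?_, fun i F hF => ?_⟩
  · have := e1 i (Finset.mem_univ i)
    rw [Finset.sum_eq_zero_iff_of_nonneg fun i' _ => s2 i i'] at this
    have := this i' (Finset.mem_erase.2 ⟨hi.symm, Finset.mem_univ _⟩)
    rw [Finset.sum_eq_zero_iff_of_nonneg fun F _ => s1 i i' F] at this
    have := this F hF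
    rw [Finset.sum_eq_zero_iff_of_nonneg fun F' _ => h1 i i' F F'] at this
    exact this F' hF'
  · have := e2 i (Finset.mem_univ i)
    rw [Finset.sum_eq_zero_iff_of_nonneg fun F _ => h2 i F] at this
    exact this F hF

theorem exists_mem_relFace (hd : 1 ≤ d) {i i' : Fin M.N} {F : Fin (M.n i) × Fin (d + 1)}
    {F' : Fin (M.n i') × Fin (d + 1)}
    (h : μHE[d - 1] (M.face i F ∩ M.face i' F' ∩ M.Ω) ≠ 0) :
    ∃ x, x ∈ M.relFace i F ∧ x ∈ M.relFace i' F' := by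
  by_contra hne
  push Not at hne
  refine h (measure_mono_null (t := (M.face i F \ M.relFace i F) ∪ (M.face i' F' \ M.relFace i' F'))
    ?_ (measure_union_null (hausdorff_facet_diff_relFacet _ hd _)
      (hausdorff_facet_diff_relFacet _ hd _)))
  intro x hx
  by_cases h1 : x ∈ M.relFace i F
  · exact Or.inr ⟨hx.1.2, hne x h1⟩
  · exact Or.inl ⟨hx.1.1, h1⟩

/-- The volume part makes `v` elementwise constant. Opposite normals turn the jump into a difference
of constants, so the positive penalty removes all jumps of positive measure and the boundary values.
-/
theorem eq_zero_of_dgNorm_eq_zero (hM : Admissible M c Cstar Csh χ) (hd : 1 ≤ d) (hk : 1 ≤ k)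
    (hC : 0 < Cstar) {v : Fin M.N → E d → ℝ} (hv : v ∈ M.VP k)
    (h : c.dgNorm k Cstar (M.toBroken v) = 0) : v = 0 := by
  have h1 := c.dgNorm_sq hk hC (M.toBroken v)
  rw [h, zero_pow two_ne_zero] at h1
  have hV0 := c.volumeForm_self_nonneg (M.toBroken v)
  have hP0 := c.penaltyForm_self_nonneg hk hC (M.toBroken v)
  have hconst := c.eq_const_of_volumeForm_eq_zero hM hv (by linarith)
  have hP : c.penaltyForm k Cstar (M.toBroken v) (M.toBroken v) = 0 := by linarith
  have hσ := fun i => hM.σBd_pos (k := k) hd hk hC i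
  have hσ' := fun i i' => (hσ i).trans_le (c.σBd_le_σ (k := k) hk hC i i').1
  set b : Fin M.N → ℝ := fun i => v i 0 with hb
  have hvb : ∀ i x, v i x = b i := hconst
  rw [penaltyForm_eq] at hP
  obtain ⟨hint, hbdy⟩ := skeletonIntegral_eq_zero
    (fun i i' F F' x => mul_nonneg (hσ' i i').le real_inner_self_nonneg)
    (fun i F x => mul_nonneg (hσ i).le real_inner_self_nonneg) hP
  have hzero : b = 0 := by
    refine eq_zero_of_no_jumps hd b (c.nonempty_simplices hM) ?_ ?_
    · intro i i' hi F hF F' hF' hpos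
      obtain ⟨x, hx, hx'⟩ := exists_mem_relFace hd hpos
      have hn := normal_eq_neg hd (M.disjoint_of_ne hi F.1 F'.1) hx hx'
      have e : ∀ x, c.penFun k Cstar (M.toBroken v) (M.toBroken v) i F i' F' x =
          c.σ k Cstar i i' * (b i - b i') ^ 2 := fun x => by
        have : M.jump (M.toBroken v) i F i' F' x = (b i - b i') • normal (M.T i F.1) F.2 := by
          rw [jump, nrm, nrm, hn, toBroken, toBroken, hvb, hvb, smul_neg, sub_smul, sub_eq_add_neg]
        rw [penFun, this, real_inner_self_eq_norm_sq, norm_smul, norm_normal _ hd, mul_one,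
          Real.norm_eq_abs, sq_abs]
      have h2 := (integral_congr_ae (Eventually.of_forall e)).symm.trans (hint i i' hi F hF F' hF')
      rw [setIntegral_const, smul_eq_mul, measureReal_def] at h2
      have hμ : (μHE[d - 1] (M.face i F ∩ M.face i' F' ∩ M.Ω)).toReal ≠ 0 :=
        ENNReal.toReal_ne_zero.2 ⟨hpos, ((measure_mono (interior_piece_subset i i' F F')).trans_lt
          (hausdorff_face_ne_top hd i F).lt_top).ne⟩
      have h3 := (mul_eq_zero.1 ((mul_eq_zero.1 h2).resolve_left hμ)).resolve_left (hσ' i i').ne'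
      exact sub_eq_zero.1 (pow_eq_zero_iff two_ne_zero |>.1 h3)
    · intro i F hF hpos
      have e : ∀ x, c.penBd k Cstar (M.toBroken v) (M.toBroken v) i F x =
          c.σBd k Cstar i * b i ^ 2 := fun x => by
        rw [penBd, real_inner_self_eq_norm_sq, norm_jumpBd_sq hd, toBroken, hvb]
      have h2 := (integral_congr_ae (Eventually.of_forall e)).symm.trans (hbdy i F hF)
      rw [setIntegral_const, smul_eq_mul, measureReal_def] at h2
      have hμ : (μHE[d - 1] (M.face i F ∩ frontier M.Ω)).toReal ≠ 0 :=
        ENNReal.toReal_ne_zero.2 ⟨hpos, ((measure_mono Set.inter_subset_left).trans_lt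
          (hausdorff_face_ne_top hd i F).lt_top).ne⟩
      have h3 := (mul_eq_zero.1 ((mul_eq_zero.1 h2).resolve_left hμ)).resolve_left (hσ i).ne'
      exact pow_eq_zero_iff two_ne_zero |>.1 h3
  funext i x
  rw [hvb, hzero]
  rfl

end Coeff


/-! ### Unique solvability for Lipschitz, strongly monotone operators. -/

section Zarantonello

variable {V : Type*} [NormedAddCommGroup V] [InnerProductSpace ℝ V] [FiniteDimensional ℝ V]

/-- Zarantonello's theorem: a Lipschitz continuous, strongly monotone operator is bijective. -/
theorem existsUnique_of_lipschitz_of_monotone {A : V → Module.Dual ℝ V} {L m : ℝ} (hL : 0 < L)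
    (hm : 0 < m) (hA : ∀ u w z, |A u z - A w z| ≤ L * ‖u - w‖ * ‖z‖)
    (hmono : ∀ u w, m * ‖u - w‖ ^ 2 ≤ A u (u - w) - A w (u - w)) (ℓ : Module.Dual ℝ V) :
    ∃! u, A u = ℓ := by
  have hcomplete : CompleteSpace V := FiniteDimensional.complete ℝ V
  set R : Module.Dual ℝ V → V := fun f =>
    (InnerProductSpace.toDual ℝ V).symm (LinearMap.toContinuousLinearMap f) with hR
  have hRi : ∀ f z, ⟪R f, z⟫ = f z := fun f z => by
    rw [hR, InnerProductSpace.toDual_symm_apply]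
    rfl
  -- This step size minimises `1 - 2 τ m + τ² L²`, the squared contraction factor of the damped
  -- Riesz iteration.
  set τ : ℝ := m / L ^ 2 with hτ
  have hτ0 : 0 < τ := by positivity
  set G : V → V := fun u => u - τ • R (A u - ℓ) with hG
  have hnorm : ∀ u w, ‖R (A u - ℓ) - R (A w - ℓ)‖ ≤ L * ‖u - w‖ := fun u w => by
    set r := R (A u - ℓ) - R (A w - ℓ) with hr
    have h1 : ‖r‖ ^ 2 = A u r - A w r := by
      rw [← real_inner_self_eq_norm_sq]
      nth_rewrite 1 [hr]
      rw [inner_sub_left, hRi, hRi, LinearMap.sub_apply, LinearMap.sub_apply]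
      ring
    have h2 : ‖r‖ ^ 2 ≤ L * ‖u - w‖ * ‖r‖ := h1 ▸ (le_abs_self _).trans (hA u w r)
    by_contra! h
    have h3 : 0 < ‖r‖ := (mul_nonneg hL.le (norm_nonneg _)).trans_lt h
    nlinarith
  have hcontr : ∀ u w, ‖G u - G w‖ ^ 2 ≤ (1 - m ^ 2 / L ^ 2) * ‖u - w‖ ^ 2 := fun u w => by
    have e : G u - G w = (u - w) - τ • (R (A u - ℓ) - R (A w - ℓ)) := by
      simp only [hG, smul_sub]
      abel
    have h1 : ⟪u - w, R (A u - ℓ) - R (A w - ℓ)⟫ = A u (u - w) - A w (u - w) := by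
      rw [real_inner_comm, inner_sub_left, hRi, hRi, LinearMap.sub_apply, LinearMap.sub_apply]
      ring
    rw [e, norm_sub_sq_real, inner_smul_right, h1, norm_smul, Real.norm_of_nonneg hτ0.le, mul_pow]
    have h2 := mul_le_mul_of_nonneg_left (hmono u w) hτ0.le
    have h3 : ‖R (A u - ℓ) - R (A w - ℓ)‖ ^ 2 ≤ L ^ 2 * ‖u - w‖ ^ 2 := by
      rw [← mul_pow]
      exact pow_le_pow_left₀ (norm_nonneg _) (hnorm u w) 2
    have h4 := mul_le_mul_of_nonneg_left h3 (sq_nonneg τ)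
    have e1 : τ * (m * ‖u - w‖ ^ 2) = m ^ 2 / L ^ 2 * ‖u - w‖ ^ 2 := by rw [hτ]; field_simp
    have e2 : τ ^ 2 * (L ^ 2 * ‖u - w‖ ^ 2) = m ^ 2 / L ^ 2 * ‖u - w‖ ^ 2 := by
      rw [hτ]; field_simp
    linarith
  set q : ℝ := 1 - m ^ 2 / L ^ 2 with hq
  have hq1 : q < 1 := by have : 0 < m ^ 2 / L ^ 2 := by positivity
                         linarith
  -- The maximum covers a negative `q`, possible only on the trivial space, where `m ≤ L` is not
  -- forced.
  set K : NNReal := ⟨√(max q 0), Real.sqrt_nonneg _⟩ with hK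
  have hctr : ContractingWith K G := by
    refine ⟨?_, LipschitzWith.of_dist_le_mul fun u w => ?_⟩
    · rw [← NNReal.coe_lt_coe]
      change √(max q 0) < 1
      rw [Real.sqrt_lt' one_pos]
      simpa using hq1
    · rw [dist_eq_norm, dist_eq_norm]
      change _ ≤ √(max q 0) * _
      refine abs_le_of_sq_le_sq' ?_ (by positivity) |>.2
      rw [mul_pow, Real.sq_sqrt (le_max_right _ _)]
      exact (hcontr u w).trans (mul_le_mul_of_nonneg_right (le_max_left _ _) (sq_nonneg _))
  refine ⟨ContractingWith.fixedPoint G hctr, ?_, fun w hw => ?_⟩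
  · have h1 : G (ContractingWith.fixedPoint G hctr) = _ := hctr.fixedPoint_isFixedPt
    set u := ContractingWith.fixedPoint G hctr
    have h2 : τ • R (A u - ℓ) = 0 := by
      have : u - τ • R (A u - ℓ) = u := h1
      exact sub_eq_self.1 this
    have h3 := (smul_eq_zero.1 h2).resolve_left hτ0.ne'
    ext z
    have h4 := hRi (A u - ℓ) z
    rw [h3, inner_zero_left, LinearMap.sub_apply] at h4
    linarith
  · refine hctr.fixedPoint_unique ?_
    have hw' : A w = ℓ := hw
    change w - τ • R (A w - ℓ) = w
    rw [hw', sub_self]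
    have : R 0 = 0 := by rw [hR]; simp
    rw [this, smul_zero, sub_zero]

/-- The nonlinearity is a scalar 1-Lipschitz function of finitely many functionals, all bounded in
finite dimension; no explicit constant is needed. -/
theorem exists_lipschitz_const {ι : Type*} [Fintype ι] (S : V →ₗ[ℝ] Module.Dual ℝ V)
    (e P : ι → Module.Dual ℝ V) {g : ℝ → ℝ} (hg : ∀ a b, |g a - g b| ≤ |a - b|)
    {A : V → Module.Dual ℝ V} (hA : ∀ u z, A u z = S u z + ∑ n, g (e n u) * P n z) :
    ∃ L : ℝ, 0 < L ∧ ∀ u w z, |A u z - A w z| ≤ L * ‖u - w‖ * ‖z‖ := by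
  have hb : ∀ (f : Module.Dual ℝ V) z, |f z| ≤ ‖LinearMap.toContinuousLinearMap f‖ * ‖z‖ :=
    fun f z => (LinearMap.toContinuousLinearMap f).le_opNorm z
  set Sc := S.toContinuousBilinearMap
  have hS : ∀ u z, |S u z| ≤ ‖Sc‖ * ‖u‖ * ‖z‖ := fun u z => Sc.le_opNorm₂ u z
  set ce : ι → ℝ := fun n => ‖LinearMap.toContinuousLinearMap (e n)‖
  set cP : ι → ℝ := fun n => ‖LinearMap.toContinuousLinearMap (P n)‖
  have hs : 0 ≤ ∑ n, ce n * cP n :=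
    Finset.sum_nonneg fun n _ => mul_nonneg (norm_nonneg _) (norm_nonneg _)
  refine ⟨‖Sc‖ + ∑ n, ce n * cP n + 1, by positivity, fun u w z => ?_⟩
  have e1 : A u z - A w z = S (u - w) z + ∑ n, (g (e n u) - g (e n w)) * P n z := by
    rw [hA, hA, map_sub, LinearMap.sub_apply]
    simp only [sub_mul, Finset.sum_sub_distrib]
    ring
  rw [e1]
  have h1 : |∑ n, (g (e n u) - g (e n w)) * P n z| ≤
      (∑ n, ce n * cP n) * ‖u - w‖ * ‖z‖ := by
    refine (Finset.abs_sum_le_sum_abs _ _).trans ?_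
    rw [Finset.sum_mul, Finset.sum_mul]
    refine Finset.sum_le_sum fun n _ => ?_
    rw [abs_mul]
    have h2 : |g (e n u) - g (e n w)| ≤ ce n * ‖u - w‖ := by
      refine (hg _ _).trans ?_
      rw [← map_sub]
      exact hb _ _
    calc _ ≤ (ce n * ‖u - w‖) * (cP n * ‖z‖) :=
          mul_le_mul h2 (hb _ _) (abs_nonneg _) (mul_nonneg (norm_nonneg _) (norm_nonneg _))
      _ = _ := by ring
  calc _ ≤ ‖Sc‖ * ‖u - w‖ * ‖z‖ + (∑ n, ce n * cP n) * ‖u - w‖ * ‖z‖ :=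
        (abs_add_le _ _).trans (add_le_add (hS _ _) h1)
    _ ≤ _ := by
        have : 0 ≤ ‖u - w‖ * ‖z‖ := by positivity
        nlinarith

end Zarantonello

section FormNorm

variable {V : Type*} [AddCommGroup V] [Module ℝ V]

/-- The inner product defined by a symmetric positive definite bilinear form. -/
@[reducible] def coreOfForm (B : LinearMap.BilinForm ℝ V) (hsymm : ∀ u w, B u w = B w u)
    (hnn : ∀ u, 0 ≤ B u u) (hdef : ∀ u, B u u = 0 → u = 0) : InnerProductSpace.Core ℝ V where
  inner u w := B u w
  conj_inner_symm u w := by simpa using hsymm w u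
  re_inner_nonneg u := by simpa using hnn u
  add_left u w z := by simp
  smul_left u w r := by simp
  definite := hdef

/-- Well-posedness for a perturbation of a linear operator by a nonlinearity acting on finitely
many linear functionals. -/
theorem wellPosed_of_monotone [FiniteDimensional ℝ V] (B : LinearMap.BilinForm ℝ V)
    (hsymm : ∀ u w, B u w = B w u) (hnn : ∀ u, 0 ≤ B u u) (hdef : ∀ u, B u u = 0 → u = 0)
    {ν : V → ℝ} (hν : ∀ u, ν u = √(B u u))
    {ι : Type*} [Fintype ι] (S : V →ₗ[ℝ] Module.Dual ℝ V)
    (e P : ι → Module.Dual ℝ V) {g : ℝ → ℝ} (hg : ∀ a b, |g a - g b| ≤ |a - b|)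
    {A : V → Module.Dual ℝ V} (hA : ∀ u z, A u z = S u z + ∑ n, g (e n u) * P n z)
    {m : ℝ} (hm : 0 < m) (hmono : ∀ u w, m * ν (u - w) ^ 2 ≤ A u (u - w) - A w (u - w)) :
    IsContinuousOp ν A ∧ IsStronglyMonotone ν A ∧ ∀ ℓ : Module.Dual ℝ V, ∃! u, A u = ℓ := by
  -- The Hilbert structure is introduced locally, so that `ν` becomes its norm.
  let core := coreOfForm B hsymm hnn hdef
  let _ : NormedAddCommGroup V := core.toNormedAddCommGroup
  let _ : InnerProductSpace ℝ V := InnerProductSpace.ofCore core.toCore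
  have hν' : ∀ u, ν u = ‖u‖ := fun u => by
    rw [hν, norm_eq_sqrt_real_inner]
    rfl
  obtain ⟨L, hL, hLip⟩ := exists_lipschitz_const S e P hg hA
  simp only [hν'] at hmono
  refine ⟨fun u ε hε => ⟨ε / L, by positivity, fun w hw z => ?_⟩, ⟨m, hm, ?_⟩, ?_⟩
  · rw [hν'] at hw ⊢
    refine (hLip w u z).trans (mul_le_mul_of_nonneg_right ?_ (norm_nonneg _))
    rw [lt_div_iff₀ hL] at hw
    linarith
  · simpa only [hν'] using hmono
  · exact existsUnique_of_lipschitz_of_monotone hL hm hLip hmono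

end FormNorm


/-! ### The operator in terms of nodal values, and well-posedness. -/

namespace PolytopicMesh

variable {d k : ℕ} {M : PolytopicMesh d}

instance finiteDimensional_VP (M : PolytopicMesh d) (k : ℕ) : FiniteDimensional ℝ (M.VP k) := by
  let f : M.VP k →ₗ[ℝ] (Fin M.N → polys d k) :=
    { toFun := fun v i => ⟨v.1 i, mem_VP.1 v.2 i⟩
      map_add' := fun _ _ => rfl
      map_smul' := fun _ _ => rfl }
  refine Module.Finite.of_injective f fun v w h => Subtype.ext (funext fun i => ?_)
  exact congrArg Subtype.val (congrFun h i)

/-- The Lagrange nodes of all simplices of the submesh. -/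
abbrev NodeIdx (M : PolytopicMesh d) (k : ℕ) : Type :=
  (Σ i : Fin M.N, Fin (M.n i)) × nodeIdx d k

/-- The value at a Lagrange node, as a linear functional. -/
noncomputable def nodeEval (n : M.NodeIdx k) : Module.Dual ℝ (M.VP k) where
  toFun v := v.1 n.1.1 (node (M.T n.1.1 n.1.2) k n.2)
  map_add' _ _ := rfl
  map_smul' _ _ := rfl

open Classical in
/-- The Lagrange basis functions of the simplices, extended by zero. -/
noncomputable def nodeBasis (n : M.NodeIdx k) : M.BP k :=
  ⟨fun i t => if n.1 = ⟨i, t⟩ then lagrange (M.T i t) k n.2 else 0, fun i t => by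
    dsimp only
    split_ifs
    · exact lagrange_mem_polys _ n.2.2
    · exact Submodule.zero_mem _⟩

theorem plus_eq_sum (hk : 1 ≤ k) (κ : ℝ) (v : M.VP k) :
    M.plus hk κ v = ∑ n : M.NodeIdx k, clip κ (nodeEval n v) • nodeBasis n := by
  refine Subtype.ext (funext fun i => funext fun t => funext fun x => ?_)
  have e : ((∑ n : M.NodeIdx k, clip κ (nodeEval n v) • nodeBasis n : M.BP k) : M.Broken) i t x =
      ∑ n : M.NodeIdx k, clip κ (nodeEval n v) * (nodeBasis n).1 i t x := by
    rw [Submodule.coe_sum, Finset.sum_apply, Finset.sum_apply, Finset.sum_apply]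
    rfl
  rw [e, Fintype.sum_prod_type, Finset.sum_eq_single (⟨i, t⟩ : Σ i : Fin M.N, Fin (M.n i))]
  · change M.Eplus k κ v i t x = _
    rw [Eplus_apply, ← Finset.sum_coe_sort]
    refine Finset.sum_congr rfl fun a _ => ?_
    simp [nodeBasis, nodeEval]
  · intro n _ hn
    refine Finset.sum_eq_zero fun a _ => ?_
    simp [nodeBasis, hn]
  · exact fun h => absurd (Finset.mem_univ _) h

end PolytopicMesh

namespace Coeff

open PolytopicMesh

variable {d k : ℕ} {M : PolytopicMesh d} (c : Coeff M) {Cstar Csh χ C γ θ κ : ℝ}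

/-- Substituting `E⁻(u) = u - E⁺(u)` gives `s(u, ·)`, linear in `u`, plus the form `a_DG - s`
applied to `E⁺(u)`, which depends on `u` through truncated nodal values only. -/
theorem operator_eq_sum (hd : 1 ≤ d) (hk : 1 ≤ k) (α : Fin M.N → ℝ) (u z : M.VP k) :
    c.operator hd hk Cstar θ κ α u z =
      ((c.stabForm k α).compl₁₂ (incl M k) (incl M k)) u z +
      ∑ n : M.NodeIdx k, clip κ (nodeEval n u) *
        ((c.ipForm hd k Cstar θ - c.stabForm k α) (nodeBasis n)).comp (incl M k) z := by
  have e : M.minus hk κ u = incl M k u - M.plus hk κ u :=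
    eq_sub_of_add_eq' (plus_add_minus hk κ u)
  rw [operator, e, plus_eq_sum]
  simp only [map_sub, map_sum, map_smul, LinearMap.add_apply, LinearMap.comp_apply,
    LinearMap.sub_apply, LinearMap.coe_sum, Finset.sum_apply, LinearMap.smul_apply, smul_eq_mul,
    LinearMap.compl₁₂_apply, mul_sub, Finset.sum_sub_distrib]
  ring

/-- The load functional `v ↦ ∫ f v`. -/
noncomputable def load {f : E d → ℝ} (hf : MemLp f 2 (volume.restrict M.Ω)) (k : ℕ) :
    Module.Dual ℝ (M.VP k) :=
  have hint : ∀ (v : M.VP k) i, IntegrableOn (fun x => f x * v.1 i x) (M.K i) := fun v i => by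
    have : IsFiniteMeasure (volume.restrict (M.K i)) :=
      ⟨by rw [Measure.restrict_apply_univ]; exact (M.volume_K_ne_top i).lt_top⟩
    have h1 : IntegrableOn f (M.K i) :=
      (hf.mono_measure (M.restrict_K_le i)).integrable one_le_two
    exact h1.mul_continuousOn (continuous_of_mem_polys (mem_VP.1 v.2 i)).continuousOn
      (M.isCompact_K i)
  { toFun := fun v => ∑ i, ∫ x in M.K i, f x * v.1 i x
    map_add' := fun v w => by
      rw [← Finset.sum_add_distrib]
      refine Finset.sum_congr rfl fun i _ => ?_
      rw [← integral_add (hint v i) (hint w i)]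
      exact integral_congr_ae (Eventually.of_forall fun x => mul_add _ _ _)
    map_smul' := fun a v => by
      rw [RingHom.id_apply, smul_eq_mul, Finset.mul_sum]
      refine Finset.sum_congr rfl fun i _ => ?_
      rw [← integral_const_mul]
      exact integral_congr_ae (Eventually.of_forall fun x => mul_left_comm _ _ _) }

theorem operator_wellPosed (hd : 1 ≤ d) (hd3 : d ≤ 3) (hk : 1 ≤ k) (hCs : 0 < Cstar)
    (hM : Admissible M c Cstar Csh χ) (hC : 0 < C) (hE : c.IsEquivConst k Cstar C)
    (hγ : 25 * C ≤ γ) (hθ : θ ∈ Set.Icc (-1 : ℝ) 1) :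
    IsContinuousOp (fun v : M.VP k => c.dgNorm k Cstar (M.toBroken v))
        (c.operator hd hk Cstar θ κ (alphaChoice M Cstar γ)) ∧
      IsStronglyMonotone (fun v : M.VP k => c.dgNorm k Cstar (M.toBroken v))
        (c.operator hd hk Cstar θ κ (alphaChoice M Cstar γ)) ∧
      ∀ ℓ : Module.Dual ℝ (M.VP k),
        ∃! u, c.operator hd hk Cstar θ κ (alphaChoice M Cstar γ) u = ℓ := by
  refine wellPosed_of_monotone ((c.dgForm hd k Cstar).compl₁₂ (incl M k) (incl M k))
    (fun u w => c.dgForm_comm hd _ _) (fun u => c.dgForm_self_nonneg hd hk hCs _)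
    (fun u hu => Subtype.ext ?_) (fun u => rfl)
    ((c.stabForm k (alphaChoice M Cstar γ)).compl₁₂ (incl M k) (incl M k))
    nodeEval (fun n => ((c.ipForm hd k Cstar θ - c.stabForm k (alphaChoice M Cstar γ))
      (nodeBasis n)).comp (incl M k)) (abs_clip_sub_le κ)
    (c.operator_eq_sum hd hk (alphaChoice M Cstar γ)) (m := 1 / 5) (by norm_num)
    (c.operator_strongly_monotone hd hd3 hk hCs hM hC hE hγ hθ)
  refine c.eq_zero_of_dgNorm_eq_zero hM hd hk hCs u.2 ?_
  have h : c.dgNorm k Cstar (M.toBroken u) =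
      √((c.dgForm hd k Cstar).compl₁₂ (incl M k) (incl M k) u u) := rfl
  rw [h, hu, Real.sqrt_zero]

end Coeff

end BPDG

theorem theorem11 (d k : ℕ) (hd : d = 2 ∨ d = 3) (hk : 1 ≤ k)
    (Cstar Csh χ : ℝ) (hCstar : 0 < Cstar) (hCsh : 0 < Csh) (hχ : 0 < χ) :
    ∃ Cequiv : ℝ, 0 < Cequiv ∧
      ∀ (M : BPDG.PolytopicMesh d) (c : BPDG.Coeff M), BPDG.Admissible M c Cstar Csh χ →
        c.IsEquivConst k Cstar Cequiv ∧
        ∀ C : ℝ, 0 < C → c.IsEquivConst k Cstar C →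
        ∀ γ : ℝ, 25 * C ≤ γ →
        ∀ θ : ℝ, θ ∈ Set.Icc (-1 : ℝ) 1 →
        ∀ κ : ℝ, 0 < κ →
          (∀ v : M.VP k, c.dgNorm k Cstar (M.toBroken v) = 0 → v = 0) ∧
          ∃ T : M.VP k → Module.Dual ℝ (M.VP k),
            (∀ u v : M.VP k, T u v = c.ah k Cstar θ κ (BPDG.alphaChoice M Cstar γ) u v) ∧
            BPDG.IsContinuousOp (fun v : M.VP k => c.dgNorm k Cstar (M.toBroken v)) T ∧
            BPDG.IsStronglyMonotone (fun v : M.VP k => c.dgNorm k Cstar (M.toBroken v)) T ∧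
            (∀ ℓ : Module.Dual ℝ (M.VP k), ∃! u : M.VP k, T u = ℓ) ∧
            (∀ f : BPDG.E d → ℝ, MeasureTheory.MemLp f 2 (MeasureTheory.volume.restrict M.Ω) →
              ∃! u : M.VP k, ∀ v : M.VP k,
                c.ah k Cstar θ κ (BPDG.alphaChoice M Cstar γ) u v
                  = ∑ i, ∫ x in M.K i, f x * (v : Fin M.N → BPDG.E d → ℝ) i x) := by
  have hd1 : 1 ≤ d := by omega
  have hd2 : 2 ≤ d := by omega
  have hd3 : d ≤ 3 := by omega
  obtain ⟨Cequiv, hpos, hequiv⟩ := BPDG.Coeff.exists_isEquivConst hd2 hk hCstar hCsh hχ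
  refine ⟨Cequiv, hpos, fun M c hM => ⟨hequiv M c hM, fun C hC hE γ hγ θ hθ κ _ => ?_⟩⟩
  obtain ⟨hcont, hmono, hex⟩ := c.operator_wellPosed (κ := κ) hd1 hd3 hk hCstar hM hC hE hγ hθ
  refine ⟨fun v hv => Subtype.ext (c.eq_zero_of_dgNorm_eq_zero hM hd1 hk hCstar v.2 hv),
    c.operator hd1 hk Cstar θ κ (BPDG.alphaChoice M Cstar γ), fun u v => rfl, hcont, hmono, hex,
    fun f hf => ?_⟩
  obtain ⟨u, hu, huniq⟩ := hex (BPDG.Coeff.load hf k)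
  exact ⟨u, fun v => LinearMap.congr_fun hu v, fun w hw => huniq w (LinearMap.ext hw)⟩
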